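/- Let $A\in C^2(\mathbb R)$ be strictly convex, let $C_L>C_R$, and put $$S_0(x)=\begin{cases}C_L,&x<0,\\ C_R,&x\ge 0,\end{cases}\qquad \sigma=\frac{A(C_L)-A(C_R)}{C_L-C_R}.$$ For $\varepsilon>0$ and $U_0\in L^\infty(\mathbb R)$ consider $$\partial_tU+\partial_xA(U)=\varepsilon\,\partial_{xx}^2U\quad(t>0,\ x\in\mathbb R),\qquad U(0,\cdot)=U_0. \tag{1}$$ A solution of (1) is a function $U$ that is bounded on $(0,\tau)\times\mathbb R$ for every $\tau>0$, has continuous derivatives $\partial_tU,\partial_xU,\partial^2_{xx}U$ on $(0,\infty)\times\mathbb R$, satisfies the equation there, and for which $U(t)\to U_0$ in $L^1_{loc}(\mathbb R)$ as $t\downarrow0$. For all $M,K\ge 0$ there is $\varepsilon_0>0$, depending only on $A,C_L,C_R,M,K$, and for every $T>0$ there is $C^*>0$, depending only on the same data and $T$, such that the following holds. Let $U_0\in L^\infty(\mathbb R)\cap BV_{loc}(\mathbb R)$ satisfy $\|U_0\|_{L^\infty}\le M$, $U_0-S_0\in L^2(\mathbb R)$, and $(\frac{d}{dx}U_0)_+\in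 L^2(\mathbb R)$ with $\|(\frac{d}{dx}U_0)_+\|_{L^2}\le K$, where $(\frac{d}{dx}U_0)_+$ is the positive part of the Radon measure $\frac{d}{dx}U_0$. Then for every $0<\varepsilon\le\varepsilon_0$ and every solution $U$ of (1) there is a continuous curve $X:[0,T]\to\mathbb R$, differentiable on $(0,T)$, with $X(0)=0$, such that for all $0<t<T$, $U(t)-S_0(\cdot-X(t))\in L^2(\mathbb R)$ and $$\|U(t)-S_0(\cdot-X(t))\|_{L^2(\mathbb R)}^2\le\|U_0-S_0\|_{L^2(\mathbb R)}^2+C^*\varepsilon\log(1/\varepsilon),$$ $$|\dot X(t)|\le C^*,\qquad |X(t)-\sigma t|^2\le C^*t^{2/3}\left(\|U_0-S_0\|_{L^2(\mathbb R)}^2+\varepsilon\log(1/\varepsilon)\right).$$ -/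

import Mathlib

open MeasureTheory Set Filter Topology
open scoped ENNReal ContDiff

noncomputable section

/-- The stationary profile of a shock: `C_L` on `(-∞, 0)` and `C_R` on `[0, ∞)`. -/
def shockProfile (C_L C_R : ℝ) (x : ℝ) : ℝ := if x < 0 then C_L else C_R

/-- The Rankine–Hugoniot speed of the shock. -/
def shockSpeed (A : ℝ → ℝ) (C_L C_R : ℝ) : ℝ := (A C_L - A C_R) / (C_L - C_R)

/-- `u` is in `BV_loc(ℝ)` and `μ - ν` is the Jordan decomposition of its distributional
derivative: `μ` and `ν` are Radon measures, they are mutually singular, and `u' = μ - ν` in the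
sense of distributions. Hence `μ` is the positive part of `u'`. -/
structure HasJordanDerivative (u : ℝ → ℝ) (μ ν : Measure ℝ) : Prop where
  locallyIntegrable : LocallyIntegrable u volume
  locallyFinite_pos : IsLocallyFiniteMeasure μ
  locallyFinite_neg : IsLocallyFiniteMeasure ν
  mutuallySingular : μ ⟂ₘ ν
  integral_by_parts : ∀ φ : ℝ → ℝ, ContDiff ℝ ∞ φ → HasCompactSupport φ →
    -∫ x, u x * deriv φ x = ∫ x, φ x ∂μ - ∫ x, φ x ∂ν

/-- `g` is the density of the positive part of the distributional derivative of `u`, that is,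
`u` is in `BV_loc(ℝ)` and `(du/dx)_+ = g dx`. -/
def IsDerivPosPart (u g : ℝ → ℝ) : Prop :=
  AEMeasurable g volume ∧ 0 ≤ᵐ[volume] g ∧
    ∃ ν : Measure ℝ, HasJordanDerivative u (volume.withDensity fun x => ENNReal.ofReal (g x)) ν

/-- `U t x` is a solution of `∂ₜU + ∂ₓA(U) = ε ∂ₓₓU` for `t > 0`, `x ∈ ℝ`, with initial value `U₀`:
it is bounded on bounded time intervals, it is classical (`C¹` in `t` and `C²` in `x`) for `t > 0`,
and it takes its initial value in `L¹_loc`. -/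
structure IsViscousSolution (A : ℝ → ℝ) (ε : ℝ) (U₀ : ℝ → ℝ) (U : ℝ → ℝ → ℝ) : Prop where
  bounded : ∀ T : ℝ, ∃ M : ℝ, ∀ t ∈ Ioo 0 T, ∀ x, |U t x| ≤ M
  differentiable_t : ∀ t > 0, ∀ x, DifferentiableAt ℝ (fun s => U s x) t
  differentiable_x : ∀ t > 0, Differentiable ℝ (U t)
  differentiable_xx : ∀ t > 0, Differentiable ℝ (deriv (U t))
  continuous_t : ContinuousOn (fun p : ℝ × ℝ => deriv (fun s => U s p.2) p.1) (Ioi 0 ×ˢ univ)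
  continuous_x : ContinuousOn (fun p : ℝ × ℝ => deriv (U p.1) p.2) (Ioi 0 ×ˢ univ)
  continuous_xx : ContinuousOn (fun p : ℝ × ℝ => deriv (deriv (U p.1)) p.2) (Ioi 0 ×ˢ univ)
  equation : ∀ t > 0, ∀ x,
    deriv (fun s => U s x) t + deriv (fun y => A (U t y)) x = ε * deriv (deriv (U t)) x
  initial : ∀ R : ℝ, Tendsto (fun t => ∫ x in Icc (-R) R, |U t x - U₀ x|) (𝓝[>] 0) (𝓝 0)

/-- The square of the `L²(ℝ)` norm (meaningful for functions in `L²`). -/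
def sqL2Norm (f : ℝ → ℝ) : ℝ := (eLpNorm f 2 volume).toReal ^ 2

end

/-! ### Differentiation under the integral sign over a compact set -/

/-! The proof is a relative entropy argument for quadratic entropies, carried out separately on the
two sides of a moving point `X t`. The entropy `(u - c) ^ 2` has the flux `(u - c) ^ 2 * meanSpeed
(deriv A) c u`, so the energy relative to a state `c` travels with a mean characteristic speed that
increases with `c` and with `u`. By strict convexity the speed for `C_L` exceeds the speed for `C_R`
by at least `4 * θ`, uniformly for bounded `u` (`exists_meanSpeed_gap`). If `X` follows the average
of the two speeds at `U t (X t)`, then the energy relative to `C_L` on the left leaves through `X`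
to the right, and the energy relative to `C_R` on the right leaves to the left. Without viscosity
neither would grow.

Viscosity forbids sharp half lines as weights. Each is replaced by a logistic layer of width `ε /
θ`, centered at a distance `δ` of order `ε * log (1 / ε)` inside its half line. The viscous term
created by the layer is at most `θ` times its slope and is beaten by transport wherever the speed
margin is at least `θ`. The slope outside the region where the margin is known produces energy at a
rate of order `ε`, and exchanging layers for half lines costs a multiple of `δ` (`layer_energy_le`,
`sqL2Norm_sub_shift_le`).

The margin is needed over a fixed distance `h₀` from `X t`, not only at `X t`. Since the speeds
increase with `u`, only an increase of `U` from left to right can spoil it, so a bound `U t (x + h)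
- U t x ≤ c₁` for `0 < h < h₀` suffices. At the initial time it follows from the `L²` bound on the
positive part of the derivative by Cauchy-Schwarz (`increment_le_of_isDerivPosPart`). The equation
preserves it (`increment_le`): a truncated cube of the increments is integrated over `x` and over
the distance `h` with the weight `h₀ - h`, and convexity of `A` gives the transport in `h` a
favourable sign (`leftFlux_le_rightFlux`). No decay at infinity is available a priori, so all
balances are localized by a cutoff whose error vanishes as its radius grows.

The position of `X` comes from the mass balance against a plateau of width proportional to `t`:
moving the jump changes the mass by `(C_L - C_R) * X t`, the flux of the profile gives the
Rankine-Hugoniot term, and the remainder is at most a multiple of `√t` times the `L²` distance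
(`exists_sq_shift_sub_le`). This covers `ε ≤ t`; for `t < ε` bounded speeds are enough. -/

theorem hasDerivAt_setIntegral_of_continuousOn {E : Type*} [MetricSpace E]
    [SecondCountableTopology E] [MeasurableSpace E] [BorelSpace E] {μ : Measure E}
    [IsFiniteMeasureOnCompacts μ] {k : Set E} (hk : IsCompact k) {I : Set ℝ} (hI : IsOpen I)
    {F F' : ℝ → E → ℝ} (hF : ∀ t ∈ I, ContinuousOn (F t) k)
    (hF' : ContinuousOn (fun p : ℝ × E => F' p.1 p.2) (I ×ˢ k))
    (hd : ∀ t ∈ I, ∀ x ∈ k, HasDerivAt (fun s => F s x) (F' t x) t) {t : ℝ} (ht : t ∈ I) :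
    HasDerivAt (fun s => ∫ x in k, F s x ∂μ) (∫ x in k, F' t x ∂μ) t := by
  obtain ⟨r, hr, hrI⟩ := Metric.isOpen_iff.1 hI t ht
  have hsub : Metric.closedBall t (r / 2) ⊆ I :=
    (Metric.closedBall_subset_ball (by linarith)).trans hrI
  have hcomp : IsCompact (Metric.closedBall t (r / 2) ×ˢ k) :=
    (isCompact_closedBall t (r / 2)).prod hk
  obtain ⟨C, hC⟩ := hcomp.exists_bound_of_continuousOn (hF'.mono (prod_mono hsub subset_rfl))
  have hslice : ContinuousOn (F' t) k :=
    hF'.comp (f := fun x => (t, x)) (by fun_prop) (fun x hx => ⟨ht, hx⟩)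
  refine (hasDerivAt_integral_of_dominated_loc_of_deriv_le (bound := fun _ => C)
    (Metric.closedBall_mem_nhds t (by positivity : 0 < r / 2)) ?_
    ((hF t ht).integrableOn_compact hk)
    (hslice.aestronglyMeasurable hk.measurableSet) ?_ ?_ ?_).2
  · filter_upwards [hI.mem_nhds ht] with s hs
    exact (hF s hs).aestronglyMeasurable hk.measurableSet
  · filter_upwards [ae_restrict_mem hk.measurableSet] with x hx s hs
    exact hC (s, x) ⟨hs, hx⟩
  · exact continuousOn_const.integrableOn_compact hk
  · filter_upwards [ae_restrict_mem hk.measurableSet] with x hx s hs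
    exact hd s (hsub hs) x hx

theorem hasDerivAt_intervalIntegral_of_continuousOn {a b : ℝ} (hab : a ≤ b) {I : Set ℝ}
    (hI : IsOpen I) {F F' : ℝ → ℝ → ℝ} (hF : ∀ t ∈ I, ContinuousOn (F t) (Icc a b))
    (hF' : ContinuousOn (fun p : ℝ × ℝ => F' p.1 p.2) (I ×ˢ Icc a b))
    (hd : ∀ t ∈ I, ∀ x ∈ Icc a b, HasDerivAt (fun s => F s x) (F' t x) t) {t : ℝ} (ht : t ∈ I) :
    HasDerivAt (fun s => ∫ x in a..b, F s x) (∫ x in a..b, F' t x) t := by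
  simp only [intervalIntegral.integral_of_le hab, ← integral_Icc_eq_integral_Ioc]
  exact hasDerivAt_setIntegral_of_continuousOn isCompact_Icc hI hF hF' hd ht

/-! ### Regularity of viscous solutions -/

namespace IsViscousSolution

variable {A : ℝ → ℝ} {ε : ℝ} {U₀ : ℝ → ℝ} {U : ℝ → ℝ → ℝ}

theorem hasDerivAt_time (h : IsViscousSolution A ε U₀ U) {t : ℝ} (ht : 0 < t) (x : ℝ) :
    HasDerivAt (fun s => U s x) (deriv (fun s => U s x) t) t :=
  (h.differentiable_t t ht x).hasDerivAt

theorem hasDerivAt_space (h : IsViscousSolution A ε U₀ U) {t : ℝ} (ht : 0 < t) (x : ℝ) :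
    HasDerivAt (U t) (deriv (U t) x) x :=
  (h.differentiable_x t ht x).hasDerivAt

theorem hasDerivAt_space_space (h : IsViscousSolution A ε U₀ U) {t : ℝ} (ht : 0 < t) (x : ℝ) :
    HasDerivAt (deriv (U t)) (deriv (deriv (U t)) x) x :=
  (h.differentiable_xx t ht x).hasDerivAt

theorem continuous_slice (h : IsViscousSolution A ε U₀ U) {t : ℝ} (ht : 0 < t) :
    Continuous (U t) :=
  (h.differentiable_x t ht).continuous

theorem continuous_deriv_slice (h : IsViscousSolution A ε U₀ U) {t : ℝ} (ht : 0 < t) :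
    Continuous (deriv (U t)) :=
  (h.differentiable_xx t ht).continuous

theorem continuous_deriv_deriv_slice (h : IsViscousSolution A ε U₀ U) {t : ℝ} (ht : 0 < t) :
    Continuous (deriv (deriv (U t))) := by
  rw [← continuousOn_univ]
  exact h.continuous_xx.comp (f := fun x => (t, x)) (by fun_prop) (fun x _ => ⟨ht, mem_univ _⟩)

/-- A local bound of the space derivative away from the initial time. -/
theorem exists_lipschitz_bound (h : IsViscousSolution A ε U₀ U) {a : ℝ} (ha : 0 < a) (b R : ℝ) :
    ∃ C : NNReal, ∀ t ∈ Icc a b, LipschitzOnWith C (U t) (Icc (-R) R) := by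
  have hc : IsCompact (Icc a b ×ˢ Icc (-R) R) := isCompact_Icc.prod isCompact_Icc
  obtain ⟨C, hC⟩ := hc.exists_bound_of_continuousOn
    (h.continuous_x.mono (prod_mono (fun t ht => lt_of_lt_of_le ha ht.1) (subset_univ _)))
  refine ⟨C.toNNReal, fun t ht => ?_⟩
  refine (convex_Icc (-R) R).lipschitzOnWith_of_nnnorm_deriv_le
    (fun x _ => h.differentiable_x t (lt_of_lt_of_le ha ht.1) x) (fun x hx => ?_)
  rw [← NNReal.coe_le_coe, coe_nnnorm]
  exact (hC (t, x) ⟨ht, hx⟩).trans (Real.le_coe_toNNReal C)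

/-- Joint continuity of `U` is not part of the notion of solution. It follows from continuity in
time at each point and a Lipschitz bound in space that is locally uniform in time. -/
theorem continuousOn_uncurry (h : IsViscousSolution A ε U₀ U) :
    ContinuousOn (fun p : ℝ × ℝ => U p.1 p.2) (Ioi 0 ×ˢ univ) := by
  rintro ⟨t, x⟩ ⟨ht, -⟩
  have ht : 0 < t := ht
  obtain ⟨C, hC⟩ := h.exists_lipschitz_bound (half_pos ht) (2 * t) (|x| + 1)
  have hcont : ContinuousOn (fun p : ℝ × ℝ => U p.1 p.2)
      (Icc (t / 2) (2 * t) ×ˢ Icc (-(|x| + 1)) (|x| + 1)) :=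
    continuousOn_prod_of_continuousOn_lipschitzOnWith' _ C (fun s hs => hC s hs)
      (fun y _ s hs => (h.differentiable_t s
        (lt_of_lt_of_le (half_pos ht) hs.1) y).continuousAt.continuousWithinAt)
  refine (hcont.continuousAt (prod_mem_nhds (Icc_mem_nhds (by linarith) (by linarith))
    (Icc_mem_nhds ?_ ?_))).continuousWithinAt
  · linarith [neg_abs_le x]
  · linarith [le_abs_self x]

theorem time_deriv_eq (h : IsViscousSolution A ε U₀ U) (hA : Differentiable ℝ A) {t : ℝ}
    (ht : 0 < t) (x : ℝ) :
    deriv (fun s => U s x) t =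
      -(deriv A (U t x) * deriv (U t) x) + ε * deriv (deriv (U t)) x := by
  have h1 := h.equation t ht x
  have h2 : HasDerivAt (fun y => A (U t y)) (deriv A (U t x) * deriv (U t) x) x :=
    (hA (U t x)).hasDerivAt.comp x (h.hasDerivAt_space ht x)
  rw [h2.deriv] at h1
  linarith

/-- The balance law of an entropy `η` with flux `q`, tested with a weight `ψ` which vanishes
together with its space derivative at the end points of `[-R, R]`. -/
theorem hasDerivAt_integral_entropy (h : IsViscousSolution A ε U₀ U) (hA : Differentiable ℝ A)
    {η η' η'' q : ℝ → ℝ}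
    (hη : ∀ u, HasDerivAt η (η' u) u) (hη' : ∀ u, HasDerivAt η' (η'' u) u)
    (hη'' : Continuous η'') (hq : ∀ u, HasDerivAt q (η' u * deriv A u) u)
    {T R : ℝ} (hR : 0 ≤ R) {ψ ψt ψx ψxx : ℝ → ℝ → ℝ}
    (hψt : ∀ t ∈ Ioo 0 T, ∀ x, HasDerivAt (fun s => ψ s x) (ψt t x) t)
    (hψx : ∀ t ∈ Ioo 0 T, ∀ x, HasDerivAt (ψ t) (ψx t x) x)
    (hψxx : ∀ t ∈ Ioo 0 T, ∀ x, HasDerivAt (ψx t) (ψxx t x) x)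
    (cψ : ContinuousOn (fun p : ℝ × ℝ => ψ p.1 p.2) (Ioo 0 T ×ˢ univ))
    (cψt : ContinuousOn (fun p : ℝ × ℝ => ψt p.1 p.2) (Ioo 0 T ×ˢ univ))
    (cψxx : ∀ t ∈ Ioo 0 T, Continuous (ψxx t))
    (hψR : ∀ t ∈ Ioo 0 T, ψ t R = 0 ∧ ψ t (-R) = 0)
    (hψxR : ∀ t ∈ Ioo 0 T, ψx t R = 0 ∧ ψx t (-R) = 0) {t : ℝ} (ht : t ∈ Ioo 0 T) :
    HasDerivAt (fun s => ∫ x in (-R)..R, ψ s x * η (U s x))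
      (∫ x in (-R)..R, (ψt t x * η (U t x) + ψx t x * q (U t x) + ε * (ψxx t x * η (U t x))
        - ε * (ψ t x * (η'' (U t x) * deriv (U t) x ^ 2)))) t := by
  have cη : Continuous η := continuous_iff_continuousAt.2 fun u => (hη u).continuousAt
  have cη' : Continuous η' := continuous_iff_continuousAt.2 fun u => (hη' u).continuousAt
  have cq : Continuous q := continuous_iff_continuousAt.2 fun u => (hq u).continuousAt
  have hsub : Ioo 0 T ×ˢ (univ : Set ℝ) ⊆ Ioi 0 ×ˢ univ :=
    prod_mono Ioo_subset_Ioi_self subset_rfl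
  have cU := h.continuousOn_uncurry.mono hsub
  have cUt := h.continuous_t.mono hsub
  have ht0 : 0 < t := ht.1
  have hmono : Ioo 0 T ×ˢ Icc (-R) R ⊆ Ioo 0 T ×ˢ (univ : Set ℝ) :=
    prod_mono subset_rfl (subset_univ _)
  have key := hasDerivAt_intervalIntegral_of_continuousOn (a := -R) (b := R) (by linarith)
    (isOpen_Ioo (a := (0 : ℝ)) (b := T)) (F := fun s x => ψ s x * η (U s x))
    (F' := fun s x => ψt s x * η (U s x) + ψ s x * (η' (U s x) * deriv (fun r => U r x) s))
    (fun s hs => by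
      have c1 : Continuous (ψ s) := continuous_iff_continuousAt.2 fun x => (hψx s hs x).continuousAt
      have c2 := h.continuous_slice hs.1
      exact (c1.mul (cη.comp c2)).continuousOn)
    ((by fun_prop : ContinuousOn (fun p : ℝ × ℝ => ψt p.1 p.2 * η (U p.1 p.2) +
      ψ p.1 p.2 * (η' (U p.1 p.2) * deriv (fun r => U r p.2) p.1)) (Ioo 0 T ×ˢ univ)).mono hmono)
    (fun s hs x _ => (hψt s hs x).mul ((hη _).comp s (h.hasDerivAt_time hs.1 x))) ht
  refine key.congr_deriv ?_
  have cUs := h.continuous_slice ht0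
  have cUx := h.continuous_deriv_slice ht0
  have cUxx := h.continuous_deriv_deriv_slice ht0
  have c1 : Continuous (ψ t) := continuous_iff_continuousAt.2 fun x => (hψx t ht x).continuousAt
  have c2 : Continuous (ψx t) := continuous_iff_continuousAt.2 fun x => (hψxx t ht x).continuousAt
  have c3 := cψxx t ht
  have c4 : Continuous (ψt t) := by
    rw [← continuousOn_univ]
    exact cψt.comp (f := fun x => (t, x)) (by fun_prop) (fun x _ => ⟨ht, mem_univ _⟩)
  have cUt' : Continuous fun x => deriv (fun r => U r x) t := by
    rw [← continuousOn_univ]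
    exact cUt.comp (f := fun x => (t, x)) (by fun_prop) (fun x _ => ⟨ht, mem_univ _⟩)
  -- By the equation, the differentiated integrand and the claimed one differ by an exact space
  -- derivative. Its primitive contains only terms with a factor `ψ` or `ψx`, so it vanishes at both
  -- end points.
  have hflux : ∀ x, HasDerivAt
      (fun x => -(ψ t x * q (U t x)) +
        ε * (ψ t x * (η' (U t x) * deriv (U t) x) - ψx t x * η (U t x)))
      ((ψt t x * η (U t x) + ψ t x * (η' (U t x) * deriv (fun r => U r x) t)) -
        (ψt t x * η (U t x) + ψx t x * q (U t x) + ε * (ψxx t x * η (U t x))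
        - ε * (ψ t x * (η'' (U t x) * deriv (U t) x ^ 2)))) x := by
    intro x
    have hU := h.hasDerivAt_space ht0 x
    have e1 := (hψx t ht x).mul ((hq _).comp x hU)
    have e2 := (hψx t ht x).mul (((hη' _).comp x hU).mul (h.hasDerivAt_space_space ht0 x))
    have e3 := (hψxx t ht x).mul ((hη _).comp x hU)
    refine (e1.neg.add ((e2.sub e3).const_mul ε)).congr_deriv ?_
    rw [h.time_deriv_eq hA ht0 x]
    simp only [Function.comp, Pi.mul_apply]
    ring
  have hint := intervalIntegral.integral_eq_sub_of_hasDerivAt (a := -R) (b := R)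
    (fun x _ => hflux x) (by
      apply Continuous.intervalIntegrable
      fun_prop)
  rw [(hψR t ht).1, (hψR t ht).2, (hψxR t ht).1, (hψxR t ht).2] at hint
  rw [intervalIntegral.integral_sub (by apply Continuous.intervalIntegrable; fun_prop)
    (by apply Continuous.intervalIntegrable; fun_prop)] at hint
  simp only [zero_mul, neg_zero, mul_zero, sub_zero, add_zero] at hint
  linarith

end IsViscousSolution

/-! ### A polynomial cutoff -/

/-- A cutoff on `[-r ^ 2, r ^ 2]` which tends to `1` as `r → ∞`. -/
noncomputable def cutoff (r x : ℝ) : ℝ := (1 - (x / r ^ 2) ^ 2) ^ 4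

/-- The derivative of `cutoff`. -/
noncomputable def cutoff' (r x : ℝ) : ℝ := -(8 * (1 - (x / r ^ 2) ^ 2) ^ 3 * (x / r ^ 2) / r ^ 2)

/-- The second derivative of `cutoff`. -/
noncomputable def cutoff'' (r x : ℝ) : ℝ :=
  (48 * (1 - (x / r ^ 2) ^ 2) ^ 2 * (x / r ^ 2) ^ 2 - 8 * (1 - (x / r ^ 2) ^ 2) ^ 3) / r ^ 4

theorem hasDerivAt_cutoff (r x : ℝ) : HasDerivAt (cutoff r) (cutoff' r x) x := by
  have h1 : HasDerivAt (fun x : ℝ => x / r ^ 2) (1 / r ^ 2) x := (hasDerivAt_id x).div_const _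
  refine (((h1.pow 2).const_sub 1).pow 4).congr_deriv ?_
  simp only [cutoff', Nat.cast_ofNat, Pi.pow_apply]
  ring

theorem hasDerivAt_cutoff' (r x : ℝ) : HasDerivAt (cutoff' r) (cutoff'' r x) x := by
  have h1 : HasDerivAt (fun x : ℝ => x / r ^ 2) (1 / r ^ 2) x := (hasDerivAt_id x).div_const _
  refine ((((((h1.pow 2).const_sub 1).pow 3).const_mul 8).mul h1).div_const
    (r ^ 2)).neg.congr_deriv ?_
  simp only [cutoff'', Nat.cast_ofNat, Pi.pow_apply]
  ring

theorem continuous_cutoff (r : ℝ) : Continuous (cutoff r) := by unfold cutoff; fun_prop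

theorem continuous_cutoff' (r : ℝ) : Continuous (cutoff' r) := by unfold cutoff'; fun_prop

theorem continuous_cutoff'' (r : ℝ) : Continuous (cutoff'' r) := by unfold cutoff''; fun_prop

theorem cutoff_nonneg (r x : ℝ) : 0 ≤ cutoff r x := by unfold cutoff; positivity

theorem cutoff_endpoints {r : ℝ} (hr : 0 < r) : cutoff r (r ^ 2) = 0 ∧ cutoff r (-r ^ 2) = 0 := by
  have : r ^ 2 ≠ 0 := by positivity
  constructor <;> simp [cutoff, neg_div, div_self this]

theorem cutoff'_endpoints {r : ℝ} (hr : 0 < r) :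
    cutoff' r (r ^ 2) = 0 ∧ cutoff' r (-r ^ 2) = 0 := by
  have : r ^ 2 ≠ 0 := by positivity
  constructor <;> simp [cutoff', neg_div, div_self this]

theorem abs_div_sq_le_one {r x : ℝ} (hr : 0 < r) (hx : x ∈ Icc (-r ^ 2) (r ^ 2)) :
    |x / r ^ 2| ≤ 1 := by
  rw [abs_div, abs_of_pos (by positivity : 0 < r ^ 2), div_le_one (by positivity)]
  exact abs_le.2 hx

theorem cutoff_le_one {r x : ℝ} (hr : 0 < r) (hx : x ∈ Icc (-r ^ 2) (r ^ 2)) :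
    cutoff r x ≤ 1 := by
  have h1 := abs_div_sq_le_one hr hx
  have h2 : (x / r ^ 2) ^ 2 ≤ 1 := (sq_le_one_iff_abs_le_one _).2 h1
  exact pow_le_one₀ (by linarith) (by linarith [sq_nonneg (x / r ^ 2)])

/-- With `s = 1 - (x / r ^ 2) ^ 2` both derivatives are of size `s ^ 2 / r ^ 2`, which is split by
`2 * s ^ 2 / r ^ 2 ≤ s ^ 4 / r + 1 / r ^ 3`. The first term is a multiple of the cutoff and is
absorbed by an exponential factor in time; the second has integral of order `1 / r` over an interval
of length `2 * r ^ 2`. The fourth power in the cutoff is chosen for this splitting. -/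
theorem cutoff_derivs_le {r x : ℝ} (hr : 1 ≤ r) (hx : x ∈ Icc (-r ^ 2) (r ^ 2)) :
    |cutoff' r x| + |cutoff'' r x| ≤ 32 * (cutoff r x / r + 1 / r ^ 3) := by
  have hr0 : 0 < r := by linarith
  have hy := abs_div_sq_le_one hr0 hx
  unfold cutoff' cutoff'' cutoff
  set y := x / r ^ 2
  have hy2 : y ^ 2 ≤ 1 := (sq_le_one_iff_abs_le_one _).2 hy
  set s := 1 - y ^ 2
  have hs0 : 0 ≤ s := by linarith
  have hs1 : s ≤ 1 := by linarith [sq_nonneg y]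
  have hs32 : s ^ 3 ≤ s ^ 2 := pow_le_pow_of_le_one hs0 hs1 (by norm_num)
  have e1 : |-(8 * s ^ 3 * y / r ^ 2)| ≤ 8 * s ^ 2 / r ^ 2 := by
    rw [abs_neg, abs_div, abs_mul, abs_of_nonneg (by positivity : 0 ≤ 8 * s ^ 3),
      abs_of_pos (by positivity : 0 < r ^ 2)]
    refine div_le_div_of_nonneg_right ?_ (by positivity)
    nlinarith [pow_nonneg hs0 3, abs_nonneg y]
  have e2 : |(48 * s ^ 2 * y ^ 2 - 8 * s ^ 3) / r ^ 4| ≤ 48 * s ^ 2 / r ^ 2 := by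
    rw [abs_div, abs_of_pos (by positivity : 0 < r ^ 4)]
    have h1 : |48 * s ^ 2 * y ^ 2 - 8 * s ^ 3| ≤ 48 * s ^ 2 := by
      rw [abs_le]
      constructor <;> nlinarith [sq_nonneg s, sq_nonneg y, mul_nonneg (sq_nonneg s) (sq_nonneg y),
        pow_nonneg hs0 3]
    have h2 : r ^ 2 ≤ r ^ 4 := pow_le_pow_right₀ hr (by norm_num)
    gcongr
  have e3 : 56 * s ^ 2 / r ^ 2 ≤ 32 * (s ^ 4 / r + 1 / r ^ 3) := by
    rw [div_add_div _ _ (by positivity) (by positivity), ← mul_div_assoc,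
      div_le_div_iff₀ (by positivity) (by positivity)]
    have : 0 ≤ r ^ 4 * (s ^ 2 * r - 1) ^ 2 := by positivity
    have h3 : 0 ≤ r ^ 4 * (s ^ 2 * r) := by positivity
    have h4 : 0 ≤ r ^ 3 * (s ^ 2 * r - 1) ^ 2 := by positivity
    have h5 : 0 ≤ r ^ 3 * (s ^ 2 * r) := by positivity
    have h6 : 0 ≤ r ^ 2 * (s ^ 2 * r - 1) ^ 2 := by positivity
    have h7 : 0 ≤ r ^ 2 * (s ^ 2 * r) := by positivity
    nlinarith
  calc _ ≤ 8 * s ^ 2 / r ^ 2 + 48 * s ^ 2 / r ^ 2 := add_le_add e1 e2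
    _ = 56 * s ^ 2 / r ^ 2 := by ring
    _ ≤ _ := e3

theorem quarter_le_cutoff {r x : ℝ} (hr : 0 < r) (hx : 2 * |x| ≤ r ^ 2) :
    1 / 4 ≤ cutoff r x := by
  have h1 : |x / r ^ 2| ≤ 1 / 2 := by
    rw [abs_div, abs_of_pos (by positivity : 0 < r ^ 2), div_le_iff₀ (by positivity)]
    linarith
  have h2 : (x / r ^ 2) ^ 2 ≤ 1 / 4 := by
    rw [← sq_abs]; nlinarith [abs_nonneg (x / r ^ 2)]
  have h3 : (3 / 4 : ℝ) ^ 4 ≤ cutoff r x := by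
    unfold cutoff
    gcongr
    linarith
  norm_num at h3 ⊢
  linarith

theorem tendsto_cutoff (x : ℝ) : Tendsto (fun r => cutoff r x) atTop (𝓝 1) := by
  have h1 : Tendsto (fun r : ℝ => x / r ^ 2) atTop (𝓝 0) :=
    tendsto_const_nhds.div_atTop (tendsto_pow_atTop (by norm_num))
  have h2 : Tendsto (fun r : ℝ => (1 - (x / r ^ 2) ^ 2) ^ 4) atTop (𝓝 ((1 - 0 ^ 2) ^ 4)) :=
    ((h1.pow 2).const_sub 1).pow 4
  simpa [cutoff] using h2

/-- A nonnegative continuous function whose cutoff integrals tend to zero vanishes. -/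
theorem eq_zero_of_integral_cutoff_le {F : ℝ → ℝ} (hF : Continuous F) (h0 : ∀ x, 0 ≤ F x) {C : ℝ}
    (hC : ∀ r, 1 ≤ r → ∫ x in (-r ^ 2)..(r ^ 2), cutoff r x * F x ≤ C / r) (x : ℝ) : F x = 0 := by
  by_contra hne
  have hpos : 0 < ∫ y in (x - 1)..(x + 1), F y :=
    intervalIntegral.integral_pos (by linarith) hF.continuousOn (fun y _ => h0 y)
      ⟨x, ⟨by linarith, by linarith⟩, lt_of_le_of_ne (h0 x) (Ne.symm hne)⟩
  have hbound : ∀ᶠ r : ℝ in atTop, ∫ y in (x - 1)..(x + 1), F y ≤ 4 * (C / r) := by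
    filter_upwards [eventually_ge_atTop (max 1 (2 * (|x| + 1)))] with r hr
    have hr1 : 1 ≤ r := (le_max_left _ _).trans hr
    have hr2 : 2 * (|x| + 1) ≤ r ^ 2 := ((le_max_right _ _).trans hr).trans (by nlinarith)
    have hxl := neg_abs_le x
    have hxr := le_abs_self x
    have e1 : ∫ y in (x - 1)..(x + 1), F y ≤ ∫ y in (x - 1)..(x + 1), 4 * (cutoff r y * F y) := by
      refine intervalIntegral.integral_mono_on (by linarith) (hF.intervalIntegrable _ _)
        ((continuous_const.mul ((continuous_cutoff r).mul hF)).intervalIntegrable _ _) ?_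
      intro y hy
      have hy' : |y| ≤ |x| + 1 := abs_le.2 ⟨by linarith [hy.1], by linarith [hy.2]⟩
      have := quarter_le_cutoff (by linarith : 0 < r) (x := y) (by linarith)
      nlinarith [h0 y]
    have e2 : ∫ y in (x - 1)..(x + 1), cutoff r y * F y ≤
        ∫ y in (-r ^ 2)..(r ^ 2), cutoff r y * F y := by
      refine intervalIntegral.integral_mono_interval (by linarith) (by linarith) (by linarith)
        (Eventually.of_forall fun y => mul_nonneg (cutoff_nonneg r y) (h0 y))
        (((continuous_cutoff r).mul hF).intervalIntegrable _ _)
    rw [intervalIntegral.integral_const_mul] at e1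
    linarith [hC r hr1]
  have hlim : Tendsto (fun r : ℝ => 4 * (C / r)) atTop (𝓝 (4 * 0)) :=
    (tendsto_const_nhds.div_atTop tendsto_id).const_mul 4
  have := ge_of_tendsto hlim hbound
  linarith

/-! ### Attainment of the initial value -/

theorem exists_lipschitz_of_hasDerivAt {η η' : ℝ → ℝ} (hη : ∀ u, HasDerivAt η (η' u) u)
    (hη' : Continuous η') (m : ℝ) :
    ∃ C, 0 ≤ C ∧ ∀ u ∈ Icc (-m) m, ∀ v ∈ Icc (-m) m, |η u - η v| ≤ C * |u - v| := by
  obtain ⟨C, hC⟩ := (isCompact_Icc (a := -m) (b := m)).exists_bound_of_continuousOn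
    hη'.continuousOn
  refine ⟨max C 0, le_max_right _ _, fun u hu v hv => ?_⟩
  exact (convex_Icc (-m) m).norm_image_sub_le_of_norm_hasDerivWithin_le
    (fun w _ => (hη w).hasDerivWithinAt) (fun w hw => (hC w hw).trans (le_max_left _ _)) hv hu

theorem hasDerivAt_exp_neg_mul (Λ s : ℝ) :
    HasDerivAt (fun s => Real.exp (-(Λ * s))) (-Λ * Real.exp (-(Λ * s))) s := by
  have : HasDerivAt (fun s : ℝ => -(Λ * s)) (-(Λ * 1)) s :=
    ((hasDerivAt_id s).const_mul Λ).neg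
  refine this.exp.congr_deriv ?_
  ring

theorem le_add_mul_of_deriv_le {f f' : ℝ → ℝ} {B s t : ℝ} (hst : s ≤ t)
    (hder : ∀ y ∈ Icc s t, HasDerivAt f (f' y) y) (hB : ∀ y ∈ Ioo s t, f' y ≤ B) :
    f t ≤ f s + B * (t - s) := by
  have := (convex_Icc s t).image_sub_le_mul_sub_of_deriv_le (f := f)
    (fun y hy => (hder y hy).continuousAt.continuousWithinAt)
    (fun y hy => (hder y (interior_subset hy)).differentiableAt.differentiableWithinAt)
    (fun y hy => (hder y (interior_subset hy)).deriv.trans_le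
      (hB y (by rwa [interior_Icc] at hy))) s ⟨le_rfl, hst⟩ t ⟨hst, le_rfl⟩ hst
  linarith

theorem le_add_mul_of_tendsto_of_deriv_le {f f' : ℝ → ℝ} {T B l t : ℝ} (ht : t ∈ Ioo 0 T)
    (hder : ∀ s ∈ Ioo 0 T, HasDerivAt f (f' s) s) (hB : ∀ s ∈ Ioo 0 t, f' s ≤ B)
    (hlim : Tendsto f (𝓝[>] 0) (𝓝 l)) : f t ≤ l + B * t := by
  have hstep : ∀ s ∈ Ioo 0 t, f t ≤ f s + B * (t - s) := fun s hs =>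
    le_add_mul_of_deriv_le hs.2.le
      (fun y hy => hder y ⟨hs.1.trans_le hy.1, hy.2.trans_lt ht.2⟩)
      (fun y hy => hB y ⟨hs.1.trans hy.1, hy.2⟩)
  have hlim2 : Tendsto (fun s => f s + B * (t - s)) (𝓝[>] 0) (𝓝 (l + B * (t - 0))) :=
    hlim.add (tendsto_nhdsWithin_of_tendsto_nhds (by apply Continuous.tendsto; fun_prop))
  rw [sub_zero] at hlim2
  exact ge_of_tendsto hlim2 (by filter_upwards [Ioo_mem_nhdsGT ht.1] with s hs using hstep s hs)

namespace IsViscousSolution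

variable {A : ℝ → ℝ} {ε : ℝ} {U₀ : ℝ → ℝ} {U : ℝ → ℝ → ℝ}

/-- On the range of the solution `η` is Lipschitz, so convergence in `L¹_loc` passes to `η (U t)`.
The remaining integral with `η (U₀)` converges by dominated convergence in the weight, which may
depend on time. -/
theorem tendsto_integral_initial (h : IsViscousSolution A ε U₀ U)
    (hU₀ : AEStronglyMeasurable U₀ volume) {m τ : ℝ} (hτ : 0 < τ)
    (hm : ∀ t ∈ Ioo 0 τ, ∀ x, |U t x| ≤ m) (hm₀ : ∀ᵐ x, |U₀ x| ≤ m)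
    {η η' : ℝ → ℝ} (hη : ∀ u, HasDerivAt η (η' u) u) (hη' : Continuous η')
    {R : ℝ} (hR : 0 ≤ R) {ψ : ℝ → ℝ → ℝ} {ψ₀ : ℝ → ℝ} {B : ℝ}
    (cψ : ∀ t ∈ Ioo 0 τ, Continuous (ψ t))
    (hB : ∀ t ∈ Ioo 0 τ, ∀ x ∈ Icc (-R) R, |ψ t x| ≤ B)
    (hψ : ∀ x, Tendsto (fun t => ψ t x) (𝓝[>] 0) (𝓝 (ψ₀ x))) :
    Tendsto (fun t => ∫ x in (-R)..R, ψ t x * η (U t x)) (𝓝[>] 0)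
      (𝓝 (∫ x in (-R)..R, ψ₀ x * η (U₀ x))) := by
  have cη : Continuous η := continuous_iff_continuousAt.2 fun u => (hη u).continuousAt
  obtain ⟨C, hC0, hC⟩ := exists_lipschitz_of_hasDerivAt hη hη' m
  obtain ⟨D, hD⟩ := (isCompact_Icc (a := -m) (b := m)).exists_bound_of_continuousOn cη.continuousOn
  have hIoo : ∀ᶠ t in 𝓝[>] (0 : ℝ), t ∈ Ioo 0 τ := Ioo_mem_nhdsGT hτ
  have hηU₀ : ∀ᵐ x, ‖η (U₀ x)‖ ≤ D := by
    filter_upwards [hm₀] with x hx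
    exact hD _ (abs_le.1 hx)
  have mηU₀ : AEStronglyMeasurable (fun x => η (U₀ x)) volume :=
    cη.comp_aestronglyMeasurable hU₀
  have iηU₀ : ∀ f : ℝ → ℝ, Continuous f →
      IntervalIntegrable (fun x => f x * η (U₀ x)) volume (-R) R := by
    intro f hf
    have : IntervalIntegrable (fun x => η (U₀ x)) volume (-R) R := by
      refine (intervalIntegrable_const (c := D)).mono_fun mηU₀.restrict ?_
      filter_upwards [ae_restrict_of_ae hηU₀] with x hx
      exact hx.trans (Real.le_norm_self D)
    exact this.continuousOn_mul hf.continuousOn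
  have iU₀ : IntervalIntegrable U₀ volume (-R) R := by
    refine (intervalIntegrable_const (c := m)).mono_fun hU₀.restrict ?_
    filter_upwards [ae_restrict_of_ae hm₀] with x hx
    exact hx.trans (Real.le_norm_self m)
  have lim1 : Tendsto (fun t => ∫ x in (-R)..R, ψ t x * η (U₀ x)) (𝓝[>] 0)
      (𝓝 (∫ x in (-R)..R, ψ₀ x * η (U₀ x))) := by
    refine intervalIntegral.tendsto_integral_filter_of_dominated_convergence (fun _ => B * D)
      ?_ ?_ intervalIntegrable_const ?_
    · filter_upwards [hIoo] with t ht
      exact ((cψ t ht).aestronglyMeasurable.mul mηU₀).restrict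
    · filter_upwards [hIoo] with t ht
      filter_upwards [hηU₀] with x hx hxR
      rw [uIoc_of_le (by linarith)] at hxR
      rw [norm_mul]
      exact mul_le_mul (hB t ht x ⟨hxR.1.le, hxR.2⟩) hx (norm_nonneg _)
        ((abs_nonneg _).trans (hB t ht x ⟨hxR.1.le, hxR.2⟩))
    · exact Eventually.of_forall fun x _ => (hψ x).mul_const _
  have lim2 : Tendsto (fun t => ∫ x in (-R)..R, ψ t x * (η (U t x) - η (U₀ x))) (𝓝[>] 0)
      (𝓝 0) := by
    have hlim : Tendsto (fun t => B * C * ∫ x in Icc (-R) R, |U t x - U₀ x|) (𝓝[>] 0)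
        (𝓝 (B * C * 0)) := (h.initial R).const_mul _
    rw [mul_zero] at hlim
    refine squeeze_zero_norm' ?_ hlim
    filter_upwards [hIoo] with t ht
    rw [integral_Icc_eq_integral_Ioc, ← intervalIntegral.integral_of_le (by linarith),
      ← intervalIntegral.integral_const_mul]
    refine intervalIntegral.norm_integral_le_of_norm_le (by linarith) ?_ ?_
    · filter_upwards [hm₀] with x hx hxR
      rw [norm_mul, mul_assoc]
      exact mul_le_mul (hB t ht x ⟨hxR.1.le, hxR.2⟩)
        (hC _ (abs_le.1 (hm t ht x)) _ (abs_le.1 hx)) (norm_nonneg _)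
        ((abs_nonneg _).trans (hB t ht x ⟨hxR.1.le, hxR.2⟩))
    · exact (((h.continuous_slice ht.1).intervalIntegrable _ _).sub iU₀).abs.const_mul _
  have hsum := lim2.add lim1
  rw [zero_add] at hsum
  refine hsum.congr' ?_
  filter_upwards [hIoo] with t ht
  have i1 : IntervalIntegrable (fun x => ψ t x * η (U t x)) volume (-R) R :=
    ((cψ t ht).mul (cη.comp (h.continuous_slice ht.1))).intervalIntegrable _ _
  rw [← intervalIntegral.integral_add]
  · refine intervalIntegral.integral_congr fun x _ => ?_
    ring
  · simp only [mul_sub]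
    exact i1.sub (iηU₀ _ (cψ t ht))
  · exact iηU₀ _ (cψ t ht)

/-- An entropy which vanishes on the initial values vanishes on the solution. -/
theorem entropy_eq_zero (h : IsViscousSolution A ε U₀ U) (hA : Differentiable ℝ A) (hε : 0 ≤ ε)
    (hU₀ : AEStronglyMeasurable U₀ volume) {T m : ℝ}
    (hm : ∀ t ∈ Ioo 0 T, ∀ x, |U t x| ≤ m) (hm₀ : ∀ᵐ x, |U₀ x| ≤ m)
    {η η' η'' q : ℝ → ℝ}
    (hη : ∀ u, HasDerivAt η (η' u) u) (hη' : ∀ u, HasDerivAt η' (η'' u) u)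
    (hη'' : Continuous η'') (hq : ∀ u, HasDerivAt q (η' u * deriv A u) u)
    (η_nonneg : ∀ u, 0 ≤ η u) (η''_nonneg : ∀ u, 0 ≤ η'' u) {L : ℝ} (hL : 0 ≤ L)
    (hqη : ∀ u ∈ Icc (-m) m, |q u| ≤ L * η u) (hη₀ : ∀ᵐ x, η (U₀ x) = 0)
    {t : ℝ} (ht : t ∈ Ioo 0 T) (x : ℝ) : η (U t x) = 0 := by
  have cη : Continuous η := continuous_iff_continuousAt.2 fun u => (hη u).continuousAt
  have cη' : Continuous η' := continuous_iff_continuousAt.2 fun u => (hη' u).continuousAt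
  have cq : Continuous q := continuous_iff_continuousAt.2 fun u => (hq u).continuousAt
  obtain ⟨D, hD⟩ := (isCompact_Icc (a := -m) (b := m)).exists_bound_of_continuousOn cη.continuousOn
  have hDU : ∀ s ∈ Ioo 0 T, ∀ x, η (U s x) ≤ D := fun s hs x =>
    (Real.le_norm_self _).trans (hD _ (abs_le.1 (hm s hs x)))
  have hD0 : 0 ≤ D := (η_nonneg _).trans (hDU t ht 0)
  -- The flux is at most `L` times the entropy, so all cutoff errors are bounded through
  -- `cutoff_derivs_le` by `Λ` times the weighted entropy plus a term of order `r ^ (-3)`. The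
  -- weight `exp (-Λ s)` cancels the former.
  set Λ : ℝ := 32 * (L + ε)
  have hΛ : 0 ≤ Λ := by positivity
  refine eq_zero_of_integral_cutoff_le (C := Real.exp (Λ * t) * (2 * Λ * D * t))
    (cη.comp (h.continuous_slice ht.1)) (fun x => η_nonneg _) (fun r hr => ?_) x
  have hr0 : 0 < r := by linarith
  set ψ : ℝ → ℝ → ℝ := fun s x => Real.exp (-(Λ * s)) * cutoff r x
  set f : ℝ → ℝ := fun s => ∫ x in (-r ^ 2)..(r ^ 2), ψ s x * η (U s x)
  have hder := fun s (hs : s ∈ Ioo 0 T) => h.hasDerivAt_integral_entropy hA hη hη' hη'' hq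
    (T := T) (R := r ^ 2) (by positivity) (ψ := ψ)
    (ψt := fun s x => -Λ * Real.exp (-(Λ * s)) * cutoff r x)
    (ψx := fun s x => Real.exp (-(Λ * s)) * cutoff' r x)
    (ψxx := fun s x => Real.exp (-(Λ * s)) * cutoff'' r x)
    (fun s _ x => (hasDerivAt_exp_neg_mul Λ s).mul_const _)
    (fun s _ x => (hasDerivAt_cutoff r x).const_mul _)
    (fun s _ x => (hasDerivAt_cutoff' r x).const_mul _)
    (by have := continuous_cutoff r; exact Continuous.continuousOn (by fun_prop))
    (by have := continuous_cutoff r; exact Continuous.continuousOn (by fun_prop))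
    (fun s _ => by have := continuous_cutoff'' r; fun_prop)
    (fun s _ => by simp [ψ, cutoff_endpoints hr0]) (fun s _ => by simp [cutoff'_endpoints hr0]) hs
  have hneg : ∀ s ∈ Ioo 0 T, ∫ x in (-r ^ 2)..(r ^ 2),
      (-Λ * Real.exp (-(Λ * s)) * cutoff r x * η (U s x)
          + Real.exp (-(Λ * s)) * cutoff' r x * q (U s x)
          + ε * (Real.exp (-(Λ * s)) * cutoff'' r x * η (U s x))
          - ε * (ψ s x * (η'' (U s x) * deriv (U s) x ^ 2))) ≤ 2 * Λ * D / r := by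
    intro s hs
    have hle : ∀ x ∈ Icc (-r ^ 2) (r ^ 2),
        (-Λ * Real.exp (-(Λ * s)) * cutoff r x * η (U s x)
          + Real.exp (-(Λ * s)) * cutoff' r x * q (U s x)
          + ε * (Real.exp (-(Λ * s)) * cutoff'' r x * η (U s x))
          - ε * (ψ s x * (η'' (U s x) * deriv (U s) x ^ 2))) ≤ Λ * D / r ^ 3 := by
      intro x hx
      have e0 : 0 ≤ ε * (ψ s x * (η'' (U s x) * deriv (U s) x ^ 2)) :=
        mul_nonneg hε (mul_nonneg (mul_nonneg (Real.exp_pos _).le (cutoff_nonneg r x))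
          (mul_nonneg (η''_nonneg _) (sq_nonneg _)))
      have e1 := hqη _ (abs_le.1 (hm s hs x))
      have e2 := cutoff_derivs_le hr hx
      have hη0 := η_nonneg (U s x)
      have hηD := hDU s hs x
      have hexp := Real.exp_pos (-(Λ * s))
      have hexp1 : Real.exp (-(Λ * s)) ≤ 1 :=
        Real.exp_le_one_iff.2 (by have := hs.1; nlinarith)
      have e3 : cutoff' r x * q (U s x) + ε * (cutoff'' r x * η (U s x)) ≤
          (L + ε) * (32 * (cutoff r x / r + 1 / r ^ 3)) * η (U s x) := by
        have h1 : cutoff' r x * q (U s x) ≤ |cutoff' r x| * (L * η (U s x)) := by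
          refine (le_abs_self _).trans ?_
          rw [abs_mul]
          gcongr
        have h2 : cutoff'' r x * η (U s x) ≤ |cutoff'' r x| * η (U s x) := by
          gcongr; exact le_abs_self _
        have h3 : 0 ≤ |cutoff' r x| * (ε * η (U s x)) := by positivity
        have h4 : 0 ≤ |cutoff'' r x| * (L * η (U s x)) := by positivity
        have h5 : (L + ε) * (|cutoff' r x| + |cutoff'' r x|) * η (U s x) ≤
          (L + ε) * (32 * (cutoff r x / r + 1 / r ^ 3)) * η (U s x) := by gcongr
        nlinarith [mul_le_mul_of_nonneg_left h2 hε]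
      have e4 : cutoff r x / r ≤ cutoff r x := div_le_self (cutoff_nonneg r x) hr
      have e5 : Real.exp (-(Λ * s)) * (Λ * (1 / r ^ 3) * η (U s x)) ≤ Λ * D / r ^ 3 := by
        calc Real.exp (-(Λ * s)) * (Λ * (1 / r ^ 3) * η (U s x))
            ≤ 1 * (Λ * (1 / r ^ 3) * D) := by gcongr
          _ = Λ * D / r ^ 3 := by ring
      have e6 : -Λ * cutoff r x * η (U s x) + (cutoff' r x * q (U s x)
          + ε * (cutoff'' r x * η (U s x))) ≤ Λ * (1 / r ^ 3) * η (U s x) := by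
        have : Λ * (cutoff r x / r) * η (U s x) ≤ Λ * cutoff r x * η (U s x) := by gcongr
        have h7 : (L + ε) * (32 * (cutoff r x / r + 1 / r ^ 3)) * η (U s x) =
          Λ * (cutoff r x / r) * η (U s x) + Λ * (1 / r ^ 3) * η (U s x) := by ring
        linarith
      have e7 := mul_le_mul_of_nonneg_left e6 hexp.le
      linarith
    have cs := h.continuous_slice hs.1
    have cs' := h.continuous_deriv_slice hs.1
    have k0 := continuous_cutoff r
    have k1 := continuous_cutoff' r
    have k2 := continuous_cutoff'' r
    refine (intervalIntegral.integral_mono_on (by nlinarith) (by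
      apply Continuous.intervalIntegrable; fun_prop) (intervalIntegrable_const) hle).trans ?_
    rw [intervalIntegral.integral_const, smul_eq_mul]
    apply le_of_eq
    field_simp
    ring
  have hlim : Tendsto f (𝓝[>] 0) (𝓝 (∫ x in (-r ^ 2)..(r ^ 2), cutoff r x * η (U₀ x))) := by
    have hT : 0 < T := ht.1.trans ht.2
    refine h.tendsto_integral_initial hU₀ hT hm hm₀ hη cη' (R := r ^ 2) (by positivity)
      (ψ := ψ) (B := 1)
      (fun s _ => continuous_const.mul (continuous_cutoff r)) ?_ ?_
    · intro s hs x hx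
      have hexp1 : Real.exp (-(Λ * s)) ≤ 1 :=
        Real.exp_le_one_iff.2 (by have := hs.1; nlinarith)
      rw [abs_of_nonneg (mul_nonneg (Real.exp_pos _).le (cutoff_nonneg r x))]
      exact mul_le_one₀ hexp1 (cutoff_nonneg r x) (cutoff_le_one hr0 hx)
    · intro x
      have : Tendsto (fun s => ψ s x) (𝓝 0) (𝓝 (ψ 0 x)) := by
        apply Continuous.tendsto
        fun_prop
      simpa [ψ] using this.mono_left nhdsWithin_le_nhds
  have hzero : ∫ x in (-r ^ 2)..(r ^ 2), cutoff r x * η (U₀ x) = 0 := by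
    rw [intervalIntegral.integral_congr_ae (g := fun _ => 0)]
    · simp
    · filter_upwards [hη₀] with x hx _
      simp [hx]
  rw [hzero] at hlim
  have hft := le_add_mul_of_tendsto_of_deriv_le ht hder
    (fun s hs => hneg s ⟨hs.1, hs.2.trans ht.2⟩) hlim
  have hfe : ∫ x in (-r ^ 2)..(r ^ 2), cutoff r x * η (U t x) = Real.exp (Λ * t) * f t := by
    simp only [f, ψ]
    rw [← intervalIntegral.integral_const_mul]
    refine intervalIntegral.integral_congr fun x _ => ?_
    rw [← mul_assoc, ← mul_assoc, ← Real.exp_add]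
    simp
  refine hfe.le.trans ?_
  calc Real.exp (Λ * t) * f t ≤ Real.exp (Λ * t) * (0 + 2 * Λ * D / r * t) := by gcongr
    _ = _ := by ring

end IsViscousSolution

/-! ### Truncated powers -/

theorem hasDerivAt_max_pow (n : ℕ) (c s : ℝ) :
    HasDerivAt (fun s => max (s - c) 0 ^ (n + 2)) ((n + 2) * max (s - c) 0 ^ (n + 1)) s := by
  have hne : ∀ y ≠ c, HasDerivAt (fun s => max (s - c) 0 ^ (n + 2))
      ((n + 2) * max (y - c) 0 ^ (n + 1)) y := by
    intro y hy
    rcases lt_or_gt_of_ne hy with h | h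
    · have h1 : (fun s => max (s - c) 0 ^ (n + 2)) =ᶠ[𝓝 y] fun _ => 0 := by
        filter_upwards [Iio_mem_nhds h] with s hs
        rw [max_eq_right (by linarith [show s < c from hs]), zero_pow (by omega)]
      rw [max_eq_right (by linarith), zero_pow (by omega), mul_zero]
      exact (hasDerivAt_const y (0 : ℝ)).congr_of_eventuallyEq h1
    · have h1 : (fun s => max (s - c) 0 ^ (n + 2)) =ᶠ[𝓝 y] fun s => (s - c) ^ (n + 2) := by
        filter_upwards [Ioi_mem_nhds h] with s hs
        rw [max_eq_left (by linarith [show c < s from hs])]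
      rw [max_eq_left (by linarith)]
      refine ((((hasDerivAt_id y).sub_const c).pow (n + 2)).congr_of_eventuallyEq h1).congr_deriv ?_
      simp
  by_cases hs : s = c
  · subst hs
    exact hasDerivAt_of_hasDerivAt_of_ne (g := fun y => (n + 2) * max (y - s) 0 ^ (n + 1)) hne
      (by fun_prop) (by fun_prop)
  · exact hne s hs

/-- The truncated cube `s ↦ (s - c)_+ ^ 3`. -/
def cubePos (c s : ℝ) : ℝ := max (s - c) 0 ^ 3

/-- The derivative of `cubePos`. -/
def cubePos' (c s : ℝ) : ℝ := 3 * max (s - c) 0 ^ 2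

/-- The second derivative of `cubePos`. -/
def cubePos'' (c s : ℝ) : ℝ := 6 * max (s - c) 0

/-- The third power is the smallest integer power whose truncation is twice continuously
differentiable, which is the regularity that the entropy balance asks for. -/
theorem hasDerivAt_cubePos (c s : ℝ) : HasDerivAt (cubePos c) (cubePos' c s) s :=
  (hasDerivAt_max_pow 1 c s).congr_deriv (by norm_num [cubePos'])

theorem hasDerivAt_cubePos' (c s : ℝ) : HasDerivAt (cubePos' c) (cubePos'' c s) s :=
  ((hasDerivAt_max_pow 0 c s).const_mul 3).congr_deriv (by norm_num [cubePos'']; ring)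

theorem continuous_cubePos (c : ℝ) : Continuous (cubePos c) := by unfold cubePos; fun_prop

theorem continuous_cubePos' (c : ℝ) : Continuous (cubePos' c) := by unfold cubePos'; fun_prop

theorem continuous_cubePos'' (c : ℝ) : Continuous (cubePos'' c) := by unfold cubePos''; fun_prop

theorem cubePos_nonneg (c s : ℝ) : 0 ≤ cubePos c s := by unfold cubePos; positivity

theorem cubePos'_nonneg (c s : ℝ) : 0 ≤ cubePos' c s := by unfold cubePos'; positivity

theorem cubePos''_nonneg (c s : ℝ) : 0 ≤ cubePos'' c s := by
  unfold cubePos''; have := le_max_right (s - c) 0; positivity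

theorem cubePos_eq_zero_iff {c s : ℝ} : cubePos c s = 0 ↔ s ≤ c := by
  simp [cubePos]

theorem cubePos'_eq_zero {c s : ℝ} (h : s ≤ c) : cubePos' c s = 0 := by
  simp [cubePos', h]

theorem cubePos'_mono (c : ℝ) : Monotone (cubePos' c) := by
  intro s t hst
  unfold cubePos'
  gcongr

/-- For a nondecreasing entropy, the flux based at a zero of the entropy is dominated by the entropy
itself. This makes the cutoff errors absorbable. -/
theorem abs_integral_deriv_mul_le {β β' b : ℝ → ℝ} (hβ : ∀ s, HasDerivAt β (β' s) s)
    (cβ' : Continuous β') (hβ' : ∀ s, 0 ≤ β' s) {L v u : ℝ} (hvu : v ≤ u)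
    (hL : ∀ s ∈ Icc v u, |b s| ≤ L) : |∫ s in v..u, β' s * b s| ≤ L * (β u - β v) := by
  have h1 : ∫ s in v..u, L * β' s = L * (β u - β v) := by
    rw [intervalIntegral.integral_const_mul,
      intervalIntegral.integral_eq_sub_of_hasDerivAt (fun s _ => hβ s)
        (cβ'.intervalIntegrable _ _)]
  rw [← h1, ← Real.norm_eq_abs]
  refine intervalIntegral.norm_integral_le_of_norm_le hvu ?_
    ((continuous_const.mul cβ').intervalIntegrable _ _)
  refine Eventually.of_forall fun s hs => ?_
  rw [norm_mul, Real.norm_of_nonneg (hβ' s), mul_comm]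
  exact mul_le_mul_of_nonneg_right (hL s ⟨hs.1.le, hs.2⟩) (hβ' s)

theorem hasDerivAt_integral_upper {f : ℝ → ℝ} (hf : Continuous f) (b u : ℝ) :
    HasDerivAt (fun u => ∫ s in b..u, f s) (f u) u :=
  intervalIntegral.integral_hasDerivAt_right (hf.intervalIntegrable _ _)
    (hf.stronglyMeasurableAtFilter _ _) hf.continuousAt

namespace IsViscousSolution

variable {A : ℝ → ℝ} {ε : ℝ} {U₀ : ℝ → ℝ} {U : ℝ → ℝ → ℝ}

theorem exists_bound (h : IsViscousSolution A ε U₀ U) {M : ℝ} (T : ℝ) :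
    ∃ m, M ≤ m ∧ ∀ t ∈ Ioo 0 T, ∀ x, |U t x| ≤ m := by
  obtain ⟨m, hm⟩ := h.bounded T
  exact ⟨max M m, le_max_left _ _, fun t ht x => (hm t ht x).trans (le_max_right _ _)⟩

/-- The maximum principle. -/
theorem abs_le_of_initial (h : IsViscousSolution A ε U₀ U) (hA : ContDiff ℝ 2 A) (hε : 0 ≤ ε)
    (hU₀ : AEStronglyMeasurable U₀ volume) {M : ℝ} (hM : 0 ≤ M) (hM₀ : ∀ᵐ x, |U₀ x| ≤ M)
    {t : ℝ} (ht : 0 < t) (x : ℝ) : |U t x| ≤ M := by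
  have dA : Differentiable ℝ A := hA.differentiable (by norm_num)
  have ca : Continuous (deriv A) := hA.continuous_deriv (by norm_num)
  -- The bound `m` depends on the solution and on the time. It serves only to make the speed
  -- bounded, hence the flux comparable with the entropy; it leaves no trace in the conclusion.
  obtain ⟨m, hMm, hm⟩ := h.exists_bound (M := M) (t + 1)
  have hm₀ : ∀ᵐ x, |U₀ x| ≤ m := hM₀.mono fun x hx => hx.trans hMm
  obtain ⟨L, hL⟩ := (isCompact_Icc (a := -m) (b := m)).exists_bound_of_continuousOn ca.continuousOn
  have hL0 : 0 ≤ L := (norm_nonneg _).trans (hL 0 ⟨by linarith, by linarith⟩)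
  have htT : t ∈ Ioo 0 (t + 1) := ⟨ht, by linarith⟩
  have c' := continuous_cubePos' M
  have hb : cubePos M (-m) = 0 := cubePos_eq_zero_iff.2 (by linarith)
  have upper : cubePos M (U t x) = 0 := by
    refine h.entropy_eq_zero dA hε hU₀ hm hm₀ (hasDerivAt_cubePos M) (hasDerivAt_cubePos' M)
      (continuous_cubePos'' M) (q := fun u => ∫ s in (-m)..u, cubePos' M s * deriv A s)
      (fun u => hasDerivAt_integral_upper (c'.mul ca) _ u) (cubePos_nonneg M) (cubePos''_nonneg M)
      hL0 (fun u hu => ?_) ?_ htT x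
    · refine (abs_integral_deriv_mul_le (hasDerivAt_cubePos M) c' (cubePos'_nonneg M) hu.1
        (fun s hs => hL s ⟨hs.1, hs.2.trans hu.2⟩)).trans ?_
      rw [hb, sub_zero]
    · filter_upwards [hM₀] with y hy
      exact cubePos_eq_zero_iff.2 (abs_le.1 hy).2
  -- The reflected entropy handles the lower bound. Its flux is written as an integral up to `-u`,
  -- so that the same estimate for nondecreasing entropies applies.
  have lower : cubePos M (-U t x) = 0 := by
    refine h.entropy_eq_zero dA hε hU₀ hm hm₀ (η := fun u => cubePos M (-u))
      (η' := fun u => -cubePos' M (-u)) (η'' := fun u => cubePos'' M (-u))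
      (fun u => ((hasDerivAt_cubePos M (-u)).comp u (hasDerivAt_neg u)).congr_deriv (by ring))
      (fun u => ((hasDerivAt_cubePos' M (-u)).comp u (hasDerivAt_neg u)).neg.congr_deriv (by ring))
      ((continuous_cubePos'' M).comp continuous_neg)
      (q := fun u => ∫ s in (-m)..(-u), cubePos' M s * deriv A (-s))
      (fun u => ((hasDerivAt_integral_upper (c'.mul (ca.comp continuous_neg)) _ (-u)).comp u
        (hasDerivAt_neg u)).congr_deriv (by simp))
      (fun u => cubePos_nonneg M _) (fun u => cubePos''_nonneg M _)
      hL0 (fun u hu => ?_) ?_ htT x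
    · refine (abs_integral_deriv_mul_le (b := fun s => deriv A (-s)) (hasDerivAt_cubePos M) c'
        (cubePos'_nonneg M) (by linarith [hu.2] : -m ≤ -u)
        (fun s hs => hL (-s) ⟨by linarith [hs.2, hu.1], by linarith [hs.1]⟩)).trans ?_
      rw [hb, sub_zero]
    · filter_upwards [hM₀] with y hy
      exact cubePos_eq_zero_iff.2 (by linarith [(abs_le.1 hy).1])
  exact abs_le.2 ⟨by linarith [cubePos_eq_zero_iff.1 lower], cubePos_eq_zero_iff.1 upper⟩

end IsViscousSolution

/-! ### Entropy fluxes of the doubled equation -/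

section DoubledFlux

/-- The moments `∫₀^w s ^ n a(s) ds`. -/
noncomputable def fluxMoment (a : ℝ → ℝ) (n : ℕ) (w : ℝ) : ℝ := ∫ s in (0 : ℝ)..w, s ^ n * a s

/-- `∫_v^w 3 (w - s)² a(s) ds`, expanded in moments. -/
noncomputable def quadraticFlux (a : ℝ → ℝ) (w v : ℝ) : ℝ :=
  3 * w ^ 2 * (fluxMoment a 0 w - fluxMoment a 0 v) -
    6 * w * (fluxMoment a 1 w - fluxMoment a 1 v) +
    3 * (fluxMoment a 2 w - fluxMoment a 2 v)

/-- `∫_v^u β'(u - s) a(s) ds` for the truncated cube `β = cubePos c`. -/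
noncomputable def leftFlux (a : ℝ → ℝ) (c u v : ℝ) : ℝ :=
  quadraticFlux a (u - c) (min v (u - c))

/-- The partial derivative of `leftFlux` in its first variable. -/
noncomputable def leftFluxDeriv (a : ℝ → ℝ) (c u v : ℝ) : ℝ :=
  6 * (u - c) * (fluxMoment a 0 (u - c) - fluxMoment a 0 (min v (u - c))) -
    6 * (fluxMoment a 1 (u - c) - fluxMoment a 1 (min v (u - c)))

/-- `∫_v^u β'(s - v) a(s) ds` for the truncated cube `β = cubePos c`. -/
noncomputable def rightFlux (a : ℝ → ℝ) (c u v : ℝ) : ℝ := ∫ s in v..u, cubePos' c (s - v) * a s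

variable {a : ℝ → ℝ}

theorem hasDerivAt_fluxMoment (ha : Continuous a) (n : ℕ) (w : ℝ) : HasDerivAt (fluxMoment a n) (w ^ n * a w) w :=
  hasDerivAt_integral_upper (by fun_prop) 0 w

theorem continuous_fluxMoment (ha : Continuous a) (n : ℕ) : Continuous (fluxMoment a n) :=
  continuous_iff_continuousAt.2 fun w => (hasDerivAt_fluxMoment ha n w).continuousAt

theorem quadraticFlux_eq (ha : Continuous a) (w v : ℝ) :
    quadraticFlux a w v = ∫ s in v..w, 3 * (w - s) ^ 2 * a s := by
  have hi : ∀ n : ℕ, ∀ b d : ℝ, IntervalIntegrable (fun s => s ^ n * a s) volume b d :=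
    fun n b d => Continuous.intervalIntegrable (by fun_prop) _ _
  have hm : ∀ n : ℕ, fluxMoment a n w - fluxMoment a n v = ∫ s in v..w, s ^ n * a s := by
    intro n
    simp only [fluxMoment]
    rw [intervalIntegral.integral_interval_sub_left (hi n _ _) (hi n _ _)]
  unfold quadraticFlux
  rw [hm, hm, hm, ← intervalIntegral.integral_const_mul, ← intervalIntegral.integral_const_mul,
    ← intervalIntegral.integral_const_mul, ← intervalIntegral.integral_sub,
    ← intervalIntegral.integral_add]
  · refine intervalIntegral.integral_congr fun s _ => ?_
    ring
  all_goals exact Continuous.intervalIntegrable (by fun_prop) _ _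

theorem hasDerivAt_quadraticFlux_comp (ha : Continuous a) {w v : ℝ → ℝ} {w' v' z : ℝ} (hw : HasDerivAt w w' z)
    (hv : HasDerivAt v v' z) :
    HasDerivAt (fun z => quadraticFlux a (w z) (v z))
      ((6 * w z * (fluxMoment a 0 (w z) - fluxMoment a 0 (v z)) -
        6 * (fluxMoment a 1 (w z) - fluxMoment a 1 (v z))) * w' -
        3 * (w z - v z) ^ 2 * a (v z) * v') z := by
  have hm : ∀ n, HasDerivAt (fun z => fluxMoment a n (w z) - fluxMoment a n (v z))
      (w z ^ n * a (w z) * w' - v z ^ n * a (v z) * v') z := fun n =>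
    ((hasDerivAt_fluxMoment ha n (w z)).comp z hw).sub
      ((hasDerivAt_fluxMoment ha n (v z)).comp z hv)
  refine (((((hw.pow 2).const_mul 3).mul (hm 0)).sub ((hw.const_mul 6).mul (hm 1))).add
    ((hm 2).const_mul 3)).congr_deriv ?_
  simp only [Pi.pow_apply, Nat.cast_ofNat]
  ring

/-- In the variable `v` this is the entropy flux belonging to `β (u - v)`. Here both arguments move.
The expansion in moments leaves only primitives of continuous functions to differentiate, so `a`
itself need not be differentiable. -/
theorem hasDerivAt_leftFlux_comp (ha : Continuous a) (c : ℝ) {u v : ℝ → ℝ} {u' v' z : ℝ} (hu : HasDerivAt u u' z)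
    (hv : HasDerivAt v v' z) :
    HasDerivAt (fun z => leftFlux a c (u z) (v z))
      (leftFluxDeriv a c (u z) (v z) * u' - cubePos' c (u z - v z) * a (v z) * v') z := by
  have hw : HasDerivAt (fun z => u z - c) u' z := hu.sub_const c
  have hq := hasDerivAt_quadraticFlux_comp ha hw hv
  have cu : ContinuousAt (fun z => u z - c - v z) z := (hw.sub hv).continuousAt
  rcases lt_trichotomy (v z) (u z - c) with hlt | heq | hgt
  · have hev : (fun z => leftFlux a c (u z) (v z)) =ᶠ[𝓝 z]
        fun z => quadraticFlux a (u z - c) (v z) := by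
      filter_upwards [cu.eventually (lt_mem_nhds (sub_pos.2 hlt))] with y hy
      rw [leftFlux, min_eq_left (by linarith)]
    refine (hq.congr_of_eventuallyEq hev).congr_deriv ?_
    rw [leftFluxDeriv, min_eq_left hlt.le, cubePos', max_eq_left (by linarith)]
    ring
  · have hzero : quadraticFlux a (u z - c) (v z) = 0 := by rw [heq]; simp [quadraticFlux]
    have hd : leftFluxDeriv a c (u z) (v z) * u' - cubePos' c (u z - v z) * a (v z) * v' = 0 := by
      rw [leftFluxDeriv, min_eq_left heq.le, ← heq, cubePos'_eq_zero (by linarith)]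
      ring
    have hq0 : HasDerivAt (fun z => quadraticFlux a (u z - c) (v z)) 0 z := by
      refine hq.congr_deriv ?_
      simp only [← heq]
      ring
    rw [hd]
    rw [hasDerivAt_iff_isLittleO] at hq0 ⊢
    -- At the edge of the truncation, the truncated flux is pointwise either zero or equal to the
    -- untruncated one, which vanishes there together with its derivative.
    refine (Asymptotics.IsBigO.of_bound 1 (Eventually.of_forall fun y => ?_)).trans_isLittleO hq0
    have hz : leftFlux a c (u z) (v z) = 0 := by
      rw [leftFlux, min_eq_left heq.le, hzero]
    rw [hz, hzero, one_mul]
    simp only [smul_zero, sub_zero, leftFlux]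
    rcases le_total (v y) (u y - c) with h | h
    · rw [min_eq_left h]
    · rw [min_eq_right h]
      simp [quadraticFlux]
  · have hev : (fun z => leftFlux a c (u z) (v z)) =ᶠ[𝓝 z] fun _ => 0 := by
      filter_upwards [cu.eventually (gt_mem_nhds (sub_neg.2 hgt))] with y hy
      rw [leftFlux, min_eq_right (by linarith)]
      simp [quadraticFlux]
    refine ((hasDerivAt_const z (0 : ℝ)).congr_of_eventuallyEq hev).congr_deriv ?_
    rw [leftFluxDeriv, min_eq_right hgt.le, cubePos'_eq_zero (by linarith)]
    simp

theorem continuous_leftFlux (ha : Continuous a) (c : ℝ) : Continuous fun p : ℝ × ℝ => leftFlux a c p.1 p.2 := by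
  have := continuous_fluxMoment ha
  unfold leftFlux quadraticFlux
  fun_prop

theorem continuous_leftFluxDeriv (ha : Continuous a) (c : ℝ) :
    Continuous fun p : ℝ × ℝ => leftFluxDeriv a c p.1 p.2 := by
  have := continuous_fluxMoment ha
  unfold leftFluxDeriv
  fun_prop

theorem leftFlux_eq (ha : Continuous a) (c : ℝ) (hc : 0 ≤ c) {u v : ℝ} (huv : v ≤ u) :
    leftFlux a c u v = ∫ s in v..u, cubePos' c (u - s) * a s := by
  have c' := continuous_cubePos' c
  have hi : ∀ b d, IntervalIntegrable (fun s => cubePos' c (u - s) * a s) volume b d :=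
    fun b d => Continuous.intervalIntegrable (by fun_prop) _ _
  rw [leftFlux, quadraticFlux_eq ha]
  rcases le_total v (u - c) with h | h
  · rw [min_eq_left h, ← intervalIntegral.integral_add_adjacent_intervals (hi v (u - c)) (hi _ u)]
    have h2 : ∫ s in (u - c)..u, cubePos' c (u - s) * a s = 0 := by
      rw [intervalIntegral.integral_congr (g := fun _ => (0 : ℝ))]
      · simp
      · intro s hs
        rw [uIcc_of_le (by linarith)] at hs
        simp [cubePos'_eq_zero (by linarith [hs.1] : u - s ≤ c)]
    rw [h2, add_zero]
    refine intervalIntegral.integral_congr fun s hs => ?_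
    rw [uIcc_of_le h] at hs
    simp only [cubePos']
    rw [max_eq_left (by linarith [hs.2])]
    ring
  · rw [min_eq_right h, intervalIntegral.integral_same,
      intervalIntegral.integral_congr (g := fun _ => (0 : ℝ))]
    · simp
    · intro s hs
      rw [uIcc_of_le huv] at hs
      simp [cubePos'_eq_zero (by linarith [hs.1] : u - s ≤ c)]

theorem leftFlux_eq_zero (ha : Continuous a) (c : ℝ) {u v : ℝ} (huv : u - v ≤ c) : leftFlux a c u v = 0 := by
  rw [leftFlux, min_eq_right (by linarith), quadraticFlux_eq ha, intervalIntegral.integral_same]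

theorem rightFlux_eq_zero (c : ℝ) (hc : 0 ≤ c) {u v : ℝ} (huv : u - v ≤ c) :
    rightFlux a c u v = 0 := by
  rw [rightFlux, intervalIntegral.integral_congr (g := fun _ => (0 : ℝ))]
  · simp
  · intro s hs
    have : s ≤ max v u := hs.2
    have h2 : max v u ≤ v + c := max_le (by linarith) (by linarith)
    simp [cubePos'_eq_zero (by linarith : s - v ≤ c)]

theorem hasDerivAt_rightFlux (ha : Continuous a) (c u v : ℝ) :
    HasDerivAt (fun u => rightFlux a c u v) (cubePos' c (u - v) * a u) u := by
  have c' := continuous_cubePos' c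
  exact hasDerivAt_integral_upper (f := fun s => cubePos' c (s - v) * a s) (by fun_prop) v u

theorem abs_leftFlux_le (ha : Continuous a) (c : ℝ) (hc : 0 ≤ c) {L M : ℝ} (hL0 : 0 ≤ L)
    (hL : ∀ s ∈ Icc (-M) M, |a s| ≤ L) {u v : ℝ} (hu : u ∈ Icc (-M) M) (hv : v ∈ Icc (-M) M) :
    |leftFlux a c u v| ≤ L * cubePos c (u - v) := by
  have hb := cubePos_nonneg c (u - v)
  rcases le_total (u - v) c with h | h
  · rw [leftFlux_eq_zero ha c h, abs_zero]; positivity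
  · have huv : v ≤ u := by linarith
    rw [leftFlux_eq ha c hc huv]
    have hsub : ∫ s in v..u, cubePos' c (u - s) * a s =
        ∫ s in (u - u)..(u - v), cubePos' c s * a (u - s) := by
      rw [← intervalIntegral.integral_comp_sub_left (fun s => cubePos' c s * a (u - s)) u]
      simp
    rw [hsub, sub_self]
    refine (abs_integral_deriv_mul_le (b := fun s => a (u - s)) (hasDerivAt_cubePos c)
      (continuous_cubePos' c) (cubePos'_nonneg c) (by linarith)
      (fun s hs => hL _ ⟨by linarith [hs.2, hv.1], by linarith [hs.1, hu.2]⟩)).trans ?_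
    rw [cubePos_eq_zero_iff.2 hc, sub_zero]

/-- Both integrals weigh `a` over `[v, u]`, with weights that are mirror images about the midpoint.
The right one is concentrated towards `u`, where `a` is larger. Here convexity of the flux `A`
enters the propagation of increments. -/
theorem leftFlux_le_rightFlux (ha : Continuous a) (ha' : Monotone a) (c : ℝ) (hc : 0 ≤ c) (u v : ℝ) :
    leftFlux a c u v ≤ rightFlux a c u v := by
  rcases le_total (u - v) c with h | h
  · rw [leftFlux_eq_zero ha c h, rightFlux_eq_zero c hc h]
  have huv : v ≤ u := by linarith
  have c' := continuous_cubePos' c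
  rw [leftFlux_eq ha c hc huv, rightFlux, ← sub_nonneg,
    ← intervalIntegral.integral_sub (Continuous.intervalIntegrable (by fun_prop) _ _)
      (Continuous.intervalIntegrable (by fun_prop) _ _)]
  -- The two weights have equal mass, so the value of `a` at the midpoint may be subtracted.
  -- Afterwards both factors of the integrand have the sign of `s - (u + v) / 2`.
  have hsym : ∫ s in v..u, (cubePos' c (s - v) - cubePos' c (u - s)) * a ((u + v) / 2) = 0 := by
    rw [intervalIntegral.integral_mul_const, intervalIntegral.integral_sub
      (Continuous.intervalIntegrable (by fun_prop) _ _)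
      (Continuous.intervalIntegrable (by fun_prop) _ _),
      intervalIntegral.integral_comp_sub_left (fun s => cubePos' c s),
      intervalIntegral.integral_comp_sub_right (fun s => cubePos' c s)]
    simp
  rw [← hsym]
  refine intervalIntegral.integral_mono_on huv (Continuous.intervalIntegrable (by fun_prop) _ _)
      (Continuous.intervalIntegrable (by fun_prop) _ _) fun s _ => ?_
  rw [← sub_nonneg]
  have : cubePos' c (s - v) * a s - cubePos' c (u - s) * a s -
      (cubePos' c (s - v) - cubePos' c (u - s)) * a ((u + v) / 2) =
      (cubePos' c (s - v) - cubePos' c (u - s)) * (a s - a ((u + v) / 2)) := by ring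
  rw [this]
  rcases le_total s ((u + v) / 2) with hs | hs
  · exact mul_nonneg_of_nonpos_of_nonpos
      (sub_nonpos.2 (cubePos'_mono c (by linarith))) (sub_nonpos.2 (ha' hs))
  · exact mul_nonneg (sub_nonneg.2 (cubePos'_mono c (by linarith))) (sub_nonneg.2 (ha' hs))

end DoubledFlux

/-! ### One-sided modulus of continuity -/

theorem intervalIntegral_swap_of_continuous {F : ℝ → ℝ → ℝ}
    (hF : Continuous fun z : ℝ × ℝ => F z.1 z.2) (a b c d : ℝ) :
    ∫ x in a..b, ∫ y in c..d, F x y = ∫ y in c..d, ∫ x in a..b, F x y :=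
  intervalIntegral_intervalIntegral_swap
    (IntegrableOn.mono_set (hF.continuousOn.integrableOn_compact
      (isCompact_uIcc (a := a) (b := b) |>.prod (isCompact_uIcc (a := c) (b := d))))
      (prod_mono uIoc_subset_uIcc uIoc_subset_uIcc))

/-- The evolution of `∬ W(x) (h₀ - h) β(u(x + h) - u(x)) dh dx`: the transport in `h` has a sign. -/
theorem integral_doubled_le {a u u' u'' W W' W'' : ℝ → ℝ} (ha : Continuous a) (ha' : Monotone a)
    (hu : ∀ x, HasDerivAt u (u' x) x) (hu' : ∀ x, HasDerivAt u' (u'' x) x) (hu'' : Continuous u'')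
    (hW : ∀ x, HasDerivAt W (W' x) x) (hW' : ∀ x, HasDerivAt W' (W'' x) x) (hW'' : Continuous W'')
    (W_nonneg : ∀ x, 0 ≤ W x) {R : ℝ} (hR : 0 ≤ R) (hWR : W R = 0 ∧ W (-R) = 0)
    (hW'R : W' R = 0 ∧ W' (-R) = 0) {ε L M c h₀ : ℝ} (hε : 0 ≤ ε) (hL0 : 0 ≤ L)
    (hL : ∀ s ∈ Icc (-M) M, |a s| ≤ L) (hM : ∀ x, |u x| ≤ M) (hc : 0 ≤ c) (hh₀ : 0 ≤ h₀) :
    ∫ x in (-R)..R, ∫ h in (0 : ℝ)..h₀, W x * ((h₀ - h) * (cubePos' c (u (x + h) - u x) *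
      ((-(a (u (x + h)) * u' (x + h)) + ε * u'' (x + h)) - (-(a (u x) * u' x) + ε * u'' x)))) ≤
    ∫ x in (-R)..R, ∫ h in (0 : ℝ)..h₀,
      (h₀ - h) * ((L * |W' x| + ε * |W'' x|) * cubePos c (u (x + h) - u x)) := by
  have cu : Continuous u := continuous_iff_continuousAt.2 fun x => (hu x).continuousAt
  have cu' : Continuous u' := continuous_iff_continuousAt.2 fun x => (hu' x).continuousAt
  have cW : Continuous W := continuous_iff_continuousAt.2 fun x => (hW x).continuousAt
  have cW' : Continuous W' := continuous_iff_continuousAt.2 fun x => (hW' x).continuousAt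
  have cβ := continuous_cubePos c
  have cβ' := continuous_cubePos' c
  have cβ'' := continuous_cubePos'' c
  have cp := continuous_leftFlux ha c
  have cpd := continuous_leftFluxDeriv ha c
  set p : ℝ → ℝ → ℝ := fun x h => leftFlux a c (u (x + h)) (u x) with hp
  set pd : ℝ → ℝ → ℝ := fun x h => leftFluxDeriv a c (u (x + h)) (u x) with hpd
  have cp2 : Continuous fun z : ℝ × ℝ => p z.1 z.2 :=
    cp.comp (f := fun z : ℝ × ℝ => (u (z.1 + z.2), u z.1)) (by fun_prop)
  have cpd2 : Continuous fun z : ℝ × ℝ => pd z.1 z.2 :=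
    cpd.comp (f := fun z : ℝ × ℝ => (u (z.1 + z.2), u z.1)) (by fun_prop)
  have hshift : ∀ x h, HasDerivAt (fun x => u (x + h)) (u' (x + h)) x := fun x h =>
    (hu (x + h)).comp_add_const x h
  have hshift' : ∀ x h, HasDerivAt (fun x => u' (x + h)) (u'' (x + h)) x := fun x h =>
    (hu' (x + h)).comp_add_const x h
  have hshifth : ∀ x h, HasDerivAt (fun h => u (x + h)) (u' (x + h)) h := fun x h =>
    (hu (x + h)).comp_const_add x h
  -- the divergence in `x`
  set α : ℝ → ℝ → ℝ := fun x h => (h₀ - h) * (-(W' x * p x h + W x * (pd x h * u' (x + h) -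
    cubePos' c (u (x + h) - u x) * a (u x) * u' x)) +
    ε * (W' x * (cubePos' c (u (x + h) - u x) * (u' (x + h) - u' x)) +
      W x * (cubePos'' c (u (x + h) - u x) * (u' (x + h) - u' x) * (u' (x + h) - u' x) +
        cubePos' c (u (x + h) - u x) * (u'' (x + h) - u'' x)) -
      (W'' x * cubePos c (u (x + h) - u x) +
        W' x * (cubePos' c (u (x + h) - u x) * (u' (x + h) - u' x))))) with hα
  have cα : Continuous fun z : ℝ × ℝ => α z.1 z.2 := by
    simp only [hα]
    fun_prop
  have hαint : ∀ h, ∫ x in (-R)..R, α x h = 0 := by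
    intro h
    have hd : ∀ x, HasDerivAt (fun x => (h₀ - h) * (-(W x * p x h) +
        ε * (W x * (cubePos' c (u (x + h) - u x) * (u' (x + h) - u' x)) -
          W' x * cubePos c (u (x + h) - u x)))) (α x h) x := by
      intro x
      have e1 := (hW x).mul (hasDerivAt_leftFlux_comp ha c (hshift x h) (hu x))
      have e2 : HasDerivAt (fun x => u (x + h) - u x) (u' (x + h) - u' x) x :=
        (hshift x h).sub (hu x)
      have e3 : HasDerivAt (fun x => u' (x + h) - u' x) (u'' (x + h) - u'' x) x :=
        (hshift' x h).sub (hu' x)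
      have e4 := (hW x).mul (((hasDerivAt_cubePos' c _).comp x e2).mul e3)
      have e5 := (hW' x).mul ((hasDerivAt_cubePos c _).comp x e2)
      exact (e1.neg.add ((e4.sub e5).const_mul ε)).const_mul (h₀ - h)
    rw [intervalIntegral.integral_eq_sub_of_hasDerivAt (fun x _ => hd x)
      (Continuous.intervalIntegrable
        (cα.comp (f := fun x : ℝ => (x, h)) (by fun_prop)) _ _)]
    simp [hWR, hW'R]
  -- the divergence in `h`
  set γ : ℝ → ℝ → ℝ := fun x h => W x * (-(((-1) * (rightFlux a c (u (x + h)) (u x) - p x h) +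
      (h₀ - h) * (cubePos' c (u (x + h) - u x) * a (u (x + h)) * u' (x + h) -
        pd x h * u' (x + h))))) with hγ
  have hd : ∀ x h, HasDerivAt
      (fun h => W x * (-((h₀ - h) * (rightFlux a c (u (x + h)) (u x) - p x h)))) (γ x h) h := by
    intro x h
    have e1 := (hasDerivAt_rightFlux ha c (u (x + h)) (u x)).comp h (hshifth x h)
    have e2 : HasDerivAt (fun h => p x h) (pd x h * u' (x + h)) h :=
      (hasDerivAt_leftFlux_comp ha c (hshifth x h) (hasDerivAt_const h (u x))).congr_deriv
        (by simp [hpd])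
    have e3 : HasDerivAt (fun h => h₀ - h) (-1) h := by
      simpa using (hasDerivAt_id h).const_sub h₀
    exact ((e3.mul (e1.sub e2)).neg).const_mul (W x)
  have cγ : ∀ x, Continuous (γ x) := by
    intro x
    have e1 : Continuous fun h => rightFlux a c (u (x + h)) (u x) :=
      continuous_iff_continuousAt.2 fun h =>
        (HasDerivAt.comp (h₂ := fun w => rightFlux a c w (u x)) h
          (hasDerivAt_rightFlux ha c (u (x + h)) (u x)) (hshifth x h)).continuousAt
    have e2 : Continuous fun h => p x h := cp2.comp (f := fun h : ℝ => (x, h)) (by fun_prop)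
    have e3 : Continuous fun h => pd x h := cpd2.comp (f := fun h : ℝ => (x, h)) (by fun_prop)
    simp only [hγ]
    fun_prop
  have hγint : ∀ x, ∫ h in (0 : ℝ)..h₀, γ x h = 0 := by
    intro x
    rw [intervalIntegral.integral_eq_sub_of_hasDerivAt (fun h _ => hd x h)
      ((cγ x).intervalIntegrable _ _)]
    have e1 : rightFlux a c (u x) (u x) = 0 := rightFlux_eq_zero c hc (by simpa using hc)
    have e2 : leftFlux a c (u x) (u x) = 0 := leftFlux_eq_zero ha c (by simpa using hc)
    simp [hp, e1, e2]
  set ρ : ℝ → ℝ → ℝ := fun x h =>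
    (h₀ - h) * ((L * |W' x| + ε * |W'' x|) * cubePos c (u (x + h) - u x)) with hρ
  have cρ : Continuous fun z : ℝ × ℝ => ρ z.1 z.2 := by
    simp only [hρ]
    fun_prop
  set ζ : ℝ → ℝ → ℝ := fun x h => W x * ((h₀ - h) * (cubePos' c (u (x + h) - u x) *
      ((-(a (u (x + h)) * u' (x + h)) + ε * u'' (x + h)) - (-(a (u x) * u' x) + ε * u'' x)))) with hl
  have cl : Continuous fun z : ℝ × ℝ => ζ z.1 z.2 := by
    simp only [hl]
    fun_prop
  -- With `p` the left and `q` the right flux, the transport part of the evolution is `-∂ₓ p - ∂ₕ (q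
  -- - p)`. The weight `h₀ - h` decreases, so moving it inside the `h` derivative leaves `-(q - p) ≤
  -- 0`. The boundary terms in `h` vanish, by the weight at `h₀` and by the fluxes at `0`. Besides
  -- this term (`e1`), the dissipation (`e2`) is dropped; `ρ` bounds what falls on the derivatives
  -- of `W`.
  have hpoint : ∀ x, ∀ h ∈ Icc 0 h₀, ζ x h ≤ α x h + ρ x h + γ x h := by
    intro x h hh
    have hκ : 0 ≤ h₀ - h := by linarith [hh.2]
    have e1 : 0 ≤ W x * (rightFlux a c (u (x + h)) (u x) - p x h) :=
      mul_nonneg (W_nonneg x) (sub_nonneg.2 (leftFlux_le_rightFlux ha ha' c hc _ _))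
    have e2 : 0 ≤ (h₀ - h) * (ε * (W x * (cubePos'' c (u (x + h) - u x) *
        (u' (x + h) - u' x) ^ 2))) :=
      mul_nonneg hκ (mul_nonneg hε (mul_nonneg (W_nonneg x)
        (mul_nonneg (cubePos''_nonneg _ _) (sq_nonneg _))))
    have e3 : W' x * p x h ≤ L * |W' x| * cubePos c (u (x + h) - u x) := by
      have := abs_leftFlux_le ha c hc hL0 hL (abs_le.1 (hM (x + h))) (abs_le.1 (hM x))
      calc W' x * p x h ≤ |W' x| * |p x h| := (le_abs_self _).trans (abs_mul _ _).le
        _ ≤ |W' x| * (L * cubePos c (u (x + h) - u x)) := by gcongr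
        _ = _ := by ring
    have e4 : ε * (W'' x * cubePos c (u (x + h) - u x)) ≤
        ε * |W'' x| * cubePos c (u (x + h) - u x) := by
      have := mul_le_mul_of_nonneg_right (le_abs_self (W'' x))
        (mul_nonneg hε (cubePos_nonneg c (u (x + h) - u x)))
      linarith
    have e5 := mul_le_mul_of_nonneg_left (add_le_add e3 e4) hκ
    simp only [hl, hα, hρ, hγ]
    linarith
  have hslice : ∀ {f : ℝ → ℝ → ℝ}, Continuous (fun z : ℝ × ℝ => f z.1 z.2) → ∀ x,
      IntervalIntegrable (f x) volume 0 h₀ := fun hf x =>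
    (hf.comp (f := fun h : ℝ => (x, h)) (by fun_prop)).intervalIntegrable _ _
  have hinner : ∀ {f : ℝ → ℝ → ℝ}, Continuous (fun z : ℝ × ℝ => f z.1 z.2) →
      Continuous fun x => ∫ h in (0 : ℝ)..h₀, f x h := fun hf =>
    intervalIntegral.continuous_parametric_intervalIntegral_of_continuous' hf 0 h₀
  have hx : ∀ x, ∫ h in (0 : ℝ)..h₀, ζ x h ≤
      (∫ h in (0 : ℝ)..h₀, α x h) + ∫ h in (0 : ℝ)..h₀, ρ x h := by
    intro x
    have iα := hslice cα x
    have iρ := hslice cρ x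
    have iγ := (cγ x).intervalIntegrable (μ := volume) 0 h₀
    refine (intervalIntegral.integral_mono_on hh₀ (hslice cl x) ((iα.add iρ).add iγ)
      (hpoint x)).trans ?_
    rw [intervalIntegral.integral_add (iα.add iρ) iγ, intervalIntegral.integral_add iα iρ,
      hγint x, add_zero]
  have hswap : ∫ x in (-R)..R, ∫ h in (0 : ℝ)..h₀, α x h = 0 := by
    rw [intervalIntegral_swap_of_continuous cα]
    simp [hαint]
  refine (intervalIntegral.integral_mono_on (by linarith) ((hinner cl).intervalIntegrable _ _)
    (((hinner cα).add (hinner cρ)).intervalIntegrable _ _) fun x _ => hx x).trans ?_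
  simp only [Pi.add_apply]
  rw [intervalIntegral.integral_add ((hinner cα).intervalIntegrable _ _)
    ((hinner cρ).intervalIntegrable _ _), hswap, zero_add]

theorem setIntegral_rectangle {g : ℝ × ℝ → ℝ} (hg : Continuous g) {a b c d : ℝ} (hab : a ≤ b)
    (hcd : c ≤ d) :
    ∫ z in Icc a b ×ˢ Icc c d, g z = ∫ x in a..b, ∫ h in c..d, g (x, h) := by
  rw [Measure.volume_eq_prod, setIntegral_prod _ (by
    rw [← Measure.volume_eq_prod]
    exact hg.continuousOn.integrableOn_compact (isCompact_Icc.prod isCompact_Icc))]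
  simp only [intervalIntegral.integral_of_le hab, intervalIntegral.integral_of_le hcd,
    integral_Icc_eq_integral_Ioc]

namespace IsViscousSolution

variable {A : ℝ → ℝ} {ε : ℝ} {U₀ : ℝ → ℝ} {U : ℝ → ℝ → ℝ}

/-- The weighted integral of the truncated increments tends to zero at the initial time. -/
theorem tendsto_doubled_initial (h : IsViscousSolution A ε U₀ U)
    (hU₀ : AEStronglyMeasurable U₀ volume) {M : ℝ} (hM : ∀ t > 0, ∀ x, |U t x| ≤ M)
    (hM₀ : ∀ᵐ x, |U₀ x| ≤ M) {c h₀ : ℝ} (hh₀ : 0 ≤ h₀)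
    (hmod : ∀ h ∈ Ioc 0 h₀, ∀ᵐ x, U₀ (x + h) - U₀ x ≤ c) {R : ℝ} (hR : 0 ≤ R) {ψ : ℝ → ℝ → ℝ}
    (cψ : ∀ t > 0, Continuous (ψ t)) (hψ : ∀ t > 0, ∀ x ∈ Icc (-R) R, |ψ t x| ≤ 1) :
    Tendsto (fun t => ∫ z in Icc (-R) R ×ˢ Icc 0 h₀,
      ψ t z.1 * ((h₀ - z.2) * cubePos c (U t (z.1 + z.2) - U t z.1))) (𝓝[>] 0) (𝓝 0) := by
  have cβ := continuous_cubePos c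
  obtain ⟨C, hC0, hC⟩ := exists_lipschitz_of_hasDerivAt (hasDerivAt_cubePos c)
    (continuous_cubePos' c) (2 * M)
  have iU₀ : ∀ b d : ℝ, IntervalIntegrable U₀ volume b d := by
    intro b d
    refine (intervalIntegrable_const (c := M)).mono_fun hU₀.restrict ?_
    filter_upwards [ae_restrict_of_ae hM₀] with x hx
    exact hx.trans (Real.le_norm_self M)
  have hlim : Tendsto (fun t => h₀ * (C * (2 * ∫ x in Icc (-(R + h₀)) (R + h₀), |U t x - U₀ x|))
      * |h₀ - 0|) (𝓝[>] 0) (𝓝 (h₀ * (C * (2 * 0)) * |h₀ - 0|)) :=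
    (((h.initial (R + h₀)).const_mul 2).const_mul C).const_mul h₀ |>.mul_const _
  simp only [mul_zero, zero_mul] at hlim
  refine squeeze_zero_norm' ?_ hlim
  filter_upwards [self_mem_nhdsWithin] with t ht
  have ht : 0 < t := ht
  have cU := h.continuous_slice ht
  have cψt := cψ t ht
  set e : ℝ → ℝ := fun x => |U t x - U₀ x| with he
  have ie : ∀ b d : ℝ, IntervalIntegrable e volume b d := fun b d =>
    ((cU.intervalIntegrable b d).sub (iU₀ b d)).abs
  have cg : Continuous fun z : ℝ × ℝ =>
    ψ t z.1 * ((h₀ - z.2) * cubePos c (U t (z.1 + z.2) - U t z.1)) := by fun_prop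
  -- The initial bound holds for almost every `x` once the increment is fixed, so the integration
  -- over `x` has to be the inner one.
  rw [setIntegral_rectangle cg (by linarith) hh₀, intervalIntegral_swap_of_continuous
    (F := fun x k => ψ t x * ((h₀ - k) * cubePos c (U t (x + k) - U t x))) cg]
  refine intervalIntegral.norm_integral_le_of_norm_le_const fun k hk => ?_
  rw [uIoc_of_le hh₀] at hk
  have hshift : ∀ᵐ x, |U₀ (x + k)| ≤ M :=
    (measurePreserving_add_right volume k).quasiMeasurePreserving.ae hM₀
  have ie2 : IntervalIntegrable (fun x => h₀ * (C * (e (x + k) + e x))) volume (-R) R := by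
    have : IntervalIntegrable (fun x => e (x + k)) volume (-R) R := by
      have := (ie (-R + k) (R + k)).comp_add_right k
      simpa using this
    exact ((this.add (ie _ _)).const_mul C).const_mul h₀
  have hnorm : ‖∫ x in (-R)..R, ψ t x * ((h₀ - k) * cubePos c (U t (x + k) - U t x))‖ ≤
      ∫ x in (-R)..R, h₀ * (C * (e (x + k) + e x)) := by
    refine intervalIntegral.norm_integral_le_of_norm_le (by linarith) ?_ ie2
    filter_upwards [hM₀, hshift, hmod k hk] with x hx1 hx2 hx3 hxR
    have hb0 := cubePos_nonneg c (U t (x + k) - U t x)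
    have hk0 : 0 ≤ h₀ - k := by linarith [hk.2]
    rw [norm_mul, norm_mul, Real.norm_of_nonneg hb0, Real.norm_of_nonneg hk0, Real.norm_eq_abs]
    have h1 := hψ t ht x ⟨hxR.1.le, hxR.2⟩
    have a1 := abs_le.1 (hM t ht x)
    have a2 := abs_le.1 (hM t ht (x + k))
    have a3 := abs_le.1 hx1
    have a4 := abs_le.1 hx2
    -- The truncated cube vanishes at the initial increment, so its value at time `t` is at most its
    -- Lipschitz constant times the difference of the two increments.
    have h2 := hC (U t (x + k) - U t x) ⟨by linarith, by linarith⟩ (U₀ (x + k) - U₀ x)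
      ⟨by linarith, by linarith⟩
    rw [cubePos_eq_zero_iff.2 hx3, sub_zero, abs_of_nonneg hb0] at h2
    have h3 : |U t (x + k) - U t x - (U₀ (x + k) - U₀ x)| ≤ e (x + k) + e x := by
      have : U t (x + k) - U t x - (U₀ (x + k) - U₀ x) =
        (U t (x + k) - U₀ (x + k)) - (U t x - U₀ x) := by ring
      rw [this]
      exact abs_sub _ _
    calc |ψ t x| * ((h₀ - k) * cubePos c (U t (x + k) - U t x))
        ≤ 1 * (h₀ * (C * (e (x + k) + e x))) := by
          gcongr
          · linarith [hk.1]
          · exact h2.trans (by gcongr)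
      _ = _ := one_mul _
  refine hnorm.trans ?_
  rw [intervalIntegral.integral_const_mul, intervalIntegral.integral_const_mul,
    intervalIntegral.integral_add (by simpa using (ie (-R + k) (R + k)).comp_add_right k) (ie _ _),
    intervalIntegral.integral_comp_add_right e]
  have hmono : ∀ b d : ℝ, b ≤ d → -(R + h₀) ≤ b → d ≤ R + h₀ →
      ∫ x in b..d, e x ≤ ∫ x in Icc (-(R + h₀)) (R + h₀), e x := by
    intro b d hbd hb hd
    rw [integral_Icc_eq_integral_Ioc, ← intervalIntegral.integral_of_le (by linarith)]
    exact intervalIntegral.integral_mono_interval hb hbd hd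
      (Eventually.of_forall fun x => abs_nonneg _) (ie _ _)
  have m1 := hmono (-R + k) (R + k) (by linarith) (by linarith [hk.1]) (by linarith [hk.2])
  have m2 := hmono (-R) R (by linarith) (by linarith) (by linarith)
  gcongr
  linarith

/-- A bound of the increments over all distances less than `h₀` is propagated by the equation. -/
theorem increment_le (h : IsViscousSolution A ε U₀ U) (hA : ContDiff ℝ 2 A)
    (ha : Monotone (deriv A)) (hε : 0 ≤ ε) (hU₀ : AEStronglyMeasurable U₀ volume) {M : ℝ}
    (hM : ∀ t > 0, ∀ x, |U t x| ≤ M) (hM₀ : ∀ᵐ x, |U₀ x| ≤ M) {c h₀ : ℝ} (hc : 0 ≤ c)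
    (hmod : ∀ h ∈ Ioc 0 h₀, ∀ᵐ x, U₀ (x + h) - U₀ x ≤ c) {t : ℝ} (ht : 0 < t) (x : ℝ) {k : ℝ}
    (hk : k ∈ Ioo 0 h₀) : U t (x + k) - U t x ≤ c := by
  have hh₀ : 0 ≤ h₀ := hk.1.le.trans hk.2.le
  have dA : Differentiable ℝ A := hA.differentiable (by norm_num)
  have ca : Continuous (deriv A) := hA.continuous_deriv (by norm_num)
  have hM0 : 0 ≤ M := (abs_nonneg _).trans (hM t ht 0)
  have cβ := continuous_cubePos c
  have cβ' := continuous_cubePos' c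
  obtain ⟨L, hL⟩ := (isCompact_Icc (a := -M) (b := M)).exists_bound_of_continuousOn ca.continuousOn
  have hL0 : 0 ≤ L := (norm_nonneg _).trans (hL 0 ⟨by linarith, by linarith⟩)
  obtain ⟨D, hD⟩ := (isCompact_Icc (a := -(2 * M)) (b := 2 * M)).exists_bound_of_continuousOn
    cβ.continuousOn
  have hDU : ∀ s > 0, ∀ x y, cubePos c (U s x - U s y) ≤ D := by
    intro s hs x y
    have a1 := abs_le.1 (hM s hs x)
    have a2 := abs_le.1 (hM s hs y)
    exact (Real.le_norm_self _).trans (hD _ ⟨by linarith, by linarith⟩)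
  have hD0 : 0 ≤ D := (cubePos_nonneg _ _).trans (hDU t ht 0 0)
  set Λ : ℝ := 32 * (L + ε)
  have hΛ : 0 ≤ Λ := by positivity
  have cUt := h.continuous_slice ht
  -- The excess over `c` is averaged over all distances, since the sign of the transport in `h`
  -- appears only after integration against `h₀ - h`. Gronwall with the weight `exp (-Λ s)` and zero
  -- initial value shows that the average vanishes.
  have hF0 : ∀ x, ∫ k in (0 : ℝ)..h₀, (h₀ - k) * cubePos c (U t (x + k) - U t x) = 0 := by
    refine eq_zero_of_integral_cutoff_le (C := Real.exp (Λ * t) * (2 * Λ * (h₀ ^ 2 * D) * t))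
      (intervalIntegral.continuous_parametric_intervalIntegral_of_continuous'
        (f := fun x k => (h₀ - k) * cubePos c (U t (x + k) - U t x)) (by fun_prop) 0 h₀)
      (fun x => intervalIntegral.integral_nonneg hh₀ fun k hk =>
        mul_nonneg (by linarith [hk.2]) (cubePos_nonneg _ _)) (fun r hr => ?_)
    have hr0 : 0 < r := by linarith
    set K : Set (ℝ × ℝ) := Icc (-r ^ 2) (r ^ 2) ×ˢ Icc 0 h₀
    have hK : IsCompact K := isCompact_Icc.prod isCompact_Icc
    have k0 := continuous_cutoff r
    have k1 := continuous_cutoff' r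
    have k2 := continuous_cutoff'' r
    have hder : ∀ s ∈ Ioo 0 (t + 1), HasDerivAt (fun s => ∫ z in K,
        Real.exp (-(Λ * s)) * cutoff r z.1 *
          ((h₀ - z.2) * cubePos c (U s (z.1 + z.2) - U s z.1)))
        (∫ z in K, (-Λ * Real.exp (-(Λ * s)) * cutoff r z.1 *
          ((h₀ - z.2) * cubePos c (U s (z.1 + z.2) - U s z.1)) +
          Real.exp (-(Λ * s)) * cutoff r z.1 * ((h₀ - z.2) *
            (cubePos' c (U s (z.1 + z.2) - U s z.1) *
              (deriv (fun τ => U τ (z.1 + z.2)) s - deriv (fun τ => U τ z.1) s))))) s := by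
      intro s hs
      refine hasDerivAt_setIntegral_of_continuousOn hK isOpen_Ioo (t := s)
        (F := fun s z => Real.exp (-(Λ * s)) * cutoff r z.1 *
          ((h₀ - z.2) * cubePos c (U s (z.1 + z.2) - U s z.1)))
        (F' := fun s z => (-Λ * Real.exp (-(Λ * s)) * cutoff r z.1 *
          ((h₀ - z.2) * cubePos c (U s (z.1 + z.2) - U s z.1)) +
          Real.exp (-(Λ * s)) * cutoff r z.1 * ((h₀ - z.2) *
            (cubePos' c (U s (z.1 + z.2) - U s z.1) *
              (deriv (fun τ => U τ (z.1 + z.2)) s - deriv (fun τ => U τ z.1) s))))) ?_ ?_ ?_ hs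
      · intro τ hτ
        have := h.continuous_slice hτ.1
        exact Continuous.continuousOn (by fun_prop)
      · have c1 : ContinuousOn (fun p : ℝ × (ℝ × ℝ) => U p.1 (p.2.1 + p.2.2))
            (Ioo 0 (t + 1) ×ˢ K) :=
          h.continuousOn_uncurry.comp (f := fun p : ℝ × (ℝ × ℝ) => (p.1, p.2.1 + p.2.2))
            (by fun_prop) (fun p hp => ⟨hp.1.1, mem_univ _⟩)
        have c2 : ContinuousOn (fun p : ℝ × (ℝ × ℝ) => U p.1 p.2.1) (Ioo 0 (t + 1) ×ˢ K) :=
          h.continuousOn_uncurry.comp (f := fun p : ℝ × (ℝ × ℝ) => (p.1, p.2.1))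
            (by fun_prop) (fun p hp => ⟨hp.1.1, mem_univ _⟩)
        have c3 : ContinuousOn (fun p : ℝ × (ℝ × ℝ) =>
            deriv (fun τ => U τ (p.2.1 + p.2.2)) p.1) (Ioo 0 (t + 1) ×ˢ K) :=
          h.continuous_t.comp (f := fun p : ℝ × (ℝ × ℝ) => (p.1, p.2.1 + p.2.2))
            (by fun_prop) (fun p hp => ⟨hp.1.1, mem_univ _⟩)
        have c4 : ContinuousOn (fun p : ℝ × (ℝ × ℝ) =>
            deriv (fun τ => U τ p.2.1) p.1) (Ioo 0 (t + 1) ×ˢ K) :=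
          h.continuous_t.comp (f := fun p : ℝ × (ℝ × ℝ) => (p.1, p.2.1))
            (by fun_prop) (fun p hp => ⟨hp.1.1, mem_univ _⟩)
        have c5 : ContinuousOn (fun p : ℝ × (ℝ × ℝ) =>
            cubePos c (U p.1 (p.2.1 + p.2.2) - U p.1 p.2.1)) (Ioo 0 (t + 1) ×ˢ K) :=
          cβ.comp_continuousOn (c1.sub c2)
        have c6 : ContinuousOn (fun p : ℝ × (ℝ × ℝ) =>
            cubePos' c (U p.1 (p.2.1 + p.2.2) - U p.1 p.2.1)) (Ioo 0 (t + 1) ×ˢ K) :=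
          cβ'.comp_continuousOn (c1.sub c2)
        have c7 : ContinuousOn (fun p : ℝ × (ℝ × ℝ) => cutoff r p.2.1) (Ioo 0 (t + 1) ×ˢ K) :=
          (k0.comp (continuous_fst.comp continuous_snd)).continuousOn
        fun_prop
      · intro τ hτ z _
        have e1 : HasDerivAt (fun τ => U τ (z.1 + z.2) - U τ z.1) _ τ :=
          (h.hasDerivAt_time hτ.1 (z.1 + z.2)).sub (h.hasDerivAt_time hτ.1 z.1)
        exact ((hasDerivAt_exp_neg_mul Λ τ).mul_const _).mul
          (((hasDerivAt_cubePos c _).comp τ e1).const_mul _)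
    have hneg : ∀ s ∈ Ioo 0 (t + 1), (∫ z in K, (-Λ * Real.exp (-(Λ * s)) * cutoff r z.1 *
          ((h₀ - z.2) * cubePos c (U s (z.1 + z.2) - U s z.1)) +
          Real.exp (-(Λ * s)) * cutoff r z.1 * ((h₀ - z.2) *
            (cubePos' c (U s (z.1 + z.2) - U s z.1) *
              (deriv (fun τ => U τ (z.1 + z.2)) s - deriv (fun τ => U τ z.1) s))))) ≤
          2 * Λ * (h₀ ^ 2 * D) / r := by
      intro s hs
      have hs0 : 0 < s := hs.1
      have cs := h.continuous_slice hs0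
      have cs' := h.continuous_deriv_slice hs0
      have cs'' := h.continuous_deriv_deriv_slice hs0
      have key := integral_doubled_le (c := c) (h₀ := h₀) ca ha (h.hasDerivAt_space hs0)
        (h.hasDerivAt_space_space hs0) cs'' (hasDerivAt_cutoff r) (hasDerivAt_cutoff' r) k2
        (cutoff_nonneg r) (R := r ^ 2) (by positivity) (cutoff_endpoints hr0)
        (cutoff'_endpoints hr0) hε hL0 hL (hM s hs0) hc hh₀
      simp only [← h.time_deriv_eq dA hs0] at key
      have cUt' : Continuous fun x => deriv (fun r => U r x) s := by
        rw [← continuousOn_univ]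
        exact h.continuous_t.comp (f := fun x => (s, x)) (by fun_prop)
          (fun x _ => ⟨hs0, mem_univ _⟩)
      have cUt1 : Continuous fun z : ℝ × ℝ => deriv (fun τ => U τ (z.1 + z.2)) s :=
        cUt'.comp (f := fun z : ℝ × ℝ => z.1 + z.2) (by fun_prop)
      have cUt2 : Continuous fun z : ℝ × ℝ => deriv (fun τ => U τ z.1) s :=
        cUt'.comp continuous_fst
      rw [← setIntegral_rectangle (g := fun z => cutoff r z.1 * ((h₀ - z.2) *
          (cubePos' c (U s (z.1 + z.2) - U s z.1) *
            (deriv (fun τ => U τ (z.1 + z.2)) s - deriv (fun τ => U τ z.1) s))))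
          (by fun_prop)
          (by nlinarith) hh₀,
        ← setIntegral_rectangle (g := fun z => (h₀ - z.2) * ((L * |cutoff' r z.1| +
          ε * |cutoff'' r z.1|) * cubePos c (U s (z.1 + z.2) - U s z.1))) (by fun_prop)
          (by nlinarith) hh₀] at key
      have icont : ∀ g : ℝ × ℝ → ℝ, Continuous g → IntegrableOn g K := fun g hg =>
        hg.continuousOn.integrableOn_compact hK
      have hE0 := Real.exp_pos (-(Λ * s))
      have hE1 : Real.exp (-(Λ * s)) ≤ 1 := Real.exp_le_one_iff.2 (by nlinarith)
      simp only [mul_assoc (Real.exp (-(Λ * s))), mul_assoc (-Λ)]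
      rw [integral_add (icont _ (by fun_prop)) (icont _ (by fun_prop)),
        integral_const_mul, integral_const_mul, integral_const_mul]
      have hcomb : -Λ * (Real.exp (-(Λ * s)) * ∫ z in K, cutoff r z.1 *
            ((h₀ - z.2) * cubePos c (U s (z.1 + z.2) - U s z.1))) +
          Real.exp (-(Λ * s)) * ∫ z in K, (h₀ - z.2) * ((L * |cutoff' r z.1| +
            ε * |cutoff'' r z.1|) * cubePos c (U s (z.1 + z.2) - U s z.1)) ≤
          2 * Λ * (h₀ ^ 2 * D) / r := by
        have hle : ∫ z in K, ((h₀ - z.2) * ((L * |cutoff' r z.1| +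
            ε * |cutoff'' r z.1|) * cubePos c (U s (z.1 + z.2) - U s z.1)) -
            Λ * (cutoff r z.1 * ((h₀ - z.2) * cubePos c (U s (z.1 + z.2) - U s z.1)))) ≤
            ∫ z in K, Λ * (h₀ * D) / r ^ 3 := by
          refine setIntegral_mono_on (icont _ (by fun_prop)) (icont _ continuous_const)
            hK.measurableSet fun z hz => ?_
          have hκ : 0 ≤ h₀ - z.2 := by linarith [hz.2.2]
          have hκ' : h₀ - z.2 ≤ h₀ := by linarith [hz.2.1]
          have hb0 := cubePos_nonneg c (U s (z.1 + z.2) - U s z.1)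
          have hbD := hDU s hs0 (z.1 + z.2) z.1
          have e2 := cutoff_derivs_le hr hz.1
          have e4 : cutoff r z.1 / r ≤ cutoff r z.1 := div_le_self (cutoff_nonneg r _) hr
          have e5 : L * |cutoff' r z.1| + ε * |cutoff'' r z.1| ≤
              Λ * cutoff r z.1 + Λ * (1 / r ^ 3) := by
            have h1 : L * |cutoff' r z.1| + ε * |cutoff'' r z.1| ≤
                (L + ε) * (|cutoff' r z.1| + |cutoff'' r z.1|) := by
              have i1 : 0 ≤ ε * |cutoff' r z.1| := by positivity
              have i2 : 0 ≤ L * |cutoff'' r z.1| := by positivity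
              linarith
            have h2 : (L + ε) * (|cutoff' r z.1| + |cutoff'' r z.1|) ≤
                (L + ε) * (32 * (cutoff r z.1 + 1 / r ^ 3)) := by
              gcongr
              exact e2.trans (by gcongr)
            have h3 : (L + ε) * (32 * (cutoff r z.1 + 1 / r ^ 3)) =
              Λ * cutoff r z.1 + Λ * (1 / r ^ 3) := by ring
            linarith
          have e6 := mul_le_mul_of_nonneg_right e5 (mul_nonneg hκ hb0)
          have e7 : Λ * (1 / r ^ 3) * ((h₀ - z.2) * cubePos c (U s (z.1 + z.2) - U s z.1)) ≤
              Λ * (1 / r ^ 3) * (h₀ * D) := by gcongr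
          have e8 : Λ * (1 / r ^ 3) * (h₀ * D) = Λ * (h₀ * D) / r ^ 3 := by ring
          linarith
        rw [integral_sub (icont _ (by fun_prop)) (icont _ (by fun_prop)), integral_const_mul,
          setIntegral_const, smul_eq_mul] at hle
        have hvol : (volume.real K) = 2 * r ^ 2 * h₀ := by
          simp only [K, Measure.real, Measure.volume_eq_prod, Measure.prod_prod, Real.volume_Icc]
          rw [ENNReal.toReal_mul, ENNReal.toReal_ofReal (by nlinarith),
            ENNReal.toReal_ofReal (by linarith)]
          ring
        rw [hvol] at hle
        have e9 : 2 * r ^ 2 * h₀ * (Λ * (h₀ * D) / r ^ 3) = 2 * Λ * (h₀ ^ 2 * D) / r := by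
          field_simp
        rw [e9] at hle
        have hpos : 0 ≤ 2 * Λ * (h₀ ^ 2 * D) / r := by positivity
        have := mul_le_mul_of_nonneg_left hle hE0.le
        have h10 : Real.exp (-(Λ * s)) * (2 * Λ * (h₀ ^ 2 * D) / r) ≤
          2 * Λ * (h₀ ^ 2 * D) / r := mul_le_of_le_one_left hpos hE1
        linarith
      have := mul_le_mul_of_nonneg_left key hE0.le
      linarith
    have hlim := h.tendsto_doubled_initial hU₀ hM hM₀ hh₀ hmod (R := r ^ 2) (by positivity)
      (ψ := fun s x => Real.exp (-(Λ * s)) * cutoff r x) (fun s _ => by fun_prop) (by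
        intro s hs x hx
        rw [abs_of_nonneg (mul_nonneg (Real.exp_pos _).le (cutoff_nonneg r x))]
        exact mul_le_one₀ (Real.exp_le_one_iff.2 (by nlinarith [show 0 < s from hs]))
          (cutoff_nonneg r x) (cutoff_le_one hr0 hx))
    have hft := le_add_mul_of_tendsto_of_deriv_le ⟨ht, by linarith⟩ hder
      (fun s hs => hneg s ⟨hs.1, hs.2.trans (by linarith)⟩) hlim
    rw [setIntegral_rectangle (g := fun z => Real.exp (-(Λ * t)) * cutoff r z.1 *
          ((h₀ - z.2) * cubePos c (U t (z.1 + z.2) - U t z.1))) (by fun_prop)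
          (by nlinarith) hh₀] at hft
    simp only [mul_assoc (Real.exp (-(Λ * t))), intervalIntegral.integral_const_mul] at hft
    have hexp : Real.exp (Λ * t) * Real.exp (-(Λ * t)) = 1 := by rw [← Real.exp_add]; simp
    have := mul_le_mul_of_nonneg_left hft (Real.exp_pos (Λ * t)).le
    rw [← mul_assoc, hexp, one_mul] at this
    refine this.trans (le_of_eq ?_)
    ring
  -- The weight `h₀ - k` is positive exactly for distances below `h₀`; this is why the end point is
  -- excluded.
  by_contra hlt
  have hpos : 0 < ∫ k in (0 : ℝ)..h₀, (h₀ - k) * cubePos c (U t (x + k) - U t x) := by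
    refine intervalIntegral.integral_pos (hk.1.trans hk.2)
      (Continuous.continuousOn (by fun_prop))
      (fun k hk => mul_nonneg (by linarith [hk.2]) (cubePos_nonneg _ _))
      ⟨k, ⟨hk.1.le, hk.2.le⟩, mul_pos (by linarith [hk.2]) (lt_of_le_of_ne (cubePos_nonneg _ _) ?_)⟩
    intro h0
    exact hlt (cubePos_eq_zero_iff.1 h0.symm)
  exact hpos.ne' (hF0 x)

end IsViscousSolution

/-! ### Square integrable functions -/

theorem sqL2Norm_eq_integral {f : ℝ → ℝ} (hf : MemLp f 2 volume) :
    sqL2Norm f = ∫ x, f x ^ 2 := by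
  have h0 : 0 ≤ ∫ x, f x ^ 2 := integral_nonneg fun x => sq_nonneg _
  rw [sqL2Norm, MemLp.eLpNorm_eq_integral_rpow_norm (by norm_num) (by norm_num) hf]
  simp only [ENNReal.toReal_ofNat, Real.rpow_ofNat, Real.norm_eq_abs, sq_abs]
  rw [ENNReal.toReal_ofReal (by positivity), ← Real.rpow_natCast, ← Real.rpow_mul h0]
  norm_num

theorem integral_abs_mul_abs_le_sqrt {μ : Measure ℝ} {f g : ℝ → ℝ} (hf : MemLp f 2 μ)
    (hg : MemLp g 2 μ) :
    ∫ x, |f x| * |g x| ∂μ ≤ √(∫ x, f x ^ 2 ∂μ) * √(∫ x, g x ^ 2 ∂μ) := by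
  have := integral_mul_norm_le_Lp_mul_Lq (p := 2) (q := 2) (μ := μ) (f := f) (g := g)
    (by rw [Real.holderConjugate_iff]; norm_num) (by simpa using hf) (by simpa using hg)
  simpa only [Real.norm_eq_abs, Real.rpow_ofNat, sq_abs, ← Real.sqrt_eq_rpow] using this

/-! ### One-sided modulus of the initial value -/

/-- Convolutions with normalized bumps of shrinking support are integrals against admissible test
functions, and they converge to `f` almost everywhere. -/
theorem ae_nonneg_of_integral_contDiff_nonneg {f : ℝ → ℝ} (hf : LocallyIntegrable f volume)
    (h : ∀ φ : ℝ → ℝ, ContDiff ℝ ∞ φ → HasCompactSupport φ → (∀ x, 0 ≤ φ x) →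
      0 ≤ ∫ x, φ x * f x) : ∀ᵐ x, 0 ≤ f x := by
  let φ : ℕ → ContDiffBump (0 : ℝ) := fun n =>
    ⟨1 / (n + 1), 2 * (1 / (n + 1)), by positivity, by
      have : (0 : ℝ) < 1 / (n + 1) := by positivity
      linarith⟩
  have hφ : Tendsto (fun n => (φ n).rOut) atTop (𝓝 0) := by
    have := (tendsto_one_div_add_atTop_nhds_zero_nat (𝕜 := ℝ)).const_mul 2
    rwa [mul_zero] at this
  filter_upwards [ContDiffBump.ae_convolution_tendsto_right_of_locallyIntegrable (K := 2) hφ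
    (Eventually.of_forall fun n => le_rfl) hf] with x hx
  refine ge_of_tendsto hx (Eventually.of_forall fun n => ?_)
  rw [convolution_eq_swap]
  refine h (fun y => (φ n).normed volume (x - y)) ?_ ?_ fun y => (φ n).nonneg_normed _
  · exact (φ n).contDiff_normed.comp (contDiff_const.sub contDiff_id)
  · exact (φ n).hasCompactSupport_normed.comp_homeomorph (Homeomorph.subLeft x)

/-- Tested against `φ ≥ 0` of mass `m`, the increment is the pairing of `u'` with `Ψ x = ∫_{x-h}^{x}
φ`. The negative part of `u'` only helps. Since `0 ≤ Ψ ≤ m` and `∫ Ψ ≤ h * m`, the `L²` norm of `Ψ`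
is at most `√h * m`, and Cauchy-Schwarz against `g` gives `K * √h * m`. -/
theorem increment_le_of_isDerivPosPart {u g : ℝ → ℝ} (hg : IsDerivPosPart u g)
    (hg2 : MemLp g 2 volume) {K : ℝ} (hK0 : 0 ≤ K) (hK : eLpNorm g 2 volume ≤ ENNReal.ofReal K)
    {h : ℝ} (hh : 0 < h) : ∀ᵐ x, u (x + h) - u x ≤ K * √h := by
  obtain ⟨gmeas, gnonneg, ν, hν⟩ := hg
  have hu := hν.locallyIntegrable
  have hush : LocallyIntegrable (fun x => u (x + h)) volume := by
    rw [locallyIntegrable_iff]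
    intro k hk
    have := (locallyIntegrable_iff.1 hu) _ (hk.image (continuous_add_const h))
    rw [← (measurePreserving_add_right volume h).integrableOn_comp_preimage
      (Homeomorph.addRight h).measurableEmbedding] at this
    exact this.mono_set (subset_preimage_image _ _)
  have hint : LocallyIntegrable (fun x => K * √h - (u (x + h) - u x)) volume :=
    (locallyIntegrable_const _).sub (hush.sub hu)
  have hmain : ∀ᵐ x, 0 ≤ K * √h - (u (x + h) - u x) := by
    refine ae_nonneg_of_integral_contDiff_nonneg hint fun φ hφ hφc hφ0 => ?_
    have cφ : Continuous φ := hφ.continuous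
    have iφ : Integrable φ := cφ.integrable_of_hasCompactSupport hφc
    set m := ∫ x, φ x
    -- the primitive of the increment
    set Φ : ℝ → ℝ := fun x => ∫ s in (0 : ℝ)..x, φ s with hΦ
    have dΦ : ∀ x, HasDerivAt Φ (φ x) x := hasDerivAt_integral_upper cφ 0
    have sΦ : ContDiff ℝ ∞ Φ := by
      rw [contDiff_infty_iff_deriv]
      refine ⟨fun x => (dΦ x).differentiableAt, ?_⟩
      rwa [show deriv Φ = φ from funext fun x => (dΦ x).deriv]
    set Ψ : ℝ → ℝ := fun x => Φ x - Φ (x - h) with hΨ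
    have sΨ : ContDiff ℝ ∞ Ψ := sΦ.sub (sΦ.comp (contDiff_id.sub contDiff_const))
    have cΨ : Continuous Ψ := sΨ.continuous
    have dΨ : ∀ x, deriv Ψ x = φ x - φ (x - h) := fun x =>
      ((dΦ x).sub ((dΦ (x - h)).comp_sub_const x h)).deriv
    have Ψeq : ∀ x, Ψ x = ∫ s in (x - h)..x, φ s := fun x =>
      intervalIntegral.integral_interval_sub_left (cφ.intervalIntegrable _ _)
        (cφ.intervalIntegrable _ _)
    have Ψ0 : ∀ x, 0 ≤ Ψ x := fun x => by
      rw [Ψeq]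
      exact intervalIntegral.integral_nonneg (by linarith) fun s _ => hφ0 s
    have Ψm : ∀ x, Ψ x ≤ m := fun x => by
      rw [Ψeq, intervalIntegral.integral_of_le (by linarith)]
      exact setIntegral_le_integral iφ (Eventually.of_forall hφ0)
    obtain ⟨B, hB⟩ := hφc.isCompact.isBounded.subset_closedBall 0
    have hφB : ∀ x, B < |x| → φ x = 0 := fun x hx => by
      by_contra hne
      have := hB (subset_tsupport _ hne)
      rw [mem_closedBall_zero_iff, Real.norm_eq_abs] at this
      linarith
    have hΨB : ∀ x, x ∉ Icc (-(|B| + h)) (|B| + h) → Ψ x = 0 := fun x hx => by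
      rw [Ψeq, intervalIntegral.integral_congr (g := fun _ => (0 : ℝ))]
      · simp
      · intro s hs
        rw [uIcc_of_le (by linarith)] at hs
        apply hφB
        refine lt_of_le_of_lt (le_abs_self B) ?_
        rw [mem_Icc, not_and_or, not_le, not_le] at hx
        rcases hx with hx | hx
        · rw [lt_abs]; right; linarith [hs.2]
        · rw [lt_abs]; left; linarith [hs.1]
    have Ψc : HasCompactSupport Ψ := HasCompactSupport.intro isCompact_Icc hΨB
    have iΨ : Integrable Ψ := cΨ.integrable_of_hasCompactSupport Ψc
    have hΨint : ∫ x, Ψ x ≤ h * m := by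
      have e0 : ∫ x, Ψ x = ∫ x in (-(|B| + h))..(|B| + h), Ψ x := by
        rw [intervalIntegral.integral_of_le (by linarith [abs_nonneg B]),
          ← integral_Icc_eq_integral_Ioc, setIntegral_eq_integral_of_forall_compl_eq_zero hΨB]
      have e1 : ∀ x, Ψ x = ∫ s in (0 : ℝ)..h, φ (x - s) := fun x => by
        rw [Ψeq, intervalIntegral.integral_comp_sub_left (fun s => φ s)]
        simp
      rw [e0]
      simp only [e1]
      rw [intervalIntegral_swap_of_continuous (F := fun x s => φ (x - s)) (by fun_prop)]
      have e2 : ∀ s, ∫ x in (-(|B| + h))..(|B| + h), φ (x - s) ≤ m := fun s => by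
        rw [intervalIntegral.integral_of_le (by linarith [abs_nonneg B])]
        refine (setIntegral_le_integral (iφ.comp_sub_right s)
          (Eventually.of_forall fun x => hφ0 _)).trans ?_
        rw [integral_sub_right_eq_self φ s]
      have e3 : Continuous fun s => ∫ x in (-(|B| + h))..(|B| + h), φ (x - s) :=
        intervalIntegral.continuous_parametric_intervalIntegral_of_continuous'
          (f := fun s x => φ (x - s)) (by fun_prop) _ _
      refine (intervalIntegral.integral_mono_on hh.le (e3.intervalIntegrable _ _)
        (intervalIntegrable_const (c := m)) fun s _ => e2 s).trans ?_
      simp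
    have hΨ2 : ∫ x, Ψ x ^ 2 ≤ h * m ^ 2 := by
      have : ∫ x, Ψ x ^ 2 ≤ ∫ x, m * Ψ x := by
        refine integral_mono_of_nonneg (Eventually.of_forall fun x => sq_nonneg _)
          (iΨ.const_mul m) (Eventually.of_forall fun x => ?_)
        simp only [sq]
        exact mul_le_mul_of_nonneg_right (Ψm x) (Ψ0 x)
      rw [integral_const_mul] at this
      have hm0 : 0 ≤ m := integral_nonneg hφ0
      nlinarith
    have hΨmem : MemLp Ψ 2 volume := cΨ.memLp_of_hasCompactSupport Ψc
    have hg2' : √(∫ x, g x ^ 2) ≤ K := by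
      rw [← sqL2Norm_eq_integral hg2, sqL2Norm, Real.sqrt_sq ENNReal.toReal_nonneg]
      exact ENNReal.toReal_le_of_le_ofReal hK0 hK
    have hCS : ∫ x, g x * Ψ x ≤ K * √h * m := by
      have e1 : ∫ x, g x * Ψ x = ∫ x, |g x| * |Ψ x| := by
        refine integral_congr_ae ?_
        filter_upwards [gnonneg] with x hx
        rw [abs_of_nonneg hx, abs_of_nonneg (Ψ0 x)]
      rw [e1]
      refine (integral_abs_mul_abs_le_sqrt hg2 hΨmem).trans ?_
      have hm0 : 0 ≤ m := integral_nonneg hφ0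
      have e2 : √(∫ x, Ψ x ^ 2) ≤ √h * m := by
        refine (Real.sqrt_le_sqrt hΨ2).trans ?_
        rw [Real.sqrt_mul hh.le, Real.sqrt_sq hm0]
      calc _ ≤ K * (√h * m) := mul_le_mul hg2' e2 (Real.sqrt_nonneg _) hK0
        _ = _ := by ring
    have hibp := hν.integral_by_parts Ψ sΨ Ψc
    have hμ : ∫ x, Ψ x ∂(volume.withDensity fun x => ENNReal.ofReal (g x)) = ∫ x, g x * Ψ x := by
      rw [integral_withDensity_eq_integral_toReal_smul₀ gmeas.ennreal_ofReal
        (Eventually.of_forall fun x => ENNReal.ofReal_lt_top)]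
      refine integral_congr_ae ?_
      filter_upwards [gnonneg] with x hx
      rw [ENNReal.toReal_ofReal hx, smul_eq_mul]
    have hν0 : 0 ≤ ∫ x, Ψ x ∂ν := integral_nonneg Ψ0
    have i1 : Integrable fun x => u x * φ x :=
      hu.integrable_smul_right_of_hasCompactSupport cφ hφc
    have i2 : Integrable fun x => u (x + h) * φ x :=
      hush.integrable_smul_right_of_hasCompactSupport cφ hφc
    have i4 : Integrable fun x => u (x + h) * φ x - u x * φ x := i2.sub i1
    have i3 : Integrable fun x => u x * φ (x - h) := by
      simpa using i2.comp_sub_right h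
    have hshift : ∫ x, u (x + h) * φ x = ∫ x, u x * φ (x - h) := by
      rw [← integral_add_right_eq_self (fun x => u x * φ (x - h)) h]
      simp
    have hdecomp : ∫ x, φ x * (K * √h - (u (x + h) - u x)) =
        K * √h * m - ((∫ x, u (x + h) * φ x) - ∫ x, u x * φ x) := by
      rw [← integral_sub i2 i1, ← integral_const_mul, ← integral_sub (iφ.const_mul _) i4]
      refine integral_congr_ae (Eventually.of_forall fun x => ?_)
      simp only
      ring
    have hder : ∫ x, u x * deriv Ψ x = (∫ x, u x * φ x) - ∫ x, u x * φ (x - h) := by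
      rw [← integral_sub i1 i3]
      refine integral_congr_ae (Eventually.of_forall fun x => ?_)
      simp only [dΨ]
      ring
    rw [hdecomp, hshift]
    rw [hder, hμ] at hibp
    linarith
  filter_upwards [hmain] with x hx
  linarith

/-! ### The mean characteristic speed -/

/-- The weighted mean `2 ∫₀¹ s a(c + s (u - c)) ds` of the speed `a` between `c` and `u`. -/
noncomputable def meanSpeed (a : ℝ → ℝ) (c u : ℝ) : ℝ :=
  ∫ s in (0 : ℝ)..1, 2 * s * a (c + (u - c) * s)

section MeanSpeed

variable {a : ℝ → ℝ}

/-- The flux of the entropy `(u - c) ^ 2` factors through the entropy itself. The factor is the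
speed of the energy, to be compared with the speed of the moving layer. Writing it as an average
avoids dividing by `(u - c) ^ 2`. -/
theorem hasDerivAt_sq_mul_meanSpeed (ha : Continuous a) (c u : ℝ) :
    HasDerivAt (fun u => (u - c) ^ 2 * meanSpeed a c u) (2 * (u - c) * a u) u := by
  have heq : (fun u => (u - c) ^ 2 * meanSpeed a c u) =
      fun u => ∫ v in c..u, 2 * (v - c) * a v := by
    funext u
    have := intervalIntegral.mul_integral_comp_add_mul (a := 0) (b := 1)
      (f := fun v => 2 * (v - c) * a v) (u - c) c
    simp only [mul_zero, add_zero, mul_one, add_sub_cancel] at this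
    rw [← this, meanSpeed, ← intervalIntegral.integral_const_mul,
      ← intervalIntegral.integral_const_mul]
    refine intervalIntegral.integral_congr fun s _ => ?_
    ring
  rw [heq]
  exact hasDerivAt_integral_upper (f := fun v => 2 * (v - c) * a v) (by fun_prop) c u

theorem intervalIntegrable_meanSpeed (ha : Continuous a) (c u : ℝ) :
    IntervalIntegrable (fun s => 2 * s * a (c + (u - c) * s)) volume 0 1 :=
  Continuous.intervalIntegrable (by fun_prop) _ _

theorem meanSpeed_mono (ha : Continuous a) (ha' : Monotone a) (c : ℝ) :
    Monotone (meanSpeed a c) := by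
  intro u v huv
  refine intervalIntegral.integral_mono_on zero_le_one (intervalIntegrable_meanSpeed ha c u)
    (intervalIntegrable_meanSpeed ha c v) fun s hs => ?_
  have hs0 := hs.1
  gcongr
  exact ha' (by gcongr)

theorem segment_mem_Icc {m c u s : ℝ} (hc : c ∈ Icc (-m) m) (hu : u ∈ Icc (-m) m)
    (hs : s ∈ Icc (0 : ℝ) 1) : c + (u - c) * s ∈ Icc (-m) m := by
  obtain ⟨h1, h2⟩ := hc
  obtain ⟨h3, h4⟩ := hu
  obtain ⟨h5, h6⟩ := hs
  constructor <;> nlinarith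

theorem integral_two_mul_unit (L : ℝ) : ∫ s in (0 : ℝ)..1, 2 * s * L = L := by
  rw [intervalIntegral.integral_mul_const, intervalIntegral.integral_const_mul, integral_id]
  norm_num

theorem abs_meanSpeed_le {m L c u : ℝ} (hL : ∀ s ∈ Icc (-m) m, |a s| ≤ L)
    (hc : c ∈ Icc (-m) m) (hu : u ∈ Icc (-m) m) : |meanSpeed a c u| ≤ L := by
  rw [← integral_two_mul_unit L, ← Real.norm_eq_abs, meanSpeed]
  refine intervalIntegral.norm_integral_le_of_norm_le zero_le_one
    (Eventually.of_forall fun s hs => ?_) (Continuous.intervalIntegrable (by fun_prop) _ _)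
  have hs0 := hs.1
  rw [norm_mul, Real.norm_of_nonneg (by positivity)]
  gcongr
  exact hL _ (segment_mem_Icc hc hu ⟨hs.1.le, hs.2⟩)

theorem abs_meanSpeed_sub_le (ha : Continuous a) {m C c u v : ℝ} (hC0 : 0 ≤ C)
    (hC : ∀ x ∈ Icc (-m) m, ∀ y ∈ Icc (-m) m, |a x - a y| ≤ C * |x - y|)
    (hc : c ∈ Icc (-m) m) (hu : u ∈ Icc (-m) m) (hv : v ∈ Icc (-m) m) :
    |meanSpeed a c u - meanSpeed a c v| ≤ C * |u - v| := by
  rw [← integral_two_mul_unit (C * |u - v|), ← Real.norm_eq_abs, meanSpeed, meanSpeed,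
    ← intervalIntegral.integral_sub (intervalIntegrable_meanSpeed ha c u)
      (intervalIntegrable_meanSpeed ha c v)]
  refine intervalIntegral.norm_integral_le_of_norm_le zero_le_one
    (Eventually.of_forall fun s hs => ?_) (Continuous.intervalIntegrable (by fun_prop) _ _)
  have hs0 := hs.1
  rw [← mul_sub, norm_mul, Real.norm_of_nonneg (by positivity)]
  gcongr
  refine (hC _ (segment_mem_Icc hc hu ⟨hs.1.le, hs.2⟩) _
    (segment_mem_Icc hc hv ⟨hs.1.le, hs.2⟩)).trans ?_
  refine mul_le_mul_of_nonneg_left ?_ hC0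
  rw [show c + (u - c) * s - (c + (v - c) * s) = (u - v) * s by ring, abs_mul,
    abs_of_pos hs0]
  exact mul_le_of_le_one_right (abs_nonneg _) hs.2

theorem meanSpeed_lt (ha : Continuous a) (ha' : StrictMono a) {c d : ℝ} (hcd : c < d) (u : ℝ) :
    meanSpeed a c u < meanSpeed a d u := by
  refine intervalIntegral.integral_lt_integral_of_continuousOn_of_le_of_exists_lt zero_lt_one
    (Continuous.continuousOn (by fun_prop)) (Continuous.continuousOn (by fun_prop))
    (fun s hs => ?_) ⟨1 / 2, ⟨by norm_num, by norm_num⟩, ?_⟩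
  · have hs0 := hs.1
    gcongr 2 * s * ?_
    exact ha'.monotone (by nlinarith [hs.2])
  · have := ha' (show c + (u - c) * (1 / 2) < d + (u - d) * (1 / 2) by linarith)
    linarith

/-- The difference is continuous and positive on a compact interval. The gap is recorded as `4 * θ`
because choosing the average speed leaves `2 * θ` on each side, of which one `θ` pays for the
admissible increments and the other for viscosity. -/
theorem exists_meanSpeed_gap (ha : Continuous a) (ha' : StrictMono a) {c d : ℝ} (hcd : c < d)
    {m C : ℝ} (hC0 : 0 ≤ C)
    (hC : ∀ x ∈ Icc (-m) m, ∀ y ∈ Icc (-m) m, |a x - a y| ≤ C * |x - y|)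
    (hc : c ∈ Icc (-m) m) (hd : d ∈ Icc (-m) m) :
    ∃ θ > 0, ∀ u ∈ Icc (-m) m, 4 * θ ≤ meanSpeed a d u - meanSpeed a c u := by
  have hcont : ∀ e ∈ Icc (-m) m, ContinuousOn (meanSpeed a e) (Icc (-m) m) := by
    intro e he
    refine LipschitzOnWith.continuousOn (K := C.toNNReal) (LipschitzOnWith.of_dist_le_mul ?_)
    intro u hu v hv
    rw [Real.coe_toNNReal C hC0]
    exact abs_meanSpeed_sub_le ha hC0 hC he hu hv
  obtain ⟨u₀, hu₀, hmin⟩ := isCompact_Icc.exists_isMinOn ⟨c, hc⟩ ((hcont d hd).sub (hcont c hc))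
  refine ⟨(meanSpeed a d u₀ - meanSpeed a c u₀) / 4, ?_, fun u hu => ?_⟩
  · linarith [meanSpeed_lt ha ha' hcd u₀]
  · have := hmin hu
    simp only [mem_ofPred_eq, Pi.sub_apply] at this
    linarith

end MeanSpeed

/-! ### The shift -/

namespace IsViscousSolution

variable {A : ℝ → ℝ} {ε : ℝ} {U₀ : ℝ → ℝ} {U : ℝ → ℝ → ℝ}

/-- A curve which follows the velocity `V (U t X)` after the time `τ`. -/
theorem exists_shift (h : IsViscousSolution A ε U₀ U) {m L C τ T : ℝ} {V : ℝ → ℝ}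
    (hm : ∀ t > 0, ∀ x, |U t x| ≤ m) (hL : ∀ u ∈ Icc (-m) m, |V u| ≤ L) (hC0 : 0 ≤ C)
    (hC : ∀ u ∈ Icc (-m) m, ∀ v ∈ Icc (-m) m, |V u - V v| ≤ C * |u - v|)
    (hτ : 0 < τ) (hT : 0 < T) :
    ∃ X v : ℝ → ℝ, ContinuousOn X (Icc 0 T) ∧ X 0 = 0 ∧
      (∀ t ∈ Ioo 0 T, HasDerivAt X (v t) t) ∧ (∀ t ∈ Ioo 0 T, |v t| ≤ L) ∧
      ContinuousOn v (Ioo 0 T) ∧ ∀ t ∈ Ioo 0 T, τ ≤ t → v t = V (U t (X t)) := by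
  have hmem : ∀ t > 0, ∀ x, U t x ∈ Icc (-m) m := fun t ht x => abs_le.1 (hm t ht x)
  have hL0 : 0 ≤ L := (abs_nonneg _).trans (hL _ (hmem 1 one_pos 0))
  -- `U` need not be continuous up to the initial time. The ramp vanishes up to `τ / 2` and equals
  -- `1` from `τ` on; together with the frozen time `max t (τ / 2)` it makes the velocity field
  -- continuous on the whole plane.
  set χ : ℝ → ℝ := fun t => max 0 (min 1 (2 * t / τ - 1)) with hχ
  have χ0 : ∀ t, 0 ≤ χ t := fun t => le_max_left _ _
  have χ1 : ∀ t, χ t ≤ 1 := fun t => max_le zero_le_one (min_le_left _ _)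
  have cχ : Continuous χ := by fun_prop
  have hmax : ∀ t, τ / 2 ≤ max t (τ / 2) := fun t => le_max_right _ _
  have hmax0 : ∀ t, 0 < max t (τ / 2) := fun t => (half_pos hτ).trans_le (hmax t)
  set b : ℝ → ℝ → ℝ := fun t x => χ t * V (U (max t (τ / 2)) x) with hb
  have cV : ContinuousOn V (Icc (-m) m) := by
    refine LipschitzOnWith.continuousOn (K := C.toNNReal) (LipschitzOnWith.of_dist_le_mul ?_)
    intro u hu v hv
    rw [Real.coe_toNNReal C hC0]
    exact hC u hu v hv
  have cb : Continuous fun p : ℝ × ℝ => b p.1 p.2 := by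
    have c1 : Continuous fun p : ℝ × ℝ => U (max p.1 (τ / 2)) p.2 := by
      rw [← continuousOn_univ]
      exact h.continuousOn_uncurry.comp (f := fun p : ℝ × ℝ => (max p.1 (τ / 2), p.2))
        (by fun_prop) (fun p _ => ⟨hmax0 p.1, mem_univ _⟩)
    have c2 : Continuous fun p : ℝ × ℝ => V (U (max p.1 (τ / 2)) p.2) :=
      cV.comp_continuous c1 fun p => hmem _ (hmax0 _) _
    exact (cχ.comp continuous_fst).mul c2
  have hbL : ∀ t x, |b t x| ≤ L := by
    intro t x
    rw [hb, abs_mul, abs_of_nonneg (χ0 t)]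
    exact (mul_le_of_le_one_left (abs_nonneg _) (χ1 t)).trans (hL _ (hmem _ (hmax0 _) _))
  obtain ⟨D, hD⟩ := h.exists_lipschitz_bound (half_pos hτ) (max T (τ / 2)) (L * T)
  -- The speed is at most `L`, so the ball of radius `L * T` cannot be left before `T` and a single
  -- application covers the whole time interval.
  have hpl : IsPicardLindelof b (tmin := 0) (tmax := T) ⟨0, le_rfl, hT.le⟩ (0 : ℝ)
      (L * T).toNNReal 0 L.toNNReal (C.toNNReal * D) := by
    refine ⟨fun t ht => ?_, fun x _ => ?_, fun t _ x _ => ?_, ?_⟩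
    · refine LipschitzOnWith.of_dist_le_mul fun x hx y hy => ?_
      rw [Real.closedBall_eq_Icc, Real.coe_toNNReal _ (by positivity), zero_sub, zero_add] at hx hy
      have h1 := (hD (max t (τ / 2)) ⟨hmax t, max_le_max_right _ ht.2⟩).dist_le_mul x hx y hy
      rw [Real.dist_eq, hb]
      simp only
      rw [← mul_sub, abs_mul, abs_of_nonneg (χ0 t), NNReal.coe_mul, Real.coe_toNNReal C hC0]
      calc χ t * |V (U (max t (τ / 2)) x) - V (U (max t (τ / 2)) y)|
          ≤ 1 * (C * (D * dist x y)) := by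
            gcongr
            · exact χ1 t
            · refine (hC _ (hmem _ (hmax0 _) _) _ (hmem _ (hmax0 _) _)).trans ?_
              gcongr
              exact h1
        _ = C * D * dist x y := by ring
    · exact (cb.comp (f := fun t : ℝ => (t, x)) (by fun_prop)).continuousOn
    · rw [Real.coe_toNNReal L hL0]
      exact hbL t x
    · rw [Real.coe_toNNReal L hL0, Real.coe_toNNReal _ (by positivity)]
      simp [hT.le]
  obtain ⟨X, hX0, hX⟩ := hpl.exists_eq_forall_mem_Icc_hasDerivWithinAt₀
  have cX : ContinuousOn X (Icc 0 T) := fun t ht => (hX t ht).continuousWithinAt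
  refine ⟨X, fun t => b t (X t), cX, hX0, fun t ht =>
    (hX t ⟨ht.1.le, ht.2.le⟩).hasDerivAt (Icc_mem_nhds ht.1 ht.2), fun t _ => hbL _ _,
    ?_, fun t _ hτt => ?_⟩
  · exact cb.comp_continuousOn (continuousOn_id.prodMk (cX.mono Ioo_subset_Icc_self))
  · have e1 : χ t = 1 := by
      have : 1 ≤ 2 * t / τ - 1 := by
        have : 2 ≤ 2 * t / τ := by rw [le_div_iff₀ hτ]; linarith
        linarith
      simp only [hχ]
      rw [min_eq_left this, max_eq_right zero_le_one]
    simp only [hb]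
    rw [e1, one_mul, max_eq_left (by linarith)]

end IsViscousSolution

/-! ### The layer profile -/

/-- A smooth transition from `1` to `0` (for `σ = 1`) or from `0` to `1` (for `σ = -1`),
of width `1 / k` and centered at `-σ δ`. -/
noncomputable def layer (σ δ k y : ℝ) : ℝ := Real.sigmoid (-((σ * y + δ) * k))

/-- The derivative of `layer`. -/
noncomputable def layer' (σ δ k y : ℝ) : ℝ :=
  -(σ * k * (layer σ δ k y * (1 - layer σ δ k y)))

/-- The second derivative of `layer` for `σ ^ 2 = 1`. -/
noncomputable def layer'' (σ δ k y : ℝ) : ℝ :=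
  k ^ 2 * (layer σ δ k y * (1 - layer σ δ k y) * (1 - 2 * layer σ δ k y))

/-- A bump of width `2 / k` centered like `layer`. -/
noncomputable def layerBump (σ δ k y : ℝ) : ℝ :=
  Real.sigmoid ((σ * y + δ) * k / 2) * (1 - Real.sigmoid ((σ * y + δ) * k / 2))

section Layer

variable {σ δ k : ℝ}

theorem layer_nonneg (y : ℝ) : 0 ≤ layer σ δ k y := Real.sigmoid_nonneg _

theorem layer_le_one (y : ℝ) : layer σ δ k y ≤ 1 := Real.sigmoid_le_one _

theorem hasDerivAt_layer (y : ℝ) : HasDerivAt (layer σ δ k) (layer' σ δ k y) y := by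
  have h1 : HasDerivAt (fun y => -((σ * y + δ) * k)) (-(σ * 1 * k)) y :=
    ((((hasDerivAt_id y).const_mul σ).add_const δ).mul_const k).neg
  refine ((Real.hasDerivAt_sigmoid _).comp y h1).congr_deriv ?_
  simp only [layer', layer]
  ring

/-- The logistic profile is chosen because its second derivative is at most `k` times the absolute
value of its first. With `ε * k = θ`, the viscous term is then comparable with the transport term at
every point. -/
theorem hasDerivAt_layer' (hσ : σ ^ 2 = 1) (y : ℝ) :
    HasDerivAt (layer' σ δ k) (layer'' σ δ k y) y := by
  have h := hasDerivAt_layer (σ := σ) (δ := δ) (k := k) y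
  refine ((h.mul (h.const_sub 1)).const_mul (σ * k)).neg.congr_deriv ?_
  simp only [layer'', layer']
  linear_combination (k ^ 2 * (layer σ δ k y * (1 - layer σ δ k y) * (1 - 2 * layer σ δ k y))) * hσ

theorem continuous_layer : Continuous (layer σ δ k) :=
  continuous_iff_continuousAt.2 fun y => (hasDerivAt_layer y).continuousAt

theorem continuous_layer' : Continuous (layer' σ δ k) := by
  have := continuous_layer (σ := σ) (δ := δ) (k := k)
  unfold layer'
  fun_prop

theorem continuous_layer'' : Continuous (layer'' σ δ k) := by
  have := continuous_layer (σ := σ) (δ := δ) (k := k)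
  unfold layer''
  fun_prop

theorem continuous_layerBump : Continuous (layerBump σ δ k) := by
  have := continuous_sigmoid
  unfold layerBump
  fun_prop

theorem layerBump_nonneg (y : ℝ) : 0 ≤ layerBump σ δ k y :=
  mul_nonneg (Real.sigmoid_nonneg _) (by linarith [Real.sigmoid_le_one ((σ * y + δ) * k / 2)])

theorem layer_eq_exp (y : ℝ) : layer σ δ k y =
    Real.exp (-((σ * y + δ) * k / 2)) ^ 2 / (1 + Real.exp (-((σ * y + δ) * k / 2)) ^ 2) := by
  have : Real.exp (-((σ * y + δ) * k / 2)) ^ 2 = Real.exp (-((σ * y + δ) * k)) := by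
    rw [← Real.exp_nat_mul]
    congr 1
    push_cast
    ring
  rw [this, layer, Real.sigmoid_def, neg_neg, Real.exp_neg]
  have := Real.exp_pos ((σ * y + δ) * k)
  field_simp
  ring

theorem layerBump_eq_exp (y : ℝ) : layerBump σ δ k y =
    Real.exp (-((σ * y + δ) * k / 2)) / (1 + Real.exp (-((σ * y + δ) * k / 2))) ^ 2 := by
  have := Real.exp_pos (-((σ * y + δ) * k / 2))
  rw [layerBump, Real.sigmoid_def]
  field_simp
  ring

/-- With `E = exp (-(σ y + δ) k / 2)` the layer is at most `E ^ 2`. One factor `E` gives the small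
constant `exp (-k δ / 2)`, the other is at most four times the bump because `E ≤ 1`. Halving the
decay rate thus keeps the tail both small and integrable. -/
theorem layer_le_bump (hk : 0 ≤ k) (hδ : 0 ≤ δ) {y : ℝ} (hy : 0 ≤ σ * y) :
    layer σ δ k y ≤ 4 * Real.exp (-(k * δ / 2)) * layerBump σ δ k y := by
  rw [layer_eq_exp, layerBump_eq_exp]
  have hE : Real.exp (-((σ * y + δ) * k / 2)) ≤ Real.exp (-(k * δ / 2)) :=
    Real.exp_le_exp.2 (by nlinarith [mul_nonneg hy hk])
  have hE1 : Real.exp (-(k * δ / 2)) ≤ 1 := Real.exp_le_one_iff.2 (by nlinarith [mul_nonneg hk hδ])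
  have hE0 := Real.exp_pos (-((σ * y + δ) * k / 2))
  set E := Real.exp (-((σ * y + δ) * k / 2))
  set κ := Real.exp (-(k * δ / 2))
  have h1 : E ^ 2 / (1 + E ^ 2) ≤ κ * E :=
    (div_le_self (by positivity) (by nlinarith)).trans (by nlinarith)
  have h2 : E ≤ 4 * (E / (1 + E) ^ 2) := by
    rw [← mul_div_assoc, le_div_iff₀ (by positivity)]
    nlinarith [mul_nonneg hE0.le (by linarith : 0 ≤ 1 - E), hE.trans hE1]
  calc _ ≤ κ * E := h1
    _ ≤ κ * (4 * (E / (1 + E) ^ 2)) := by gcongr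
    _ = _ := by ring

theorem one_sub_layer_le_bump (hk : 0 ≤ k) (hδ : 0 ≤ δ) {y : ℝ} (hy : σ * y ≤ -(2 * δ)) :
    1 - layer σ δ k y ≤ 4 * Real.exp (-(k * δ / 2)) * layerBump σ δ k y := by
  rw [layer_eq_exp, layerBump_eq_exp]
  have hE : 1 ≤ Real.exp (-(k * δ / 2)) * Real.exp (-((σ * y + δ) * k / 2)) := by
    rw [← Real.exp_add]
    exact Real.one_le_exp (by nlinarith [mul_nonneg (by linarith : 0 ≤ -(2 * δ) - σ * y) hk])
  have hE1 : Real.exp (-(k * δ / 2)) ≤ 1 := Real.exp_le_one_iff.2 (by nlinarith [mul_nonneg hk hδ])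
  have hE0 := Real.exp_pos (-((σ * y + δ) * k / 2))
  have hκ0 := Real.exp_pos (-(k * δ / 2))
  set E := Real.exp (-((σ * y + δ) * k / 2))
  set κ := Real.exp (-(k * δ / 2))
  have hE2 : 1 ≤ E := by nlinarith
  have h1 : 1 - E ^ 2 / (1 + E ^ 2) ≤ κ * (1 / E) := by
    have : 1 - E ^ 2 / (1 + E ^ 2) = 1 / (1 + E ^ 2) := by field_simp; ring
    rw [this, ← mul_div_assoc, mul_one, div_le_div_iff₀ (by positivity) hE0]
    nlinarith
  have h2 : 1 / E ≤ 4 * (E / (1 + E) ^ 2) := by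
    rw [← mul_div_assoc, div_le_div_iff₀ hE0 (by positivity)]
    nlinarith
  calc _ ≤ κ * (1 / E) := h1
    _ ≤ κ * (4 * (E / (1 + E) ^ 2)) := by gcongr
    _ = _ := by ring

theorem integral_layerBump_le (hσ : σ ^ 2 = 1) (hk : 0 < k) (x₀ a b : ℝ) :
    ∫ x in a..b, layerBump σ δ k (x - x₀) ≤ 2 / k := by
  have hd : ∀ x, HasDerivAt
      (fun x => 2 / k * (σ * Real.sigmoid ((σ * (x - x₀) + δ) * k / 2)))
      (layerBump σ δ k (x - x₀)) x := by
    intro x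
    have h1 : HasDerivAt (fun x => (σ * (x - x₀) + δ) * k / 2) (σ * 1 * k / 2) x :=
      (((((hasDerivAt_id x).sub_const x₀).const_mul σ).add_const δ).mul_const k).div_const 2
    refine (((((Real.hasDerivAt_sigmoid _).comp x h1).const_mul σ)).const_mul
      (2 / k)).congr_deriv ?_
    simp only [layerBump]
    generalize Real.sigmoid ((σ * (x - x₀) + δ) * k / 2) = S
    field_simp
    linear_combination (S * (1 - S)) * hσ
  rw [intervalIntegral.integral_eq_sub_of_hasDerivAt (fun x _ => hd x)
    ((continuous_layerBump.comp (continuous_id.sub continuous_const)).intervalIntegrable _ _),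
    ← mul_sub]
  refine mul_le_of_le_one_right (by positivity) ?_
  have b1 := Real.sigmoid_nonneg ((σ * (b - x₀) + δ) * k / 2)
  have b2 := Real.sigmoid_le_one ((σ * (b - x₀) + δ) * k / 2)
  have b3 := Real.sigmoid_nonneg ((σ * (a - x₀) + δ) * k / 2)
  have b4 := Real.sigmoid_le_one ((σ * (a - x₀) + δ) * k / 2)
  rcases mul_self_eq_one_iff.1 ((sq σ).symm.trans hσ) with rfl | rfl <;> linarith

theorem integral_layer_slope_le (hσ : σ ^ 2 = 1) (x₀ a b : ℝ) :
    ∫ x in a..b, k * (layer σ δ k (x - x₀) * (1 - layer σ δ k (x - x₀))) ≤ 1 := by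
  have hd : ∀ x, HasDerivAt (fun x => -(σ * layer σ δ k (x - x₀)))
      (k * (layer σ δ k (x - x₀) * (1 - layer σ δ k (x - x₀)))) x := by
    intro x
    have h1 : HasDerivAt (fun x => layer σ δ k (x - x₀)) (layer' σ δ k (x - x₀)) x :=
      (hasDerivAt_layer (x - x₀)).comp_sub_const x x₀
    refine (h1.const_mul σ).neg.congr_deriv ?_
    simp only [layer']
    linear_combination (k * (layer σ δ k (x - x₀) * (1 - layer σ δ k (x - x₀)))) * hσ
  have hc : Continuous fun x => layer σ δ k (x - x₀) :=
    continuous_layer.comp (continuous_id.sub continuous_const)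
  rw [intervalIntegral.integral_eq_sub_of_hasDerivAt (fun x _ => hd x)
    (Continuous.intervalIntegrable (by fun_prop) _ _)]
  have b1 := layer_nonneg (σ := σ) (δ := δ) (k := k) (b - x₀)
  have b2 := layer_le_one (σ := σ) (δ := δ) (k := k) (b - x₀)
  have b3 := layer_nonneg (σ := σ) (δ := δ) (k := k) (a - x₀)
  have b4 := layer_le_one (σ := σ) (δ := δ) (k := k) (a - x₀)
  rcases mul_self_eq_one_iff.1 ((sq σ).symm.trans hσ) with rfl | rfl <;> linarith

end Layer

/-! ### The energy on one side of the shock -/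

theorem hasDerivAt_sub_sq (c u : ℝ) : HasDerivAt (fun u => (u - c) ^ 2) (2 * (u - c)) u :=
  (((hasDerivAt_id u).sub_const c).pow 2).congr_deriv (by simp)

theorem hasDerivAt_two_mul_sub (c u : ℝ) : HasDerivAt (fun u => 2 * (u - c)) 2 u :=
  (((hasDerivAt_id u).sub_const c).const_mul 2).congr_deriv (by simp)

/-- The production of the layer energy is bounded by the mass of the slope of the layer. -/
theorem integral_layer_production_le {u W a : ℝ → ℝ} {σ δ k ε θ L m c v x₀ R N : ℝ}
    (ha : Continuous a) (hu : Continuous u) (hσ : σ ^ 2 = 1) (hk : 0 ≤ k) (hεk : ε * k = θ)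
    (hθ : 0 ≤ θ) (hR : 0 ≤ R)
    (cW : Continuous W) (hW0 : ∀ x, 0 ≤ W x) (hW1 : ∀ x ∈ Icc (-R) R, W x ≤ 1)
    (hL : ∀ s ∈ Icc (-m) m, |a s| ≤ L) (hc : c ∈ Icc (-m) m) (hu' : ∀ x, u x ∈ Icc (-m) m)
    (hv : |v| ≤ L) (hN : N = (2 * L + θ) * (2 * m) ^ 2) {S : ℝ → ℝ} (cS : Continuous S)
    (hS0 : ∀ x, 0 ≤ S x)
    (hS : ∀ x, σ * (meanSpeed a c (u x) - v) < θ →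
      k * (layer σ δ k (x - x₀) * (1 - layer σ δ k (x - x₀))) ≤ S x) :
    ∫ x in (-R)..R, W x * (layer' σ δ k (x - x₀) * ((u x - c) ^ 2 * meanSpeed a c (u x) -
      v * (u x - c) ^ 2) + ε * (layer'' σ δ k (x - x₀) * (u x - c) ^ 2)) ≤
    N * ∫ x in (-R)..R, S x := by
  have hL0 : 0 ≤ L := (abs_nonneg _).trans hv
  have c1 : Continuous fun x => layer' σ δ k (x - x₀) :=
    continuous_layer'.comp (continuous_id.sub continuous_const)
  have c2 : Continuous fun x => layer'' σ δ k (x - x₀) :=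
    continuous_layer''.comp (continuous_id.sub continuous_const)
  have c3 : Continuous fun x => (u x - c) ^ 2 * meanSpeed a c (u x) :=
    (continuous_iff_continuousAt.2 fun u =>
      (hasDerivAt_sq_mul_meanSpeed ha c u).continuousAt).comp hu
  rw [← intervalIntegral.integral_const_mul]
  refine intervalIntegral.integral_mono_on (by linarith)
    (Continuous.intervalIntegrable (by fun_prop) _ _)
    (Continuous.intervalIntegrable (by fun_prop) _ _) fun x hx => ?_
  set p := layer σ δ k (x - x₀) with hp
  have hp0 : 0 ≤ p := layer_nonneg _
  have hp1 : p ≤ 1 := layer_le_one _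
  set G := meanSpeed a c (u x)
  have hG : |G| ≤ L := abs_meanSpeed_le hL hc (hu' x)
  have hσ1 : |σ| = 1 := by
    rw [← sq_eq_sq₀ (abs_nonneg _) zero_le_one, sq_abs, hσ, one_pow]
  have hη : (u x - c) ^ 2 ≤ (2 * m) ^ 2 := by
    have h1 := (hu' x).1
    have h2 := (hu' x).2
    exact sq_le_sq' (by linarith [hc.2]) (by linarith [hc.1])
  have hpp : 0 ≤ k * (p * (1 - p)) := mul_nonneg hk (mul_nonneg hp0 (by linarith))
  have hid : layer' σ δ k (x - x₀) * ((u x - c) ^ 2 * G - v * (u x - c) ^ 2) +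
      ε * (layer'' σ δ k (x - x₀) * (u x - c) ^ 2) =
      k * (p * (1 - p)) * (-(σ * (G - v)) + θ * (1 - 2 * p)) * (u x - c) ^ 2 := by
    rw [layer', layer'', ← hp, ← hεk]
    ring
  rw [hid]
  have hN0 : 0 ≤ N := by rw [hN]; positivity
  -- Where the margin is at least `θ`, the energy leaves the weighted side faster than viscosity can
  -- feed it, since `θ * (1 - 2 * p) ≤ θ`. Elsewhere the production is bounded by a constant times
  -- the slope of the layer, hence by `S`.
  by_cases hgood : θ ≤ σ * (G - v)
  · have h1 : -(σ * (G - v)) + θ * (1 - 2 * p) ≤ 0 := by nlinarith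
    have h2 : k * (p * (1 - p)) * (-(σ * (G - v)) + θ * (1 - 2 * p)) * (u x - c) ^ 2 ≤ 0 :=
      mul_nonpos_of_nonpos_of_nonneg (mul_nonpos_of_nonneg_of_nonpos hpp h1) (sq_nonneg _)
    exact (mul_nonpos_of_nonneg_of_nonpos (hW0 x) h2).trans (mul_nonneg hN0 (hS0 x))
  · have hbad := hS x (not_le.1 hgood)
    have h1 : -(σ * (G - v)) + θ * (1 - 2 * p) ≤ 2 * L + θ := by
      have : |σ * (G - v)| ≤ 2 * L := by
        rw [abs_mul, hσ1, one_mul]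
        exact (abs_sub _ _).trans (by linarith)
      nlinarith [(abs_le.1 this).1]
    have hη0 := sq_nonneg (u x - c)
    calc W x * (k * (p * (1 - p)) * (-(σ * (G - v)) + θ * (1 - 2 * p)) * (u x - c) ^ 2)
        ≤ W x * (k * (p * (1 - p)) * (2 * L + θ) * (u x - c) ^ 2) := by
          have := hW0 x
          gcongr
      _ ≤ 1 * (S x * (2 * L + θ) * (2 * m) ^ 2) := by
          have := hW0 x
          have := hS0 x
          have := hW1 x hx
          gcongr
      _ = N * S x := by rw [hN]; ring

namespace IsViscousSolution

variable {A : ℝ → ℝ} {ε : ℝ} {U₀ : ℝ → ℝ} {U : ℝ → ℝ → ℝ}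

set_option maxHeartbeats 1000000 in
/-- The energy on one side of the shock, weighted with a layer that moves with the shift. -/
theorem layer_energy_le (h : IsViscousSolution A ε U₀ U) (hA : ContDiff ℝ 2 A) (hε : 0 ≤ ε)
    (hU₀ : AEStronglyMeasurable U₀ volume) {σ δ k θ h₀ L m c T τ r N Γ : ℝ} {X v : ℝ → ℝ}
    (hσ : σ ^ 2 = 1) (hk : 0 < k) (hεk : ε * k = θ) (hθ : 0 ≤ θ) (hδ : 0 ≤ δ) (hδh : 2 * δ ≤ h₀)
    (hL : ∀ s ∈ Icc (-m) m, |deriv A s| ≤ L) (hc : c ∈ Icc (-m) m)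
    (hm : ∀ t > 0, ∀ x, |U t x| ≤ m) (hm₀ : ∀ᵐ x, |U₀ x| ≤ m)
    (cX : ContinuousOn X (Icc 0 T)) (hX0 : X 0 = 0) (hX : ∀ t ∈ Ioo 0 T, HasDerivAt X (v t) t)
    (hvL : ∀ t ∈ Ioo 0 T, |v t| ≤ L) (cv : ContinuousOn v (Ioo 0 T)) (hτ : 0 < τ)
    (hgood : ∀ t ∈ Ioo 0 T, τ ≤ t → ∀ x, 0 < -(σ * (x - X t)) → -(σ * (x - X t)) < h₀ →
      θ ≤ σ * (meanSpeed (deriv A) c (U t x) - v t))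
    (hr : 1 ≤ r) (hN : N = (2 * L + θ) * (2 * m) ^ 2) (hΓ : Γ = 32 * (L + ε + 2 * θ))
    {t : ℝ} (ht : t ∈ Ioo 0 T) :
    ∫ x in (-r ^ 2)..(r ^ 2), cutoff r x * (layer σ δ k (x - X t) * (U t x - c) ^ 2) ≤
      Real.exp (Γ / r * t) *
        ((∫ x in (-r ^ 2)..(r ^ 2), cutoff r x * (layer σ δ k x * (U₀ x - c) ^ 2)) +
          N * (τ + 8 * Real.exp (-(k * δ / 2)) * t) + 2 * Γ * (2 * m) ^ 2 / r * t) := by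
  have dA : Differentiable ℝ A := hA.differentiable (by norm_num)
  have ca : Continuous (deriv A) := hA.continuous_deriv (by norm_num)
  have hr0 : 0 < r := by linarith
  have hT : 0 < T := ht.1.trans ht.2
  have hL0 : 0 ≤ L := (abs_nonneg _).trans (hvL t ht)
  have hN0 : 0 ≤ N := by rw [hN]; positivity
  have hΓ0 : 0 ≤ Γ := by rw [hΓ]; positivity
  -- In `Γ` the term `L` comes from the flux, `ε` from the second derivative of the cutoff, and `2 *
  -- θ` from the mixed term, because `ε |layer'| ≤ θ * layer`. The rate keeps the factor `1 / r`, so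
  -- the exponential tends to `1` as the cutoff is removed and no growth in time remains.
  set Λ := Γ / r with hΛdef
  have hΛ : 0 ≤ Λ := by positivity
  have k0 := continuous_cutoff r
  have k1 := continuous_cutoff' r
  have k2 := continuous_cutoff'' r
  have l0 := continuous_layer (σ := σ) (δ := δ) (k := k)
  have l1 := continuous_layer' (σ := σ) (δ := δ) (k := k)
  have l2 := continuous_layer'' (σ := σ) (δ := δ) (k := k)
  have cq : Continuous fun u => (u - c) ^ 2 * meanSpeed (deriv A) c u :=
    continuous_iff_continuousAt.2 fun u => (hasDerivAt_sq_mul_meanSpeed ca c u).continuousAt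
  have cX2 : ContinuousOn (fun p : ℝ × ℝ => p.2 - X p.1) (Ioo 0 T ×ˢ univ) :=
    continuousOn_snd.sub ((cX.mono Ioo_subset_Icc_self).comp continuousOn_fst fun p hp => hp.1)
  have cv2 : ContinuousOn (fun p : ℝ × ℝ => v p.1) (Ioo 0 T ×ˢ univ) :=
    cv.comp continuousOn_fst fun p hp => hp.1
  have cl0 : ContinuousOn (fun p : ℝ × ℝ => layer σ δ k (p.2 - X p.1)) (Ioo 0 T ×ˢ univ) :=
    l0.comp_continuousOn cX2
  have cl1 : ContinuousOn (fun p : ℝ × ℝ => layer' σ δ k (p.2 - X p.1)) (Ioo 0 T ×ˢ univ) :=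
    l1.comp_continuousOn cX2
  have ck0 : ContinuousOn (fun p : ℝ × ℝ => cutoff r p.2) (Ioo 0 T ×ˢ univ) :=
    (k0.comp continuous_snd).continuousOn
  set ψ : ℝ → ℝ → ℝ := fun s x =>
    Real.exp (-(Λ * s)) * (cutoff r x * layer σ δ k (x - X s)) with hψ
  set ψt : ℝ → ℝ → ℝ := fun s x =>
    -Λ * Real.exp (-(Λ * s)) * (cutoff r x * layer σ δ k (x - X s)) +
      Real.exp (-(Λ * s)) * (cutoff r x * (layer' σ δ k (x - X s) * -v s)) with hψt
  set ψx : ℝ → ℝ → ℝ := fun s x => Real.exp (-(Λ * s)) *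
    (cutoff' r x * layer σ δ k (x - X s) + cutoff r x * layer' σ δ k (x - X s)) with hψx
  set ψxx : ℝ → ℝ → ℝ := fun s x => Real.exp (-(Λ * s)) *
    ((cutoff'' r x * layer σ δ k (x - X s) + cutoff' r x * layer' σ δ k (x - X s)) +
    (cutoff' r x * layer' σ δ k (x - X s) + cutoff r x * layer'' σ δ k (x - X s))) with hψxx
  have cψt : ContinuousOn (fun p : ℝ × ℝ => ψt p.1 p.2) (Ioo 0 T ×ˢ univ) := by
    have ce : ContinuousOn (fun p : ℝ × ℝ => Real.exp (-(Λ * p.1))) (Ioo 0 T ×ˢ univ) := by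
      fun_prop
    exact ((ce.const_smul (-Λ)).mul (ck0.mul cl0)).add (ce.mul (ck0.mul (cl1.mul cv2.neg)))
  have dl : ∀ s x, HasDerivAt (fun x => layer σ δ k (x - X s)) (layer' σ δ k (x - X s)) x :=
    fun s x => (hasDerivAt_layer _).comp_sub_const x (X s)
  have dl' : ∀ s x, HasDerivAt (fun x => layer' σ δ k (x - X s)) (layer'' σ δ k (x - X s)) x :=
    fun s x => (hasDerivAt_layer' hσ _).comp_sub_const x (X s)
  set f : ℝ → ℝ := fun s => ∫ x in (-r ^ 2)..(r ^ 2), ψ s x * (U s x - c) ^ 2 with hf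
  have hder := fun s (hs : s ∈ Ioo 0 T) => h.hasDerivAt_integral_entropy dA
    (η := fun u => (u - c) ^ 2) (η' := fun u => 2 * (u - c)) (η'' := fun _ => 2)
    (hasDerivAt_sub_sq c)
    (hasDerivAt_two_mul_sub c) continuous_const
    (fun u => hasDerivAt_sq_mul_meanSpeed ca c u)
    (T := T) (R := r ^ 2) (by positivity) (ψ := ψ) (ψt := ψt) (ψx := ψx) (ψxx := ψxx)
    (fun s hs x => by
      have e1 : HasDerivAt (fun s => layer σ δ k (x - X s)) (layer' σ δ k (x - X s) * -v s) s :=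
        (hasDerivAt_layer _).comp s ((hX s hs).const_sub x)
      exact (hasDerivAt_exp_neg_mul Λ s).mul (e1.const_mul _))
    (fun s _ x => ((hasDerivAt_cutoff r x).mul (dl s x)).const_mul _)
    (fun s _ x => (((hasDerivAt_cutoff' r x).mul (dl s x)).add
      ((hasDerivAt_cutoff r x).mul (dl' s x))).const_mul _)
    (by simp only [hψ]; fun_prop) cψt
    (fun s _ => by simp only [hψxx]; fun_prop)
    (fun s _ => by simp [hψ, cutoff_endpoints hr0])
    (fun s _ => by simp [hψx, cutoff_endpoints hr0, cutoff'_endpoints hr0]) hs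
  -- the production splits into the layer part and the cutoff part
  have hrate : ∀ s ∈ Ioo 0 T, ∀ b, 0 ≤ b →
      ∫ x in (-r ^ 2)..(r ^ 2), cutoff r x * (layer' σ δ k (x - X s) *
        ((U s x - c) ^ 2 * meanSpeed (deriv A) c (U s x) - v s * (U s x - c) ^ 2) +
        ε * (layer'' σ δ k (x - X s) * (U s x - c) ^ 2)) ≤ b →
      ∫ x in (-r ^ 2)..(r ^ 2), (ψt s x * (U s x - c) ^ 2 +
        ψx s x * ((U s x - c) ^ 2 * meanSpeed (deriv A) c (U s x)) +
        ε * (ψxx s x * (U s x - c) ^ 2) - ε * (ψ s x * (2 * deriv (U s) x ^ 2))) ≤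
        b + 2 * Γ * (2 * m) ^ 2 / r := by
    intro s hs b hb0 hb
    have hs0 : 0 < s := hs.1
    have cs := h.continuous_slice hs0
    have cs' := h.continuous_deriv_slice hs0
    have hE0 := Real.exp_pos (-(Λ * s))
    have hE1 : Real.exp (-(Λ * s)) ≤ 1 := Real.exp_le_one_iff.2 (by nlinarith)
    have cx0 : Continuous fun x => layer σ δ k (x - X s) :=
      l0.comp (continuous_id.sub continuous_const)
    have cx1 : Continuous fun x => layer' σ δ k (x - X s) :=
      l1.comp (continuous_id.sub continuous_const)
    have cx2 : Continuous fun x => layer'' σ δ k (x - X s) :=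
      l2.comp (continuous_id.sub continuous_const)
    have ct : Continuous (ψt s) :=
      (continuous_const.mul (k0.mul cx0)).add
        (continuous_const.mul (k0.mul (cx1.mul continuous_const)))
    have cx : Continuous (ψx s) := continuous_const.mul ((k1.mul cx0).add (k0.mul cx1))
    have cxx : Continuous (ψxx s) := continuous_const.mul
      (((k2.mul cx0).add (k1.mul cx1)).add ((k1.mul cx1).add (k0.mul cx2)))
    have cψs : Continuous (ψ s) := continuous_const.mul (k0.mul cx0)
    have cη : Continuous fun x => (U s x - c) ^ 2 := (cs.sub continuous_const).pow 2
    have cql : Continuous fun x => (U s x - c) ^ 2 * meanSpeed (deriv A) c (U s x) := cq.comp cs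
    have hpoint : ∀ x ∈ Icc (-r ^ 2) (r ^ 2), ψt s x * (U s x - c) ^ 2 +
        ψx s x * ((U s x - c) ^ 2 * meanSpeed (deriv A) c (U s x)) +
        ε * (ψxx s x * (U s x - c) ^ 2) - ε * (ψ s x * (2 * deriv (U s) x ^ 2)) ≤
        Real.exp (-(Λ * s)) * (cutoff r x * (layer' σ δ k (x - X s) *
        ((U s x - c) ^ 2 * meanSpeed (deriv A) c (U s x) - v s * (U s x - c) ^ 2) +
        ε * (layer'' σ δ k (x - X s) * (U s x - c) ^ 2))) + Γ / r ^ 3 * (2 * m) ^ 2 := by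
      intro x hx
      have hU := abs_le.1 (hm s hs0 x)
      have hW0 := cutoff_nonneg r x
      have hp0 : 0 ≤ layer σ δ k (x - X s) := layer_nonneg _
      have hp1 : layer σ δ k (x - X s) ≤ 1 := layer_le_one _
      have e0 : 0 ≤ ε * (ψ s x * (2 * deriv (U s) x ^ 2)) := by
        simp only [hψ]
        positivity
      have hG : |meanSpeed (deriv A) c (U s x)| ≤ L := abs_meanSpeed_le hL hc hU
      have hη : (U s x - c) ^ 2 ≤ (2 * m) ^ 2 :=
        sq_le_sq' (by linarith [hc.2]) (by linarith [hc.1])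
      have hlayer' : ε * |layer' σ δ k (x - X s)| ≤ θ * layer σ δ k (x - X s) := by
        have hσ1 : |σ| = 1 := by
          rw [← sq_eq_sq₀ (abs_nonneg _) zero_le_one, sq_abs, hσ, one_pow]
        rw [layer', abs_neg, abs_mul, abs_mul, hσ1, one_mul, abs_of_pos hk,
          abs_of_nonneg (mul_nonneg hp0 (by linarith)), ← hεk]
        nlinarith [mul_nonneg (mul_nonneg hε hk.le) (mul_nonneg hp0 hp0)]
      have hder1 := cutoff_derivs_le hr hx
      simp only [hψt, hψx, hψxx]
      set p := layer σ δ k (x - X s)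
      set p' := layer' σ δ k (x - X s)
      set p'' := layer'' σ δ k (x - X s)
      set G := meanSpeed (deriv A) c (U s x)
      set w := cutoff r x
      set w' := cutoff' r x
      set w'' := cutoff'' r x
      set y := (U s x - c) ^ 2
      have hy0 : 0 ≤ y := sq_nonneg _
      have e1 : w' * p * (y * G) ≤ L * (|w'| * (p * y)) := by
        calc w' * p * (y * G) ≤ |w' * p * (y * G)| := le_abs_self _
          _ = |w'| * (p * y) * |G| := by
            rw [abs_mul, abs_mul, abs_mul, abs_of_nonneg hp0, abs_of_nonneg hy0]; ring
          _ ≤ |w'| * (p * y) * L := by gcongr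
          _ = _ := by ring
      have e2 : ε * (w'' * p * y) ≤ ε * (|w''| * (p * y)) := by
        have : w'' * p * y ≤ |w''| * (p * y) := by
          rw [mul_assoc]
          gcongr
          exact le_abs_self _
        gcongr
      have e3 : 2 * (ε * (w' * p' * y)) ≤ 2 * θ * (|w'| * (p * y)) := by
        have : ε * (w' * p' * y) ≤ θ * (|w'| * (p * y)) := by
          calc ε * (w' * p' * y) ≤ ε * |w' * p' * y| := by gcongr; exact le_abs_self _
            _ = (ε * |p'|) * (|w'| * y) := by rw [abs_mul, abs_mul, abs_of_nonneg hy0]; ring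
            _ ≤ (θ * p) * (|w'| * y) := by gcongr
            _ = _ := by ring
        linarith
      have e4 : (L + ε + 2 * θ) * (|w'| + |w''|) * (p * y) ≤
          (L + ε + 2 * θ) * (32 * (w / r + 1 / r ^ 3)) * (p * y) := by gcongr
      have e5 : (L + ε + 2 * θ) * (32 * (w / r + 1 / r ^ 3)) * (p * y) =
          Λ * (w * p * y) + Γ / r ^ 3 * (p * y) := by
        rw [hΛdef, hΓ]
        field_simp
      have e6 : p * y ≤ (2 * m) ^ 2 :=
        (mul_le_of_le_one_left hy0 hp1).trans hη
      have e7 : Γ / r ^ 3 * (p * y) ≤ Γ / r ^ 3 * (2 * m) ^ 2 := by gcongr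
      have i1 : 0 ≤ (ε + 0) * (|w'| * (p * y)) := by positivity
      have i2 : 0 ≤ (L + 2 * θ) * (|w''| * (p * y)) := by positivity
      have e8 : w' * p * (y * G) + ε * (w'' * p * y) + 2 * (ε * (w' * p' * y)) - Λ * (w * p * y) ≤
          Γ / r ^ 3 * (p * y) := by
        linarith
      have e9 := mul_le_mul_of_nonneg_left e8 hE0.le
      have e10 : Real.exp (-(Λ * s)) * (Γ / r ^ 3 * (p * y)) ≤ Γ / r ^ 3 * (p * y) :=
        mul_le_of_le_one_left (by positivity) hE1
      linarith
    have cl : Continuous fun x => ψt s x * (U s x - c) ^ 2 +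
        ψx s x * ((U s x - c) ^ 2 * meanSpeed (deriv A) c (U s x)) +
        ε * (ψxx s x * (U s x - c) ^ 2) - ε * (ψ s x * (2 * deriv (U s) x ^ 2)) :=
      (((ct.mul cη).add (cx.mul cql)).add (continuous_const.mul (cxx.mul cη))).sub
        (continuous_const.mul (cψs.mul (continuous_const.mul (cs'.pow 2))))
    have cr : Continuous fun x => Real.exp (-(Λ * s)) * (cutoff r x * (layer' σ δ k (x - X s) *
        ((U s x - c) ^ 2 * meanSpeed (deriv A) c (U s x) - v s * (U s x - c) ^ 2) +
        ε * (layer'' σ δ k (x - X s) * (U s x - c) ^ 2))) :=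
      continuous_const.mul (k0.mul ((cx1.mul (cql.sub (continuous_const.mul cη))).add
        (continuous_const.mul (cx2.mul cη))))
    refine (intervalIntegral.integral_mono_on (by nlinarith) (cl.intervalIntegrable _ _)
      ((cr.intervalIntegrable _ _).add intervalIntegrable_const) hpoint).trans ?_
    rw [intervalIntegral.integral_add (cr.intervalIntegrable _ _)
      intervalIntegrable_const, intervalIntegral.integral_const_mul,
      intervalIntegral.integral_const, smul_eq_mul]
    have e1 := mul_le_mul_of_nonneg_left hb hE0.le
    have e2 : Real.exp (-(Λ * s)) * b ≤ b := mul_le_of_le_one_left hb0 hE1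
    have e3 : (r ^ 2 - -r ^ 2) * (Γ / r ^ 3 * (2 * m) ^ 2) = 2 * Γ * (2 * m) ^ 2 / r := by
      field_simp
      ring
    linarith
  -- Before `τ` nothing is known about the velocity beyond its bound, so every point counts as bad.
  -- The slope of the layer has total mass at most `1`, so the loss up to `τ` is at most `N * τ`
  -- apart from the cutoff error.
  have hcrude : ∀ s ∈ Ioo 0 T, ∫ x in (-r ^ 2)..(r ^ 2), (ψt s x * (U s x - c) ^ 2 +
        ψx s x * ((U s x - c) ^ 2 * meanSpeed (deriv A) c (U s x)) +
        ε * (ψxx s x * (U s x - c) ^ 2) - ε * (ψ s x * (2 * deriv (U s) x ^ 2))) ≤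
        N + 2 * Γ * (2 * m) ^ 2 / r := by
    intro s hs
    refine hrate s hs N hN0 ?_
    have cl : Continuous fun x => layer σ δ k (x - X s) :=
      l0.comp (continuous_id.sub continuous_const)
    refine (integral_layer_production_le ca (h.continuous_slice hs.1) hσ hk.le hεk hθ
      (by positivity) k0 (cutoff_nonneg r) (fun x hx => cutoff_le_one hr0 hx) hL hc
      (fun x => abs_le.1 (hm s hs.1 x)) (hvL s hs) hN
      (S := fun x => k * (layer σ δ k (x - X s) * (1 - layer σ δ k (x - X s)))) (by fun_prop)
      (fun x => mul_nonneg hk.le (mul_nonneg (layer_nonneg _) (sub_nonneg.2 (layer_le_one _)))) (fun x _ => le_rfl)).trans ?_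
    exact mul_le_of_le_one_right hN0 (integral_layer_slope_le hσ _ _ _)
  -- From `τ` on, bad points lie beyond the shift or at least `h₀ ≥ 2 * δ` inside, where `1 - layer`
  -- is small. In both tails the slope is dominated by `k` times a small multiple of the bump, whose
  -- integral is at most `2 / k`; the factor `k` cancels.
  have hfine : ∀ s ∈ Ioo 0 T, τ ≤ s → ∫ x in (-r ^ 2)..(r ^ 2), (ψt s x * (U s x - c) ^ 2 +
        ψx s x * ((U s x - c) ^ 2 * meanSpeed (deriv A) c (U s x)) +
        ε * (ψxx s x * (U s x - c) ^ 2) - ε * (ψ s x * (2 * deriv (U s) x ^ 2))) ≤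
        N * (8 * Real.exp (-(k * δ / 2))) + 2 * Γ * (2 * m) ^ 2 / r := by
    intro s hs hτs
    refine hrate s hs _ (by positivity) ?_
    have cb : Continuous fun x => layerBump σ δ k (x - X s) :=
      continuous_layerBump.comp (continuous_id.sub continuous_const)
    refine (integral_layer_production_le ca (h.continuous_slice hs.1) hσ hk.le hεk hθ
      (by positivity) k0 (cutoff_nonneg r) (fun x hx => cutoff_le_one hr0 hx) hL hc
      (fun x => abs_le.1 (hm s hs.1 x)) (hvL s hs) hN
      (S := fun x => k * (4 * Real.exp (-(k * δ / 2)) * layerBump σ δ k (x - X s))) (by fun_prop)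
      (fun x => by have := layerBump_nonneg (σ := σ) (δ := δ) (k := k) (x - X s); positivity)
      (fun x hx => ?_)).trans ?_
    · have hp0 := layer_nonneg (σ := σ) (δ := δ) (k := k) (x - X s)
      have hp1 := layer_le_one (σ := σ) (δ := δ) (k := k) (x - X s)
      refine mul_le_mul_of_nonneg_left ?_ hk.le
      rcases le_or_gt 0 (σ * (x - X s)) with hy | hy
      · exact (mul_le_of_le_one_right hp0 (by linarith)).trans (layer_le_bump hk.le hδ hy)
      · rcases lt_or_ge (-(σ * (x - X s))) h₀ with hy2 | hy2
        · exact absurd hx (not_lt.2 (hgood s hs hτs x (by linarith) hy2))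
        · exact (mul_le_of_le_one_left (by linarith) hp1).trans
            (one_sub_layer_le_bump hk.le hδ (by linarith))
    · refine mul_le_mul_of_nonneg_left ?_ hN0
      rw [intervalIntegral.integral_const_mul, intervalIntegral.integral_const_mul]
      have h1 := integral_layerBump_le (δ := δ) hσ hk (X s) (-r ^ 2) (r ^ 2)
      have hE := Real.exp_pos (-(k * δ / 2))
      calc _ ≤ k * (4 * Real.exp (-(k * δ / 2)) * (2 / k)) := by gcongr
        _ = _ := by field_simp; ring
  have hlim : Tendsto f (𝓝[>] 0)
      (𝓝 (∫ x in (-r ^ 2)..(r ^ 2), cutoff r x * layer σ δ k x * (U₀ x - c) ^ 2)) := by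
    refine h.tendsto_integral_initial hU₀ hT (fun s hs => hm s hs.1) hm₀
      (η := fun u => (u - c) ^ 2) (η' := fun u => 2 * (u - c))
      (hasDerivAt_sub_sq c) (by fun_prop)
      (R := r ^ 2) (by positivity) (ψ := ψ) (B := 1)
      (fun s _ => by simp only [hψ]; fun_prop) ?_ ?_
    · intro s hs x hx
      have hE1 : Real.exp (-(Λ * s)) ≤ 1 :=
        Real.exp_le_one_iff.2 (by have := hs.1; nlinarith)
      have hw := mul_nonneg (cutoff_nonneg r x) (layer_nonneg (σ := σ) (δ := δ) (k := k) (x - X s))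
      rw [abs_of_nonneg (mul_nonneg (Real.exp_pos _).le hw)]
      exact mul_le_one₀ hE1 hw (mul_le_one₀ (cutoff_le_one hr0 hx) (layer_nonneg _)
        (layer_le_one _))
    · intro x
      have hXlim : Tendsto X (𝓝[>] 0) (𝓝 0) := by
        have h1 := (cX 0 ⟨le_rfl, hT.le⟩).tendsto
        rw [hX0] at h1
        exact h1.mono_left (nhdsWithin_le_of_mem (Icc_mem_nhdsGT hT))
      have e1 : Tendsto (fun s : ℝ => Real.exp (-(Λ * s))) (𝓝[>] 0) (𝓝 1) := by
        have : Tendsto (fun s : ℝ => Real.exp (-(Λ * s))) (𝓝 0) (𝓝 (Real.exp (-(Λ * 0)))) := by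
          apply Continuous.tendsto
          fun_prop
        simpa using this.mono_left nhdsWithin_le_nhds
      have e2 : Tendsto (fun s => layer σ δ k (x - X s)) (𝓝[>] 0) (𝓝 (layer σ δ k (x - 0))) :=
        (l0.tendsto _).comp (hXlim.const_sub x)
      simpa using e1.mul (e2.const_mul (cutoff r x))
  have hD0 : 0 ≤ 2 * Γ * (2 * m) ^ 2 / r := by positivity
  have hE8 : 0 ≤ N * (8 * Real.exp (-(k * δ / 2))) := by positivity
  have hft : f t ≤ (∫ x in (-r ^ 2)..(r ^ 2), cutoff r x * layer σ δ k x * (U₀ x - c) ^ 2) +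
      N * (τ + 8 * Real.exp (-(k * δ / 2)) * t) + 2 * Γ * (2 * m) ^ 2 / r * t := by
    have hbound : ∀ s ∈ Ioo 0 T, f s ≤
        (∫ x in (-r ^ 2)..(r ^ 2), cutoff r x * layer σ δ k x * (U₀ x - c) ^ 2) +
        (N + 2 * Γ * (2 * m) ^ 2 / r) * s := fun s hs =>
      le_add_mul_of_tendsto_of_deriv_le hs hder
        (fun y hy => hcrude y ⟨hy.1, hy.2.trans hs.2⟩) hlim
    rcases le_total t τ with htτ | htτ
    · have := hbound t ht
      have h1 : N * t ≤ N * τ := by gcongr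
      have h2 : 0 ≤ N * (8 * Real.exp (-(k * δ / 2))) * t := mul_nonneg hE8 ht.1.le
      linarith
    · have h1 := hbound τ ⟨hτ, htτ.trans_lt ht.2⟩
      have h2 := le_add_mul_of_deriv_le htτ
        (fun y hy => hder y ⟨hτ.trans_le hy.1, hy.2.trans_lt ht.2⟩)
        (fun y hy => hfine y ⟨hτ.trans hy.1, hy.2.trans ht.2⟩ hy.1.le)
      have h3 : 0 ≤ N * (8 * Real.exp (-(k * δ / 2))) * τ := mul_nonneg hE8 hτ.le
      simp only [hf] at h1 h2 ⊢
      linarith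
  have hfe : ∫ x in (-r ^ 2)..(r ^ 2), cutoff r x * (layer σ δ k (x - X t) * (U t x - c) ^ 2) =
      Real.exp (Λ * t) * f t := by
    simp only [hf, hψ]
    rw [← intervalIntegral.integral_const_mul]
    refine intervalIntegral.integral_congr fun x _ => ?_
    have hexp : Real.exp (Λ * t) * Real.exp (-(Λ * t)) = 1 := by
      rw [← Real.exp_add, add_neg_cancel, Real.exp_zero]
    linear_combination -(cutoff r x * layer σ δ k (x - X t) * (U t x - c) ^ 2) * hexp
  rw [hfe]
  refine mul_le_mul_of_nonneg_left (hft.trans (le_of_eq ?_)) (Real.exp_pos _).le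
  simp only [mul_assoc]

end IsViscousSolution

/-! ### The energy relative to the shifted shock -/

/-- A bound for the distance between the layers on both sides and the indicators of the two
half lines. -/
noncomputable def layerError (δ k y : ℝ) : ℝ :=
  (Icc (-(2 * δ)) (2 * δ)).indicator 1 y +
    4 * Real.exp (-(k * δ / 2)) * (layerBump 1 δ k y + layerBump (-1) δ k y)

theorem layerError_nonneg (δ k y : ℝ) : 0 ≤ layerError δ k y := by
  have h1 := layerBump_nonneg (σ := 1) (δ := δ) (k := k) y
  have h2 := layerBump_nonneg (σ := -1) (δ := δ) (k := k) y
  have h3 : 0 ≤ (Icc (-(2 * δ)) (2 * δ)).indicator (1 : ℝ → ℝ) y :=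
    indicator_nonneg (fun _ _ => zero_le_one) y
  have h4 := Real.exp_pos (-(k * δ / 2))
  unfold layerError
  positivity

theorem layer_le_error {σ δ k y : ℝ} (hσ : σ = 1 ∨ σ = -1) (hk : 0 ≤ k) (hδ : 0 ≤ δ)
    (hy : 0 ≤ σ * y) : layer σ δ k y ≤ layerError δ k y := by
  have h1 := layerBump_nonneg (σ := 1) (δ := δ) (k := k) y
  have h2 := layerBump_nonneg (σ := -1) (δ := δ) (k := k) y
  have h3 : 0 ≤ (Icc (-(2 * δ)) (2 * δ)).indicator (1 : ℝ → ℝ) y :=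
    indicator_nonneg (fun _ _ => zero_le_one) y
  have h4 := Real.exp_pos (-(k * δ / 2))
  have h5 := layer_le_bump hk hδ hy
  unfold layerError
  rcases hσ with rfl | rfl
  · nlinarith [mul_nonneg h4.le h2]
  · nlinarith [mul_nonneg h4.le h1]

theorem one_sub_layer_le_error {σ δ k y : ℝ} (hσ : σ = 1 ∨ σ = -1) (hk : 0 ≤ k) (hδ : 0 ≤ δ)
    (hy : σ * y ≤ 0) : 1 - layer σ δ k y ≤ layerError δ k y := by
  have h1 := layerBump_nonneg (σ := 1) (δ := δ) (k := k) y
  have h2 := layerBump_nonneg (σ := -1) (δ := δ) (k := k) y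
  have h4 := Real.exp_pos (-(k * δ / 2))
  have hp := layer_nonneg (σ := σ) (δ := δ) (k := k) y
  by_cases hy2 : σ * y ≤ -(2 * δ)
  · have h3 : 0 ≤ (Icc (-(2 * δ)) (2 * δ)).indicator (1 : ℝ → ℝ) y :=
      indicator_nonneg (fun _ _ => zero_le_one) y
    have h5 := one_sub_layer_le_bump hk hδ hy2
    unfold layerError
    rcases hσ with rfl | rfl
    · nlinarith [mul_nonneg h4.le h2]
    · nlinarith [mul_nonneg h4.le h1]
  · have hmem : y ∈ Icc (-(2 * δ)) (2 * δ) := by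
      rcases hσ with rfl | rfl
      · exact ⟨by linarith, by linarith⟩
      · exact ⟨by linarith, by linarith⟩
    unfold layerError
    rw [indicator_of_mem hmem, Pi.one_apply]
    nlinarith [mul_nonneg h4.le h1, mul_nonneg h4.le h2]

theorem intervalIntegrable_layerError (δ k x₀ a b : ℝ) :
    IntervalIntegrable (fun x => layerError δ k (x - x₀)) volume a b := by
  have h1 : Continuous fun x => layerBump 1 δ k (x - x₀) :=
    continuous_layerBump.comp (continuous_id.sub continuous_const)
  have h2 : Continuous fun x => layerBump (-1) δ k (x - x₀) :=
    continuous_layerBump.comp (continuous_id.sub continuous_const)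
  have h3 : IntervalIntegrable
      (fun x => (Icc (-(2 * δ)) (2 * δ)).indicator (1 : ℝ → ℝ) (x - x₀)) volume a b := by
    refine (intervalIntegrable_const (c := (1 : ℝ))).mono_fun ?_ ?_
    · exact ((measurable_one.indicator measurableSet_Icc).comp
        (measurable_id.sub_const x₀)).aestronglyMeasurable
    · refine Eventually.of_forall fun x => ?_
      exact (norm_indicator_le_norm_self (1 : ℝ → ℝ) _).trans (by simp)
  exact h3.add (((h1.add h2).const_mul _).intervalIntegrable _ _)

theorem integral_layerError_le {δ k : ℝ} (hk : 0 < k) (hδ : 0 ≤ δ) (x₀ : ℝ) {a b : ℝ}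
    (hab : a ≤ b) :
    ∫ x in a..b, layerError δ k (x - x₀) ≤ 4 * δ + 16 * Real.exp (-(k * δ / 2)) / k := by
  have h1 : Continuous fun x => layerBump 1 δ k (x - x₀) :=
    continuous_layerBump.comp (continuous_id.sub continuous_const)
  have h2 : Continuous fun x => layerBump (-1) δ k (x - x₀) :=
    continuous_layerBump.comp (continuous_id.sub continuous_const)
  have hind : ∀ x, (Icc (-(2 * δ)) (2 * δ)).indicator (1 : ℝ → ℝ) (x - x₀) =
      (Icc (x₀ - 2 * δ) (x₀ + 2 * δ)).indicator 1 x := by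
    intro x
    simp only [indicator, mem_Icc, Pi.one_apply]
    congr 1
    rw [eq_iff_iff]
    constructor <;> rintro ⟨h, h'⟩ <;> constructor <;> linarith
  have hint : Integrable ((Icc (x₀ - 2 * δ) (x₀ + 2 * δ)).indicator (1 : ℝ → ℝ)) :=
    (integrable_indicator_iff measurableSet_Icc).2
      (integrableOn_const (by simp) (by simp))
  have h3 : ∫ x in a..b, (Icc (x₀ - 2 * δ) (x₀ + 2 * δ)).indicator (1 : ℝ → ℝ) x ≤ 4 * δ := by
    rw [intervalIntegral.integral_of_le hab]
    refine (setIntegral_le_integral hint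
      (Eventually.of_forall fun x => indicator_nonneg (fun _ _ => zero_le_one) x)).trans ?_
    rw [integral_indicator_one measurableSet_Icc, Real.volume_real_Icc_of_le (by linarith)]
    linarith
  simp only [layerError, hind]
  rw [intervalIntegral.integral_add hint.intervalIntegrable
    (((h1.intervalIntegrable _ _).add (h2.intervalIntegrable _ _)).const_mul _),
    intervalIntegral.integral_const_mul,
    intervalIntegral.integral_add (h1.intervalIntegrable _ _) (h2.intervalIntegrable _ _)]
  have h4 := integral_layerBump_le (σ := 1) (δ := δ) (by norm_num) hk x₀ a b
  have h5 := integral_layerBump_le (σ := -1) (δ := δ) (by norm_num) hk x₀ a b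
  have h6 := Real.exp_pos (-(k * δ / 2))
  have h7 : 4 * Real.exp (-(k * δ / 2)) * ((∫ x in a..b, layerBump 1 δ k (x - x₀)) +
      ∫ x in a..b, layerBump (-1) δ k (x - x₀)) ≤
      4 * Real.exp (-(k * δ / 2)) * (2 / k + 2 / k) := by gcongr
  have h8 : 4 * Real.exp (-(k * δ / 2)) * (2 / k + 2 / k) = 16 * Real.exp (-(k * δ / 2)) / k := by
    ring
  linarith

section Compare

variable {C_L C_R δ k u y D : ℝ}

/-- On each half line the square to be estimated is the energy relative to one end state. Its layer
is close to `1` except in a strip of width `2 * δ` and in exponentially small tails, which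
`layerError` records. The comparison is used at time `t`, its converse at the initial time. -/
theorem sq_sub_shockProfile_le_layers (hk : 0 ≤ k) (hδ : 0 ≤ δ) (hL : (u - C_L) ^ 2 ≤ D)
    (hR : (u - C_R) ^ 2 ≤ D) :
    (u - shockProfile C_L C_R y) ^ 2 ≤ layer 1 δ k y * (u - C_L) ^ 2 +
      layer (-1) δ k y * (u - C_R) ^ 2 + D * layerError δ k y := by
  have hpL := layer_nonneg (σ := 1) (δ := δ) (k := k) y
  have hpR := layer_nonneg (σ := -1) (δ := δ) (k := k) y
  have he := layerError_nonneg δ k y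
  rcases lt_or_ge y 0 with hy | hy
  · rw [shockProfile, if_pos hy]
    have h1 := one_sub_layer_le_error (σ := 1) (Or.inl rfl) hk hδ (by linarith : 1 * y ≤ 0)
    have h2 := mul_le_mul h1 hL (sq_nonneg _) he
    nlinarith [mul_nonneg hpR (sq_nonneg (u - C_R))]
  · rw [shockProfile, if_neg (not_lt.2 hy)]
    have h1 := one_sub_layer_le_error (σ := -1) (Or.inr rfl) hk hδ (by linarith : -1 * y ≤ 0)
    have h2 := mul_le_mul h1 hR (sq_nonneg _) he
    nlinarith [mul_nonneg hpL (sq_nonneg (u - C_L))]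

theorem layers_le_sq_sub_shockProfile (hk : 0 ≤ k) (hδ : 0 ≤ δ) (hL : (u - C_L) ^ 2 ≤ D)
    (hR : (u - C_R) ^ 2 ≤ D) :
    layer 1 δ k y * (u - C_L) ^ 2 + layer (-1) δ k y * (u - C_R) ^ 2 ≤
      (u - shockProfile C_L C_R y) ^ 2 + D * layerError δ k y := by
  have hpL := layer_le_one (σ := 1) (δ := δ) (k := k) y
  have hpR := layer_le_one (σ := -1) (δ := δ) (k := k) y
  have he := layerError_nonneg δ k y
  rcases lt_or_ge y 0 with hy | hy
  · rw [shockProfile, if_pos hy]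
    have h1 := layer_le_error (σ := -1) (Or.inr rfl) hk hδ (by linarith : 0 ≤ -1 * y)
    have h2 := mul_le_mul h1 hR (sq_nonneg _) he
    nlinarith [mul_nonneg (sub_nonneg.2 hpL) (sq_nonneg (u - C_L))]
  · rw [shockProfile, if_neg (not_lt.2 hy)]
    have h1 := layer_le_error (σ := 1) (Or.inl rfl) hk hδ (by linarith : 0 ≤ 1 * y)
    have h2 := mul_le_mul h1 hL (sq_nonneg _) he
    nlinarith [mul_nonneg (sub_nonneg.2 hpR) (sq_nonneg (u - C_R))]

end Compare

theorem measurable_shockProfile (C_L C_R : ℝ) : Measurable (shockProfile C_L C_R) :=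
  Measurable.ite measurableSet_Iio measurable_const measurable_const

theorem shockProfile_mem_Icc {C_L C_R m : ℝ} (hL : C_L ∈ Icc (-m) m) (hR : C_R ∈ Icc (-m) m)
    (x : ℝ) : shockProfile C_L C_R x ∈ Icc (-m) m := by
  unfold shockProfile
  split_ifs <;> assumption

theorem intervalIntegrable_of_ae_bounded {f : ℝ → ℝ} (hf : AEStronglyMeasurable f volume) {B : ℝ}
    (hB : ∀ᵐ x, |f x| ≤ B) (a b : ℝ) : IntervalIntegrable f volume a b :=
  (intervalIntegrable_const (c := B)).mono_fun hf.restrict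
    (by
      filter_upwards [ae_restrict_of_ae hB] with x hx
      exact hx.trans (le_abs_self B))

section Cutoff

variable {C_L C_R δ k m r x₀ : ℝ} {u : ℝ → ℝ}

theorem sq_sub_le_of_mem_Icc {m a b : ℝ} (ha : a ∈ Icc (-m) m) (hb : b ∈ Icc (-m) m) :
    (a - b) ^ 2 ≤ (2 * m) ^ 2 :=
  sq_le_sq' (by linarith [ha.1, hb.2]) (by linarith [ha.2, hb.1])

theorem intervalIntegrable_cutoff_mul {f : ℝ → ℝ} {a b : ℝ}
    (hf : IntervalIntegrable f volume a b) :
    IntervalIntegrable (fun x => cutoff r x * f x) volume a b :=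
  hf.continuousOn_mul (continuous_cutoff r).continuousOn

theorem intervalIntegrable_layer_mul_sq (hu : AEStronglyMeasurable u volume)
    (hm : ∀ᵐ x, |u x| ≤ m) {σ c : ℝ} (hc : c ∈ Icc (-m) m) (a b : ℝ) :
    IntervalIntegrable (fun x => layer σ δ k (x - x₀) * (u x - c) ^ 2) volume a b := by
  have h1 : Continuous fun x => layer σ δ k (x - x₀) :=
    continuous_layer.comp (continuous_id.sub continuous_const)
  refine (intervalIntegrable_of_ae_bounded (B := (2 * m) ^ 2)
    ((hu.sub aestronglyMeasurable_const).pow 2) ?_ a b).continuousOn_mul h1.continuousOn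
  filter_upwards [hm] with x hx
  exact (abs_of_nonneg (sq_nonneg _)).trans_le (sq_sub_le_of_mem_Icc (abs_le.1 hx) hc)

theorem aestronglyMeasurable_sub_shockProfile (hu : AEStronglyMeasurable u volume) :
    AEStronglyMeasurable (fun x => u x - shockProfile C_L C_R (x - x₀)) volume :=
  hu.sub ((measurable_shockProfile C_L C_R).comp
    (measurable_id.sub_const x₀)).aestronglyMeasurable

theorem intervalIntegrable_sq_sub_shockProfile (hu : AEStronglyMeasurable u volume)
    (hm : ∀ᵐ x, |u x| ≤ m) (hL : C_L ∈ Icc (-m) m) (hR : C_R ∈ Icc (-m) m) (a b : ℝ) :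
    IntervalIntegrable (fun x => (u x - shockProfile C_L C_R (x - x₀)) ^ 2) volume a b := by
  refine intervalIntegrable_of_ae_bounded (B := (2 * m) ^ 2)
    ((aestronglyMeasurable_sub_shockProfile hu).pow 2) ?_ a b
  filter_upwards [hm] with x hx
  exact (abs_of_nonneg (sq_nonneg _)).trans_le
    (sq_sub_le_of_mem_Icc (abs_le.1 hx) (shockProfile_mem_Icc hL hR _))

theorem integral_cutoff_layerError_le (hk : 0 < k) (hδ : 0 ≤ δ) (hr : 0 < r) :
    ∫ x in (-r ^ 2)..(r ^ 2), cutoff r x * layerError δ k (x - x₀) ≤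
      4 * δ + 16 * Real.exp (-(k * δ / 2)) / k := by
  have hle : -r ^ 2 ≤ r ^ 2 := by nlinarith
  refine le_trans ?_ (integral_layerError_le hk hδ x₀ hle)
  exact intervalIntegral.integral_mono_on hle
    (intervalIntegrable_cutoff_mul (intervalIntegrable_layerError _ _ _ _ _))
    (intervalIntegrable_layerError _ _ _ _ _)
    fun x hx => mul_le_of_le_one_left (layerError_nonneg _ _ _) (cutoff_le_one hr hx)

theorem integral_cutoff_sq_le_layers (hu : AEStronglyMeasurable u volume)
    (hm : ∀ᵐ x, |u x| ≤ m) (hL : C_L ∈ Icc (-m) m) (hR : C_R ∈ Icc (-m) m) (hk : 0 < k)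
    (hδ : 0 ≤ δ) (hr : 0 < r) :
    ∫ x in (-r ^ 2)..(r ^ 2), cutoff r x * (u x - shockProfile C_L C_R (x - x₀)) ^ 2 ≤
      (∫ x in (-r ^ 2)..(r ^ 2), cutoff r x * (layer 1 δ k (x - x₀) * (u x - C_L) ^ 2)) +
      (∫ x in (-r ^ 2)..(r ^ 2), cutoff r x * (layer (-1) δ k (x - x₀) * (u x - C_R) ^ 2)) +
      (2 * m) ^ 2 * (4 * δ + 16 * Real.exp (-(k * δ / 2)) / k) := by
  have hle : -r ^ 2 ≤ r ^ 2 := by nlinarith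
  have iL := intervalIntegrable_cutoff_mul (r := r) (intervalIntegrable_layer_mul_sq (σ := 1)
    (δ := δ) (k := k) (x₀ := x₀) hu hm hL (-r ^ 2) (r ^ 2))
  have iR := intervalIntegrable_cutoff_mul (r := r) (intervalIntegrable_layer_mul_sq (σ := -1)
    (δ := δ) (k := k) (x₀ := x₀) hu hm hR (-r ^ 2) (r ^ 2))
  have iE := intervalIntegrable_cutoff_mul (r := r)
    (intervalIntegrable_layerError δ k x₀ (-r ^ 2) (r ^ 2))
  have hE := mul_le_mul_of_nonneg_left (integral_cutoff_layerError_le (x₀ := x₀) hk hδ hr)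
    (sq_nonneg (2 * m))
  refine le_trans ?_ (add_le_add_right hE _)
  rw [← intervalIntegral.integral_add iL iR, ← intervalIntegral.integral_const_mul,
    ← intervalIntegral.integral_add (iL.add iR) (iE.const_mul _)]
  refine intervalIntegral.integral_mono_ae hle
    (intervalIntegrable_cutoff_mul (intervalIntegrable_sq_sub_shockProfile hu hm hL hR _ _))
    ((iL.add iR).add (iE.const_mul _)) ?_
  filter_upwards [hm] with x hx
  have h1 := mul_le_mul_of_nonneg_left (sq_sub_shockProfile_le_layers (y := x - x₀) hk.le hδ
    (sq_sub_le_of_mem_Icc (abs_le.1 hx) hL) (sq_sub_le_of_mem_Icc (abs_le.1 hx) hR))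
    (cutoff_nonneg r x)
  linarith

theorem integral_cutoff_layers_le_sq (hu : AEStronglyMeasurable u volume)
    (hm : ∀ᵐ x, |u x| ≤ m) (hL : C_L ∈ Icc (-m) m) (hR : C_R ∈ Icc (-m) m) (hk : 0 < k)
    (hδ : 0 ≤ δ) (hr : 0 < r) :
    (∫ x in (-r ^ 2)..(r ^ 2), cutoff r x * (layer 1 δ k (x - x₀) * (u x - C_L) ^ 2)) +
      (∫ x in (-r ^ 2)..(r ^ 2), cutoff r x * (layer (-1) δ k (x - x₀) * (u x - C_R) ^ 2)) ≤
      (∫ x in (-r ^ 2)..(r ^ 2), cutoff r x * (u x - shockProfile C_L C_R (x - x₀)) ^ 2) +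
      (2 * m) ^ 2 * (4 * δ + 16 * Real.exp (-(k * δ / 2)) / k) := by
  have hle : -r ^ 2 ≤ r ^ 2 := by nlinarith
  have iL := intervalIntegrable_cutoff_mul (r := r) (intervalIntegrable_layer_mul_sq (σ := 1)
    (δ := δ) (k := k) (x₀ := x₀) hu hm hL (-r ^ 2) (r ^ 2))
  have iR := intervalIntegrable_cutoff_mul (r := r) (intervalIntegrable_layer_mul_sq (σ := -1)
    (δ := δ) (k := k) (x₀ := x₀) hu hm hR (-r ^ 2) (r ^ 2))
  have iE := intervalIntegrable_cutoff_mul (r := r)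
    (intervalIntegrable_layerError δ k x₀ (-r ^ 2) (r ^ 2))
  have iS := intervalIntegrable_cutoff_mul (r := r) (intervalIntegrable_sq_sub_shockProfile
    (x₀ := x₀) hu hm hL hR (-r ^ 2) (r ^ 2))
  have hE := mul_le_mul_of_nonneg_left (integral_cutoff_layerError_le (x₀ := x₀) hk hδ hr)
    (sq_nonneg (2 * m))
  refine le_trans ?_ (add_le_add_right hE _)
  rw [← intervalIntegral.integral_add iL iR, ← intervalIntegral.integral_const_mul,
    ← intervalIntegral.integral_add iS (iE.const_mul _)]
  refine intervalIntegral.integral_mono_ae hle (iL.add iR) (iS.add (iE.const_mul _)) ?_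
  filter_upwards [hm] with x hx
  have h1 := mul_le_mul_of_nonneg_left (layers_le_sq_sub_shockProfile (y := x - x₀) hk.le hδ
    (sq_sub_le_of_mem_Icc (abs_le.1 hx) hL) (sq_sub_le_of_mem_Icc (abs_le.1 hx) hR))
    (cutoff_nonneg r x)
  linarith

end Cutoff

/-- Bounds on the truncated energies pass to the limit. -/
theorem memLp_two_of_integral_cutoff_le {f b : ℝ → ℝ} {B l : ℝ}
    (hf : AEStronglyMeasurable f volume) (hB : ∀ᵐ x, |f x| ≤ B) (hb : Tendsto b atTop (𝓝 l))
    (hfb : ∀ r, 1 ≤ r → ∫ x in (-r ^ 2)..(r ^ 2), cutoff r x * f x ^ 2 ≤ b r) :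
    MemLp f 2 volume ∧ sqL2Norm f ≤ l := by
  have hsq : ∀ᵐ x, |f x ^ 2| ≤ B ^ 2 := by
    filter_upwards [hB] with x hx
    rw [abs_pow]
    gcongr
  have hint : ∀ r : ℝ, IntervalIntegrable (fun x => cutoff r x * f x ^ 2) volume (-r ^ 2) (r ^ 2) :=
    fun r => intervalIntegrable_cutoff_mul (intervalIntegrable_of_ae_bounded (hf.pow 2) hsq _ _)
  have hle : ∀ n : ℕ, -((n : ℝ) + 1) ^ 2 ≤ ((n : ℝ) + 1) ^ 2 := fun n => by nlinarith
  set G : ℕ → ℝ → ℝ≥0∞ := fun n => (Ioc (-((n : ℝ) + 1) ^ 2) (((n : ℝ) + 1) ^ 2)).indicator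
    fun x => ENNReal.ofReal (cutoff ((n : ℝ) + 1) x * f x ^ 2) with hG
  have hGm : ∀ n, AEMeasurable (G n) volume := fun n =>
    (((continuous_cutoff _).aestronglyMeasurable.mul (hf.pow 2)).aemeasurable.ennreal_ofReal).indicator
      measurableSet_Ioc
  have hGint : ∀ n, ∫⁻ x, G n x ≤ ENNReal.ofReal (b ((n : ℝ) + 1)) := by
    intro n
    have hn : (1 : ℝ) ≤ (n : ℝ) + 1 := by linarith [n.cast_nonneg (α := ℝ)]
    rw [hG]
    simp only
    rw [lintegral_indicator measurableSet_Ioc, ← ofReal_integral_eq_lintegral_ofReal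
      ((intervalIntegrable_iff_integrableOn_Ioc_of_le (hle n)).1 (hint _))
      (Eventually.of_forall fun x => mul_nonneg (cutoff_nonneg _ _) (sq_nonneg _)),
      ← intervalIntegral.integral_of_le (hle n)]
    exact ENNReal.ofReal_le_ofReal (hfb _ hn)
  have hcast : Tendsto (fun n : ℕ => (n : ℝ) + 1) atTop atTop :=
    tendsto_atTop_add_const_right _ _ tendsto_natCast_atTop_atTop
  have hGlim : ∀ x, liminf (fun n => G n x) atTop = ENNReal.ofReal (f x ^ 2) := by
    intro x
    refine Tendsto.liminf_eq ?_
    have h1 : Tendsto (fun n : ℕ => ENNReal.ofReal (cutoff ((n : ℝ) + 1) x * f x ^ 2)) atTop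
        (𝓝 (ENNReal.ofReal (1 * f x ^ 2))) :=
      ENNReal.tendsto_ofReal (((tendsto_cutoff x).comp hcast).mul_const _)
    rw [one_mul] at h1
    refine h1.congr' ?_
    filter_upwards [hcast.eventually_gt_atTop |x|] with n hn
    have hn1 : (1 : ℝ) ≤ (n : ℝ) + 1 := by linarith [n.cast_nonneg (α := ℝ)]
    have hx : |x| < ((n : ℝ) + 1) ^ 2 := hn.trans_le (by nlinarith)
    rw [hG]
    simp only
    rw [indicator_of_mem]
    exact ⟨(abs_lt.1 hx).1, (abs_lt.1 hx).2.le⟩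
  -- Square integrability is part of the conclusion, so the limit is taken by Fatou in extended
  -- nonnegative integrals.
  have hfatou : ∫⁻ x, ENNReal.ofReal (f x ^ 2) ≤ ENNReal.ofReal l := by
    calc ∫⁻ x, ENNReal.ofReal (f x ^ 2) = ∫⁻ x, liminf (fun n => G n x) atTop := by
          simp only [hGlim]
      _ ≤ liminf (fun n => ∫⁻ x, G n x) atTop := lintegral_liminf_le' hGm
      _ ≤ liminf (fun n : ℕ => ENNReal.ofReal (b ((n : ℝ) + 1))) atTop :=
          liminf_le_liminf (Eventually.of_forall hGint)
      _ = ENNReal.ofReal l := (ENNReal.tendsto_ofReal (hb.comp hcast)).liminf_eq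
  have h0 : 0 ≤ᵐ[volume] fun x => f x ^ 2 := Eventually.of_forall fun x => sq_nonneg _
  have hfin : ∫⁻ x, ENNReal.ofReal (f x ^ 2) ≠ ⊤ :=
    (hfatou.trans_lt ENNReal.ofReal_lt_top).ne
  have hmem : MemLp f 2 volume := (memLp_two_iff_integrable_sq hf).2
    ((lintegral_ofReal_ne_top_iff_integrable (hf.pow 2) h0).1 hfin)
  have hl : 0 ≤ l := by
    refine ge_of_tendsto hb ?_
    filter_upwards [eventually_ge_atTop 1] with r hr
    refine le_trans ?_ (hfb r hr)
    exact intervalIntegral.integral_nonneg (by nlinarith)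
      fun x _ => mul_nonneg (cutoff_nonneg _ _) (sq_nonneg _)
  refine ⟨hmem, ?_⟩
  rw [sqL2Norm_eq_integral hmem, integral_eq_lintegral_of_nonneg_ae h0 (hf.pow 2)]
  exact ENNReal.toReal_le_of_le_ofReal hl hfatou

namespace IsViscousSolution

variable {A : ℝ → ℝ} {ε : ℝ} {U₀ : ℝ → ℝ} {U : ℝ → ℝ → ℝ}

/-- The distance to the shifted shock grows at most by the mass of the layers. -/
theorem sqL2Norm_sub_shift_le (h : IsViscousSolution A ε U₀ U) (hA : ContDiff ℝ 2 A) (hε : 0 ≤ ε)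
    (hU₀ : AEStronglyMeasurable U₀ volume) {δ k θ h₀ L m C_L C_R T τ : ℝ} {X v : ℝ → ℝ}
    (hk : 0 < k) (hεk : ε * k = θ) (hθ : 0 ≤ θ) (hδ : 0 ≤ δ) (hδh : 2 * δ ≤ h₀)
    (hL : ∀ s ∈ Icc (-m) m, |deriv A s| ≤ L) (hCL : C_L ∈ Icc (-m) m) (hCR : C_R ∈ Icc (-m) m)
    (hm : ∀ t > 0, ∀ x, |U t x| ≤ m) (hm₀ : ∀ᵐ x, |U₀ x| ≤ m)
    (hS : MemLp (fun x => U₀ x - shockProfile C_L C_R x) 2 volume)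
    (cX : ContinuousOn X (Icc 0 T)) (hX0 : X 0 = 0) (hX : ∀ t ∈ Ioo 0 T, HasDerivAt X (v t) t)
    (hvL : ∀ t ∈ Ioo 0 T, |v t| ≤ L) (cv : ContinuousOn v (Ioo 0 T)) (hτ : 0 < τ)
    (hgoodL : ∀ t ∈ Ioo 0 T, τ ≤ t → ∀ x, x < X t → X t < x + h₀ →
      v t + θ ≤ meanSpeed (deriv A) C_L (U t x))
    (hgoodR : ∀ t ∈ Ioo 0 T, τ ≤ t → ∀ x, X t < x → x < X t + h₀ →
      meanSpeed (deriv A) C_R (U t x) + θ ≤ v t)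
    {t : ℝ} (ht : t ∈ Ioo 0 T) :
    MemLp (fun x => U t x - shockProfile C_L C_R (x - X t)) 2 volume ∧
    sqL2Norm (fun x => U t x - shockProfile C_L C_R (x - X t)) ≤
      sqL2Norm (fun x => U₀ x - shockProfile C_L C_R x) +
      2 * (2 * m) ^ 2 * (4 * δ + 16 * Real.exp (-(k * δ / 2)) / k) +
      2 * (2 * L + θ) * (2 * m) ^ 2 * (τ + 8 * Real.exp (-(k * δ / 2)) * t) := by
  set S₀ := sqL2Norm (fun x => U₀ x - shockProfile C_L C_R x) with hS₀
  set E := (2 * m) ^ 2 * (4 * δ + 16 * Real.exp (-(k * δ / 2)) / k) with hE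
  set N := (2 * L + θ) * (2 * m) ^ 2 with hN
  set Γ := 32 * (L + ε + 2 * θ) with hΓ
  set P := N * (τ + 8 * Real.exp (-(k * δ / 2)) * t) with hP
  have cU := h.continuous_slice ht.1
  have hmt : ∀ᵐ x, |U t x| ≤ m := Eventually.of_forall (hm t ht.1)
  -- The two sides of the shock contribute `P` and the cutoff error once each. The comparison of
  -- layers with the sharp profile contributes `E` at the initial time, inside the exponential
  -- factor, and again at time `t`.
  have hlim : Tendsto (fun r : ℝ => Real.exp (Γ / r * t) *
      (S₀ + E + 2 * P + 2 * (2 * Γ * (2 * m) ^ 2 / r * t)) + E) atTop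
      (𝓝 (Real.exp (0 * t) * (S₀ + E + 2 * P + 2 * (0 * t)) + E)) := by
    have h1 : Tendsto (fun r : ℝ => Γ / r) atTop (𝓝 0) := tendsto_const_nhds.div_atTop tendsto_id
    have h2 : Tendsto (fun r : ℝ => 2 * Γ * (2 * m) ^ 2 / r) atTop (𝓝 0) :=
      tendsto_const_nhds.div_atTop tendsto_id
    exact (((Real.continuous_exp.tendsto _).comp (h1.mul_const t)).mul
      (tendsto_const_nhds.add ((h2.mul_const t).const_mul 2))).add tendsto_const_nhds
  have key := memLp_two_of_integral_cutoff_le (B := 2 * m)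
    (aestronglyMeasurable_sub_shockProfile (C_L := C_L) (C_R := C_R) (x₀ := X t)
      cU.aestronglyMeasurable)
    (Eventually.of_forall fun x => by
      have h1 := abs_le.1 (hm t ht.1 x)
      have h2 := shockProfile_mem_Icc hCL hCR (x - X t)
      exact abs_le.2 ⟨by linarith [h2.2], by linarith [h2.1]⟩) hlim ?_
  · refine ⟨key.1, key.2.trans (le_of_eq ?_)⟩
    simp only [zero_mul, Real.exp_zero, mul_zero, hE, hP, hN]
    ring
  intro r hr
  have hr0 : 0 < r := by linarith
  have eL := h.layer_energy_le hA hε hU₀ (σ := 1) (by norm_num) hk hεk hθ hδ hδh hL hCL hm hm₀ cX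
    hX0 hX hvL cv hτ (fun t ht hτt x h1 h2 => by
      have := hgoodL t ht hτt x (by linarith) (by linarith)
      linarith) hr hN hΓ ht
  have eR := h.layer_energy_le hA hε hU₀ (σ := -1) (by norm_num) hk hεk hθ hδ hδh hL hCR hm hm₀ cX
    hX0 hX hvL cv hτ (fun t ht hτt x h1 h2 => by
      have := hgoodR t ht hτt x (by linarith) (by linarith)
      linarith) hr hN hΓ ht
  have e1 := integral_cutoff_sq_le_layers (x₀ := X t) cU.aestronglyMeasurable hmt hCL hCR hk hδ hr0
  have e2 := integral_cutoff_layers_le_sq (x₀ := 0) hU₀ hm₀ hCL hCR hk hδ hr0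
  simp only [sub_zero] at e2
  have e3 : ∫ x in (-r ^ 2)..(r ^ 2), cutoff r x * (U₀ x - shockProfile C_L C_R x) ^ 2 ≤ S₀ := by
    have hle : -r ^ 2 ≤ r ^ 2 := by nlinarith
    have hi := hS.integrable_sq
    rw [hS₀, sqL2Norm_eq_integral hS]
    refine (intervalIntegral.integral_mono_on hle
      (intervalIntegrable_cutoff_mul hi.intervalIntegrable) hi.intervalIntegrable
      fun x hx => mul_le_of_le_one_left (sq_nonneg _) (cutoff_le_one hr0 hx)).trans ?_
    rw [intervalIntegral.integral_of_le hle]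
    exact setIntegral_le_integral hi (Eventually.of_forall fun x => sq_nonneg _)
  refine e1.trans (add_le_add_left ?_ _)
  refine (add_le_add eL eR).trans ?_
  rw [← mul_add]
  refine mul_le_mul_of_nonneg_left ?_ (Real.exp_pos _).le
  linarith

end IsViscousSolution

/-! ### The position of the shift -/

/-- A plateau function, equal to `1` on `[-1, 1]` and flat at `±2`. -/
theorem exists_plateau : ∃ χ χ' χ'' : ℝ → ℝ, (∀ x, HasDerivAt χ (χ' x) x) ∧
    (∀ x, HasDerivAt χ' (χ'' x) x) ∧ Continuous χ'' ∧ (∀ x, χ x ∈ Icc 0 1) ∧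
    (∀ x ∈ Icc (-1) 1, χ x = 1 ∧ χ' x = 0) ∧
    (∀ x, |x| = 2 → χ x = 0 ∧ χ' x = 0) := by
  let b : ContDiffBump (0 : ℝ) := ⟨1, 2, one_pos, one_lt_two⟩
  have hb : ContDiff ℝ ∞ b := b.contDiff
  have hb' : ContDiff ℝ ∞ (deriv b) := (contDiff_infty_iff_deriv.1 hb).2
  have h1 : ∀ x ∈ Icc (-1 : ℝ) 1, b x = 1 := fun x hx =>
    b.one_of_mem_closedBall (by rw [Real.closedBall_eq_Icc]; simpa [b] using hx)
  have h2 : ∀ x : ℝ, |x| = 2 → b x = 0 := fun x hx =>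
    b.zero_of_le_dist (by rw [Real.dist_eq, sub_zero, hx])
  refine ⟨b, deriv b, deriv (deriv b), fun x => (hb.differentiable (by simp) x).hasDerivAt,
    fun x => (hb'.differentiable (by simp) x).hasDerivAt,
    hb'.continuous_deriv (by simp), fun x => ⟨b.nonneg, b.le_one⟩, fun x hx => ⟨h1 x hx, ?_⟩,
    fun x hx => ⟨h2 x hx, ?_⟩⟩
  · refine IsLocalMax.deriv_eq_zero (Eventually.of_forall fun y => ?_)
    rw [h1 x hx]
    exact b.le_one
  · refine IsLocalMin.deriv_eq_zero (Eventually.of_forall fun y => ?_)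
    rw [h2 x hx]
    exact b.nonneg

theorem abs_intervalIntegral_le_of_abs_le_mul {g F : ℝ → ℝ} {R b Q : ℝ} (hR : 0 ≤ R) (hb : 0 ≤ b)
    (hF : MemLp F 2 volume) (hQ : sqL2Norm F ≤ Q)
    (hg : ∀ᵐ x, x ∈ Icc (-R) R → |g x| ≤ b * |F x|) :
    |∫ x in (-R)..R, g x| ≤ b * √(2 * R) * √Q := by
  have hle : -R ≤ R := by linarith
  have hF' := hF.restrict (Ioc (-R) R)
  have hint : IntervalIntegrable (fun x => b * |F x|) volume (-R) R := by
    rw [intervalIntegrable_iff_integrableOn_Ioc_of_le hle]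
    exact ((hF'.integrable (by norm_num)).norm).const_mul b
  refine (intervalIntegral.norm_integral_le_of_norm_le (f := g) hle ?_ hint).trans ?_
  · filter_upwards [hg] with x hx hxm
    exact hx ⟨hxm.1.le, hxm.2⟩
  rw [intervalIntegral.integral_of_le hle]
  have h1 := integral_abs_mul_abs_le_sqrt (μ := volume.restrict (Ioc (-R) R))
    (memLp_const b : MemLp (fun _ => b) 2 _) hF'
  rw [integral_const, measureReal_restrict_apply_univ, Real.volume_real_Ioc_of_le hle, smul_eq_mul,
    abs_of_nonneg hb] at h1
  refine h1.trans ?_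
  have h2 : √((R - -R) * b ^ 2) = b * √(2 * R) := by
    rw [mul_comm, Real.sqrt_mul (sq_nonneg b), Real.sqrt_sq hb]
    ring_nf
  rw [h2]
  gcongr
  refine le_trans ?_ hQ
  rw [sqL2Norm_eq_integral hF]
  exact setIntegral_le_integral hF.integrable_sq (Eventually.of_forall fun x => sq_nonneg _)

theorem intervalIntegrable_mul_comp_shockProfile {w : ℝ → ℝ} (hw : Continuous w) (f : ℝ → ℝ)
    (C_L C_R x₀ a b : ℝ) :
    IntervalIntegrable (fun x => w x * f (shockProfile C_L C_R (x - x₀))) volume a b := by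
  have hf : (fun x => f (shockProfile C_L C_R (x - x₀))) =
      fun x => shockProfile (f C_L) (f C_R) (x - x₀) := by
    funext x
    unfold shockProfile
    split_ifs <;> rfl
  refine IntervalIntegrable.continuousOn_mul ?_ hw.continuousOn
  rw [hf]
  refine intervalIntegrable_of_ae_bounded (B := max |f C_L| |f C_R|)
    ((measurable_shockProfile _ _).comp (measurable_id.sub_const x₀)).aestronglyMeasurable
    (Eventually.of_forall fun x => ?_) a b
  simp only [Function.comp_apply, shockProfile]
  split_ifs
  exacts [le_max_left _ _, le_max_right _ _]

theorem integral_mul_comp_shockProfile {w : ℝ → ℝ} (hw : Continuous w) (f : ℝ → ℝ)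
    {C_L C_R x₀ R : ℝ} (hx₀ : x₀ ∈ Icc (-R) R) :
    ∫ x in (-R)..R, w x * f (shockProfile C_L C_R (x - x₀)) =
      (∫ x in (-R)..x₀, w x) * f C_L + (∫ x in x₀..R, w x) * f C_R := by
  rw [← intervalIntegral.integral_add_adjacent_intervals
    (intervalIntegrable_mul_comp_shockProfile hw f C_L C_R x₀ (-R) x₀)
    (intervalIntegrable_mul_comp_shockProfile hw f C_L C_R x₀ x₀ R),
    ← intervalIntegral.integral_mul_const, ← intervalIntegral.integral_mul_const]
  congr 1
  · refine intervalIntegral.integral_congr_ae ?_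
    filter_upwards [Measure.ae_ne volume x₀] with x hx hxm
    rw [uIoc_of_le hx₀.1] at hxm
    simp only [shockProfile]
    rw [if_pos (sub_neg.2 (lt_of_le_of_ne hxm.2 hx))]
  · refine intervalIntegral.integral_congr_ae (Eventually.of_forall fun x hx => ?_)
    rw [uIoc_of_le hx₀.2] at hx
    simp only [shockProfile]
    rw [if_neg (by linarith [hx.1])]

theorem tendsto_nhdsGT_of_continuousOn_Icc {X : ℝ → ℝ} {T : ℝ} (hT : 0 < T)
    (cX : ContinuousOn X (Icc 0 T)) : Tendsto X (𝓝[>] 0) (𝓝 (X 0)) :=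
  (cX 0 ⟨le_rfl, hT.le⟩).tendsto.mono_left (nhdsWithin_le_of_mem (Icc_mem_nhdsGT hT))

theorem abs_le_mul_of_abs_deriv_le {X v : ℝ → ℝ} {T L : ℝ} (cX : ContinuousOn X (Icc 0 T))
    (hX0 : X 0 = 0) (hX : ∀ t ∈ Ioo 0 T, HasDerivAt X (v t) t)
    (hvL : ∀ t ∈ Ioo 0 T, |v t| ≤ L) {t : ℝ} (ht : t ∈ Ioo 0 T) : |X t| ≤ L * t := by
  have hlim := tendsto_nhdsGT_of_continuousOn_Icc (ht.1.trans ht.2) cX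
  rw [hX0] at hlim
  have hlim' := hlim.neg
  rw [neg_zero] at hlim'
  have h1 := le_add_mul_of_tendsto_of_deriv_le ht hX
    (fun s hs => (abs_le.1 (hvL s ⟨hs.1, hs.2.trans ht.2⟩)).2) hlim
  have h2 := le_add_mul_of_tendsto_of_deriv_le ht (fun s hs => (hX s hs).neg)
    (fun s hs => neg_le.1 (abs_le.1 (hvL s ⟨hs.1, hs.2.trans ht.2⟩)).1) hlim'
  rw [Pi.neg_apply] at h2
  exact abs_le.2 ⟨by linarith, by linarith⟩

theorem abs_sub_le_of_abs_deriv_le {A : ℝ → ℝ} (hA : Differentiable ℝ A) {m L : ℝ}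
    (hL : ∀ s ∈ Icc (-m) m, |deriv A s| ≤ L) {u v : ℝ} (hu : u ∈ Icc (-m) m)
    (hv : v ∈ Icc (-m) m) : |A u - A v| ≤ L * |u - v| :=
  (convex_Icc (-m) m).norm_image_sub_le_of_norm_deriv_le (fun x _ => hA x) hL hv hu

namespace IsViscousSolution

variable {A : ℝ → ℝ}

/-- The mass balance on an interval that contains the shift controls the position of the shift by
the distance to the shifted shock. -/
theorem exists_sq_shift_sub_le (hA : ContDiff ℝ 2 A) {L m C_L C_R : ℝ} (hC : C_R < C_L)
    (hL1 : 1 ≤ L) (hL : ∀ s ∈ Icc (-m) m, |deriv A s| ≤ L) (hCL : C_L ∈ Icc (-m) m)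
    (hCR : C_R ∈ Icc (-m) m) :
    ∃ C, 0 ≤ C ∧ ∀ {ε T Q : ℝ} {U₀ : ℝ → ℝ} {U : ℝ → ℝ → ℝ} {X v : ℝ → ℝ},
      IsViscousSolution A ε U₀ U → 0 ≤ ε → AEStronglyMeasurable U₀ volume →
      (∀ t > 0, ∀ x, |U t x| ≤ m) → (∀ᵐ x, |U₀ x| ≤ m) →
      ContinuousOn X (Icc 0 T) → X 0 = 0 → (∀ t ∈ Ioo 0 T, HasDerivAt X (v t) t) →
      (∀ t ∈ Ioo 0 T, |v t| ≤ L) →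
      MemLp (fun x => U₀ x - shockProfile C_L C_R x) 2 volume →
      sqL2Norm (fun x => U₀ x - shockProfile C_L C_R x) ≤ Q →
      (∀ t ∈ Ioo 0 T, MemLp (fun x => U t x - shockProfile C_L C_R (x - X t)) 2 volume) →
      (∀ t ∈ Ioo 0 T, sqL2Norm (fun x => U t x - shockProfile C_L C_R (x - X t)) ≤ Q) →
      ∀ t ∈ Ioo 0 T, ε ≤ t → |X t - shockSpeed A C_L C_R * t| ^ 2 ≤ C * (t * Q) := by
  obtain ⟨χ, χ', χ'', dχ, dχ', cχ'', hχ01, hχ1, hχ2⟩ := exists_plateau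
  have cχ : Continuous χ := continuous_iff_continuousAt.2 fun x => (dχ x).continuousAt
  have cχ' : Continuous χ' := continuous_iff_continuousAt.2 fun x => (dχ' x).continuousAt
  obtain ⟨B₁, hB₁⟩ := (isCompact_Icc (a := (-2 : ℝ)) (b := 2)).exists_bound_of_continuousOn
    cχ'.continuousOn
  obtain ⟨B₂, hB₂⟩ := (isCompact_Icc (a := (-2 : ℝ)) (b := 2)).exists_bound_of_continuousOn
    cχ''.continuousOn
  set B := max B₁ B₂
  have hB0 : 0 ≤ B := (norm_nonneg _).trans ((hB₁ 0 (by norm_num)).trans (le_max_left _ _))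
  -- The summand `L * B` comes from the flux, `B` from viscosity, and `2` from replacing the
  -- solution by the profile at the two end times.
  set κ := (L + 1) * B + 2 with hκ
  have hκ0 : 0 ≤ κ := by positivity
  have dA : Differentiable ℝ A := hA.differentiable (by norm_num)
  refine ⟨(κ / (C_L - C_R)) ^ 2 * (4 * L), by positivity, ?_⟩
  intro ε T Q U₀ U X v h hε hU₀ hm hm₀ cX hX0 hX hvL hS hSQ hF hFQ t ht hεt
  have ht0 : 0 < t := ht.1
  have hT : 0 < T := ht0.trans ht.2
  -- The plateau `[-ℓ, ℓ]` contains the shift up to time `t`, and its length is proportional to `t`,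
  -- so Cauchy-Schwarz yields a factor `√t`. Since `1 ≤ L`, also `ε ≤ t ≤ ℓ`.
  set ℓ := L * t with hℓ
  have hℓ0 : 0 < ℓ := by positivity
  have htℓ : t ≤ ℓ := by rw [hℓ]; nlinarith
  have hQ0 : 0 ≤ Q := (sq_nonneg _).trans hSQ
  have hXℓ : ∀ s ∈ Ioc 0 t, |X s| ≤ ℓ := fun s hs =>
    (abs_le_mul_of_abs_deriv_le cX hX0 hX hvL ⟨hs.1, hs.2.trans_lt ht.2⟩).trans
      (mul_le_mul_of_nonneg_left hs.2 (by linarith))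
  set ψ : ℝ → ℝ := fun x => χ (x / ℓ) with hψ
  set ψx : ℝ → ℝ := fun x => χ' (x / ℓ) * (1 / ℓ) with hψx
  set ψxx : ℝ → ℝ := fun x => χ'' (x / ℓ) * (1 / ℓ) * (1 / ℓ) with hψxx
  have dψ : ∀ x, HasDerivAt ψ (ψx x) x := fun x =>
    (dχ (x / ℓ)).comp x ((hasDerivAt_id x).div_const ℓ)
  have dψx : ∀ x, HasDerivAt ψx (ψxx x) x := fun x =>
    ((dχ' (x / ℓ)).comp x ((hasDerivAt_id x).div_const ℓ)).mul_const _
  have cψ : Continuous ψ := cχ.comp (continuous_id.div_const ℓ)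
  have cψx : Continuous ψx := (cχ'.comp (continuous_id.div_const ℓ)).mul continuous_const
  have cψxx : Continuous ψxx :=
    ((cχ''.comp (continuous_id.div_const ℓ)).mul continuous_const).mul continuous_const
  have hends : ∀ x, |x| = 2 * ℓ → ψ x = 0 ∧ ψx x = 0 := by
    intro x hx
    have h1 := hχ2 (x / ℓ) (by rw [abs_div, abs_of_pos hℓ0, hx]; field_simp)
    exact ⟨h1.1, by simp only [hψx, h1.2, zero_mul]⟩
  have hendR := hends (2 * ℓ) (abs_of_pos (by positivity))
  have hendL := hends (-(2 * ℓ)) (by rw [abs_neg, abs_of_pos (by positivity)])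
  have hplat : ∀ x, |x| ≤ ℓ → ψ x = 1 ∧ ψx x = 0 := by
    intro x hx
    have h1 := hχ1 (x / ℓ) (abs_le.1 (by
      rw [abs_div, abs_of_pos hℓ0]
      exact (div_le_one hℓ0).2 hx))
    exact ⟨h1.1, by simp only [hψx, h1.2, zero_mul]⟩
  have hscale : ∀ x ∈ Icc (-(2 * ℓ)) (2 * ℓ), x / ℓ ∈ Icc (-2 : ℝ) 2 := fun x hx =>
    ⟨by rw [le_div_iff₀ hℓ0]; linarith [hx.1], by rw [div_le_iff₀ hℓ0]; linarith [hx.2]⟩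
  have bψ : ∀ x, |ψ x| ≤ 1 := fun x => (abs_of_nonneg (hχ01 _).1).trans_le (hχ01 _).2
  have bψx : ∀ x ∈ Icc (-(2 * ℓ)) (2 * ℓ), |ψx x| ≤ B / ℓ := by
    intro x hx
    have h1 : |χ' (x / ℓ)| ≤ B := (hB₁ _ (hscale x hx)).trans (le_max_left _ _)
    rw [hψx]
    simp only
    rw [abs_mul, abs_of_pos (by positivity : 0 < 1 / ℓ), div_eq_mul_one_div B]
    gcongr
  have bψxx : ∀ x ∈ Icc (-(2 * ℓ)) (2 * ℓ), |ψxx x| ≤ B / ℓ / ℓ := by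
    intro x hx
    have h1 : |χ'' (x / ℓ)| ≤ B := (hB₂ _ (hscale x hx)).trans (le_max_right _ _)
    rw [hψxx]
    simp only
    rw [abs_mul, abs_mul, abs_of_pos (by positivity : 0 < 1 / ℓ), div_eq_mul_one_div (B / ℓ),
      div_eq_mul_one_div B]
    gcongr
  have hmemX : ∀ y, |y| ≤ ℓ → y ∈ Icc (-(2 * ℓ)) (2 * ℓ) := fun y hy =>
    ⟨by linarith [(abs_le.1 hy).1], by linarith [(abs_le.1 hy).2]⟩
  have iψx : ∀ y, |y| ≤ ℓ → (∫ x in (-(2 * ℓ))..y, ψx x) = 1 ∧ (∫ x in y..(2 * ℓ), ψx x) = -1 := by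
    intro y hy
    rw [intervalIntegral.integral_eq_sub_of_hasDerivAt (fun x _ => dψ x)
      (cψx.intervalIntegrable _ _), intervalIntegral.integral_eq_sub_of_hasDerivAt
      (fun x _ => dψ x) (cψx.intervalIntegrable _ _), (hplat y hy).1, hendR.1, hendL.1]
    norm_num
  have iψxx : ∀ y, |y| ≤ ℓ →
      (∫ x in (-(2 * ℓ))..y, ψxx x) = 0 ∧ (∫ x in y..(2 * ℓ), ψxx x) = 0 := by
    intro y hy
    rw [intervalIntegral.integral_eq_sub_of_hasDerivAt (fun x _ => dψx x)
      (cψxx.intervalIntegrable _ _), intervalIntegral.integral_eq_sub_of_hasDerivAt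
      (fun x _ => dψx x) (cψxx.intervalIntegrable _ _), (hplat y hy).2, hendR.2, hendL.2]
    norm_num
  set J : ℝ → ℝ := fun s => ∫ x in (-(2 * ℓ))..(2 * ℓ), ψ x * U s x with hJ
  have hder := fun s (hs : s ∈ Ioo 0 T) => h.hasDerivAt_integral_entropy dA
    (η := fun u => u) (η' := fun _ => 1) (η'' := fun _ => 0) (q := A)
    (fun u => hasDerivAt_id u) (fun u => hasDerivAt_const _ _) continuous_const
    (fun u => by simpa using (dA u).hasDerivAt)
    (T := T) (R := 2 * ℓ) (by positivity) (ψ := fun _ => ψ) (ψt := fun _ _ => 0)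
    (ψx := fun _ => ψx) (ψxx := fun _ => ψxx)
    (fun s _ x => hasDerivAt_const _ _) (fun s _ => dψ) (fun s _ => dψx)
    (cψ.comp continuous_snd).continuousOn continuousOn_const (fun s _ => cψxx)
    (fun s _ => ⟨hendR.1, hendL.1⟩) (fun s _ => ⟨hendR.2, hendL.2⟩) hs
  set q := √(2 * (2 * ℓ)) * √Q with hq
  have hq0 : 0 ≤ q := by positivity
  -- For the shifted profile itself the rate is exactly `A C_L - A C_R`: `ψx` has integrals `1` and
  -- `-1` on the two sides of the shift, and `ψxx` has integral `0` on each. The deviation is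
  -- estimated by the `L²` distance.
  have hrate : ∀ s ∈ Ioo 0 t, |(∫ x in (-(2 * ℓ))..(2 * ℓ), ((0 : ℝ) * U s x + ψx x * A (U s x) +
      ε * (ψxx x * U s x) - ε * (ψ x * (0 * deriv (U s) x ^ 2)))) - (A C_L - A C_R)| ≤
      (L + 1) * (B / ℓ) * q := by
    intro s hs
    have hsT : s ∈ Ioo 0 T := ⟨hs.1, hs.2.trans ht.2⟩
    have hXs := hXℓ s ⟨hs.1, hs.2.le⟩
    have cU := h.continuous_slice hs.1
    have e1 := integral_mul_comp_shockProfile cψx A (C_L := C_L) (C_R := C_R) (hmemX _ hXs)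
    rw [(iψx _ hXs).1, (iψx _ hXs).2] at e1
    have e2 := integral_mul_comp_shockProfile cψxx (fun u => u) (C_L := C_L) (C_R := C_R)
      (hmemX _ hXs)
    rw [(iψxx _ hXs).1, (iψxx _ hXs).2] at e2
    have i1 : IntervalIntegrable (fun x => ψx x * A (U s x)) volume (-(2 * ℓ)) (2 * ℓ) :=
      (cψx.mul (dA.continuous.comp cU)).intervalIntegrable _ _
    have i2 : IntervalIntegrable (fun x => ψxx x * U s x) volume (-(2 * ℓ)) (2 * ℓ) :=
      (cψxx.mul cU).intervalIntegrable _ _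
    have j1 := intervalIntegrable_mul_comp_shockProfile cψx A C_L C_R (X s) (-(2 * ℓ)) (2 * ℓ)
    have j2 := intervalIntegrable_mul_comp_shockProfile cψxx (fun u => u) C_L C_R (X s)
      (-(2 * ℓ)) (2 * ℓ)
    have b1 := abs_intervalIntegral_le_of_abs_le_mul (R := 2 * ℓ) (b := B / ℓ * L)
      (g := fun x => ψx x * A (U s x) - ψx x * A (shockProfile C_L C_R (x - X s)))
      (by positivity) (by positivity) (hF s hsT) (hFQ s hsT)
      (Eventually.of_forall fun x hx => by
        rw [← mul_sub, abs_mul, mul_assoc]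
        exact mul_le_mul (bψx x hx) (abs_sub_le_of_abs_deriv_le dA hL (abs_le.1 (hm s hs.1 x))
          (shockProfile_mem_Icc hCL hCR _)) (abs_nonneg _) (by positivity))
    have b2 := abs_intervalIntegral_le_of_abs_le_mul (R := 2 * ℓ) (b := B / ℓ / ℓ)
      (g := fun x => ψxx x * U s x - ψxx x * shockProfile C_L C_R (x - X s))
      (by positivity) (by positivity) (hF s hsT) (hFQ s hsT)
      (Eventually.of_forall fun x hx => by
        rw [← mul_sub, abs_mul]
        exact mul_le_mul_of_nonneg_right (bψxx x hx) (abs_nonneg _))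
    rw [intervalIntegral.integral_sub i1 j1, e1, mul_assoc, ← hq] at b1
    rw [intervalIntegral.integral_sub i2 j2, e2, mul_assoc, ← hq] at b2
    have e3 : ∫ x in (-(2 * ℓ))..(2 * ℓ), ((0 : ℝ) * U s x + ψx x * A (U s x) +
        ε * (ψxx x * U s x) - ε * (ψ x * (0 * deriv (U s) x ^ 2))) =
        (∫ x in (-(2 * ℓ))..(2 * ℓ), ψx x * A (U s x)) +
          ε * ∫ x in (-(2 * ℓ))..(2 * ℓ), ψxx x * U s x := by
      rw [← intervalIntegral.integral_const_mul, ← intervalIntegral.integral_add i1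
        (i2.const_mul ε)]
      refine intervalIntegral.integral_congr fun x _ => ?_
      ring
    rw [e3]
    have b3 := mul_le_mul_of_nonneg_left b2 hε
    rw [← abs_of_nonneg hε, ← abs_mul, abs_of_nonneg hε] at b3
    -- The second derivative of the plateau is of size `1 / ℓ ^ 2`. The restriction `ε ≤ t` is
    -- needed here, to make the viscous error no larger than the flux error.
    have b4 : ε * (B / ℓ / ℓ * q) ≤ B / ℓ * q := by
      have : ε * (B / ℓ / ℓ * q) ≤ ℓ * (B / ℓ / ℓ * q) := by
        have := hεt.trans htℓ
        gcongr
      refine this.trans (le_of_eq ?_)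
      field_simp
    have b5 := abs_add_le ((∫ x in (-(2 * ℓ))..(2 * ℓ), ψx x * A (U s x)) -
      (1 * A C_L + -1 * A C_R)) (ε * ((∫ x in (-(2 * ℓ))..(2 * ℓ), ψxx x * U s x) -
      (0 * C_L + 0 * C_R)))
    have b6 : ((∫ x in (-(2 * ℓ))..(2 * ℓ), ψx x * A (U s x)) +
          ε * ∫ x in (-(2 * ℓ))..(2 * ℓ), ψxx x * U s x) - (A C_L - A C_R) =
        ((∫ x in (-(2 * ℓ))..(2 * ℓ), ψx x * A (U s x)) - (1 * A C_L + -1 * A C_R)) +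
        (ε * ((∫ x in (-(2 * ℓ))..(2 * ℓ), ψxx x * U s x) - (0 * C_L + 0 * C_R))) := by ring
    rw [b6]
    linarith
  have hlim : Tendsto J (𝓝[>] 0) (𝓝 (∫ x in (-(2 * ℓ))..(2 * ℓ), ψ x * U₀ x)) :=
    h.tendsto_integral_initial hU₀ hT (fun s hs => hm s hs.1) hm₀
      (η := fun u => u) (η' := fun _ => 1) (fun u => hasDerivAt_id u) continuous_const
      (R := 2 * ℓ) (by positivity) (ψ := fun _ => ψ) (B := 1) (fun _ _ => cψ)
      (fun _ _ x _ => bψ x) (fun _ => tendsto_const_nhds)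
  have up := le_add_mul_of_tendsto_of_deriv_le ht hder
    (B := A C_L - A C_R + (L + 1) * (B / ℓ) * q)
    (fun s hs => by linarith [(abs_le.1 (hrate s hs)).2]) hlim
  have low := le_add_mul_of_tendsto_of_deriv_le ht (fun s hs => (hder s hs).neg)
    (B := -(A C_L - A C_R) + (L + 1) * (B / ℓ) * q)
    (fun s hs => by linarith [(abs_le.1 (hrate s hs)).1]) hlim.neg
  have hXt := hXℓ t ⟨ht0, le_rfl⟩
  have h0ℓ : |(0 : ℝ)| ≤ ℓ := by rw [abs_zero]; exact hℓ0.le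
  have s1 := integral_mul_comp_shockProfile cψ (fun u => u) (C_L := C_L) (C_R := C_R)
    (hmemX _ hXt)
  have s0 := integral_mul_comp_shockProfile cψ (fun u => u) (C_L := C_L) (C_R := C_R)
    (hmemX _ h0ℓ)
  simp only [sub_zero] at s0
  have a1 := intervalIntegral.integral_add_adjacent_intervals
    (cψ.intervalIntegrable (μ := volume) (-(2 * ℓ)) 0) (cψ.intervalIntegrable 0 (X t))
  have a2 := intervalIntegral.integral_add_adjacent_intervals
    (cψ.intervalIntegrable (μ := volume) 0 (X t)) (cψ.intervalIntegrable (X t) (2 * ℓ))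
  have a3 : ∫ x in (0 : ℝ)..(X t), ψ x = X t := by
    have : ∫ x in (0 : ℝ)..(X t), ψ x = ∫ x in (0 : ℝ)..(X t), (1 : ℝ) := by
      refine intervalIntegral.integral_congr fun x hx => (hplat x ?_).1
      have h1 := abs_le.1 hXt
      rcases mem_uIcc.1 hx with hx | hx
      · exact abs_le.2 ⟨by linarith [hx.1], by linarith [hx.2]⟩
      · exact abs_le.2 ⟨by linarith [hx.1], by linarith [hx.2]⟩
    rw [this]
    simp
  have c1 := abs_intervalIntegral_le_of_abs_le_mul (R := 2 * ℓ) (b := 1)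
    (g := fun x => ψ x * U t x - ψ x * shockProfile C_L C_R (x - X t))
    (by positivity) zero_le_one (hF t ht) (hFQ t ht)
    (Eventually.of_forall fun x hx => by
      rw [← mul_sub, abs_mul]
      exact mul_le_mul_of_nonneg_right (bψ x) (abs_nonneg _))
  have c0 := abs_intervalIntegral_le_of_abs_le_mul (R := 2 * ℓ) (b := 1)
    (g := fun x => ψ x * U₀ x - ψ x * shockProfile C_L C_R x)
    (by positivity) zero_le_one hS hSQ
    (Eventually.of_forall fun x hx => by
      rw [← mul_sub, abs_mul]
      exact mul_le_mul_of_nonneg_right (bψ x) (abs_nonneg _))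
  have j0 := intervalIntegrable_mul_comp_shockProfile cψ (fun u => u) C_L C_R 0
    (-(2 * ℓ)) (2 * ℓ)
  simp only [sub_zero] at j0
  have j1 : IntervalIntegrable (fun x => ψ x * U t x) volume (-(2 * ℓ)) (2 * ℓ) :=
    (cψ.mul (h.continuous_slice ht0)).intervalIntegrable _ _
  rw [intervalIntegral.integral_sub j1
    (intervalIntegrable_mul_comp_shockProfile cψ (fun u => u) C_L C_R (X t) _ _), s1, one_mul,
    ← hq] at c1
  rw [intervalIntegral.integral_sub
    ((intervalIntegrable_of_ae_bounded hU₀ hm₀ _ _).continuousOn_mul cψ.continuousOn) j0, s0,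
    one_mul, ← hq] at c0
  have hDt : (L + 1) * (B / ℓ) * q * t ≤ (L + 1) * B * q := by
    have : (L + 1) * (B / ℓ) * q * t ≤ (L + 1) * (B / ℓ) * q * ℓ := by gcongr
    refine this.trans (le_of_eq ?_)
    field_simp
  have hCd : 0 < C_L - C_R := by linarith
  -- Moving the jump from `0` to `X t` exchanges `C_R` for `C_L` on an oriented interval where the
  -- plateau equals `1`. This turns the mass balance into a formula for the position.
  have hdiff : (∫ x in (-(2 * ℓ))..(X t), ψ x) * C_L + (∫ x in (X t)..(2 * ℓ), ψ x) * C_R -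
      ((∫ x in (-(2 * ℓ))..0, ψ x) * C_L + (∫ x in (0 : ℝ)..(2 * ℓ), ψ x) * C_R) =
      (C_L - C_R) * X t := by
    rw [← a1, ← a2, a3]
    ring
  have hRH : shockSpeed A C_L C_R * t * (C_L - C_R) = (A C_L - A C_R) * t := by
    unfold shockSpeed
    field_simp
  have d1 := abs_le.1 c1
  have d0 := abs_le.1 c0
  have hmain : |X t - shockSpeed A C_L C_R * t| * (C_L - C_R) ≤ κ * q := by
    have e1 : (X t - shockSpeed A C_L C_R * t) * (C_L - C_R) =
        (C_L - C_R) * X t - (A C_L - A C_R) * t := by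
      rw [← hRH]
      ring
    rw [← abs_of_pos hCd, ← abs_mul, e1, hκ]
    simp only [Pi.neg_apply] at low
    refine abs_le.2 ⟨?_, ?_⟩ <;> linarith [d1.1, d1.2, d0.1, d0.2]
  have hfin : |X t - shockSpeed A C_L C_R * t| ≤ κ / (C_L - C_R) * q := by
    rw [div_mul_eq_mul_div, le_div_iff₀ hCd]
    exact hmain
  calc |X t - shockSpeed A C_L C_R * t| ^ 2 ≤ (κ / (C_L - C_R) * q) ^ 2 := by gcongr
    _ = (κ / (C_L - C_R)) ^ 2 * (2 * (2 * ℓ) * Q) := by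
      rw [mul_pow, hq, mul_pow, Real.sq_sqrt (by positivity), Real.sq_sqrt hQ0]
    _ = _ := by rw [hℓ]; ring

end IsViscousSolution

/-! ### The main theorem -/

theorem exists_mul_log_le {η : ℝ} (hη : 0 < η) : ∃ ε₀ > 0, ε₀ ≤ Real.exp (-1) ∧
    ∀ ε, 0 < ε → ε ≤ ε₀ → ε * Real.log (1 / ε) ≤ η := by
  have h1 : Tendsto (fun x : ℝ => -(Real.log x * x)) (𝓝[>] 0) (𝓝 (-0)) :=
    by simpa using (tendsto_log_mul_rpow_nhdsGT_zero zero_lt_one).neg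
  rw [neg_zero] at h1
  obtain ⟨b, hb, hsub⟩ := mem_nhdsGT_iff_exists_Ioo_subset.1 (h1.eventually_lt_const hη)
  have hb0 : 0 < b := hb
  refine ⟨min (Real.exp (-1)) (b / 2), lt_min (Real.exp_pos _) (by positivity), min_le_left _ _,
    fun ε h0 hε => ?_⟩
  have h2 : -(Real.log ε * ε) < η := hsub ⟨h0, by linarith [hε.trans (min_le_right _ _)]⟩
  rw [one_div, Real.log_inv]
  linarith

theorem le_mul_log_of_le_exp {ε : ℝ} (hε : 0 < ε) (hε1 : ε ≤ Real.exp (-1)) :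
    ε ≤ ε * Real.log (1 / ε) := by
  have h1 : Real.log ε ≤ -1 := (Real.log_le_iff_le_exp hε).2 hε1
  rw [one_div, Real.log_inv]
  nlinarith

theorem ae_abs_le_of_eLpNorm_top_le {u : ℝ → ℝ} {M : ℝ} (hM : 0 ≤ M)
    (h : eLpNorm u ∞ volume ≤ ENNReal.ofReal M) : ∀ᵐ x, |u x| ≤ M := by
  rw [eLpNorm_exponent_top] at h
  filter_upwards [ae_le_eLpNormEssSup (f := u) (μ := volume)] with x hx
  have h1 := hx.trans h
  rwa [Real.enorm_eq_ofReal_abs, ENNReal.ofReal_le_ofReal_iff hM] at h1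

theorem abs_shockSpeed_le {A : ℝ → ℝ} (hA : Differentiable ℝ A) {m L C_L C_R : ℝ} (hC : C_R < C_L)
    (hL : ∀ s ∈ Icc (-m) m, |deriv A s| ≤ L) (hCL : C_L ∈ Icc (-m) m) (hCR : C_R ∈ Icc (-m) m) :
    |shockSpeed A C_L C_R| ≤ L := by
  have hd : 0 < C_L - C_R := sub_pos.2 hC
  have h1 := abs_sub_le_of_abs_deriv_le hA hL hCL hCR
  rw [abs_of_pos hd] at h1
  rwa [shockSpeed, abs_div, abs_of_pos hd, div_le_iff₀ hd]

namespace IsViscousSolution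

variable {A : ℝ → ℝ} {ε : ℝ} {U₀ : ℝ → ℝ} {U : ℝ → ℝ → ℝ}

/-- If the initial value increases by at most `c₁` over distances up to `h₀`, then there is a
shift along which the distance to the shock is almost contracted. -/
theorem exists_shift_energy_le (h : IsViscousSolution A ε U₀ U) (hA : ContDiff ℝ 2 A)
    (ha : Monotone (deriv A)) (hε : 0 < ε) (hε1 : ε ≤ 1) (hlog : ε ≤ ε * Real.log (1 / ε))
    (hU₀ : AEStronglyMeasurable U₀ volume) {θ h₀ c₁ C L m C_L C_R T : ℝ} (hT : 0 < T)
    (hm : ∀ t > 0, ∀ x, |U t x| ≤ m) (hm₀ : ∀ᵐ x, |U₀ x| ≤ m)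
    (hCL : C_L ∈ Icc (-m) m) (hCR : C_R ∈ Icc (-m) m)
    (hL : ∀ s ∈ Icc (-m) m, |deriv A s| ≤ L) (hC0 : 0 ≤ C)
    (hC : ∀ x ∈ Icc (-m) m, ∀ y ∈ Icc (-m) m, |deriv A x - deriv A y| ≤ C * |x - y|)
    (hθ : 0 < θ) (hgap : ∀ u ∈ Icc (-m) m,
      4 * θ ≤ meanSpeed (deriv A) C_L u - meanSpeed (deriv A) C_R u)
    (hc₁ : 0 ≤ c₁) (hCc : C * c₁ ≤ θ)
    (hmod : ∀ h ∈ Ioc 0 h₀, ∀ᵐ x, U₀ (x + h) - U₀ x ≤ c₁)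
    (hεh : 4 * (ε * Real.log (1 / ε)) / θ ≤ h₀)
    (hS : MemLp (fun x => U₀ x - shockProfile C_L C_R x) 2 volume) :
    ∃ X v : ℝ → ℝ, ContinuousOn X (Icc 0 T) ∧ X 0 = 0 ∧
      (∀ t ∈ Ioo 0 T, HasDerivAt X (v t) t) ∧ (∀ t ∈ Ioo 0 T, |v t| ≤ L) ∧
      ∀ t ∈ Ioo 0 T, MemLp (fun x => U t x - shockProfile C_L C_R (x - X t)) 2 volume ∧
        sqL2Norm (fun x => U t x - shockProfile C_L C_R (x - X t)) ≤
          sqL2Norm (fun x => U₀ x - shockProfile C_L C_R x) +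
          (2 * (2 * m) ^ 2 * (24 / θ) + 2 * (2 * L + θ) * (2 * m) ^ 2 * (1 + 8 * T)) *
            (ε * Real.log (1 / ε)) := by
  have ca : Continuous (deriv A) := hA.continuous_deriv (by norm_num)
  have hmem : ∀ t > 0, ∀ x, U t x ∈ Icc (-m) m := fun t ht x => abs_le.1 (hm t ht x)
  -- The average puts the shift at least `2 * θ` away from both energy speeds at the point `X t`.
  set V : ℝ → ℝ := fun u => (meanSpeed (deriv A) C_L u + meanSpeed (deriv A) C_R u) / 2 with hV
  have hVL : ∀ u ∈ Icc (-m) m, |V u| ≤ L := by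
    intro u hu
    have h1 := abs_le.1 (abs_meanSpeed_le hL hCL hu)
    have h2 := abs_le.1 (abs_meanSpeed_le hL hCR hu)
    exact abs_le.2 ⟨by simp only [hV]; linarith [h1.1, h2.1],
      by simp only [hV]; linarith [h1.2, h2.2]⟩
  have hVC : ∀ u ∈ Icc (-m) m, ∀ v ∈ Icc (-m) m, |V u - V v| ≤ C * |u - v| := by
    intro u hu v hv
    have h1 := abs_le.1 (abs_meanSpeed_sub_le ca hC0 hC hCL hu hv)
    have h2 := abs_le.1 (abs_meanSpeed_sub_le ca hC0 hC hCR hu hv)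
    exact abs_le.2 ⟨by simp only [hV]; linarith [h1.1, h2.1],
      by simp only [hV]; linarith [h1.2, h2.2]⟩
  obtain ⟨X, v, cX, hX0, hX, hvL, cv, hv⟩ := h.exists_shift hm hVL hC0 hVC hε hT
  have hL0 : 0 ≤ L := (abs_nonneg _).trans (hL _ hCL)
  -- A one-sided bound is enough: if `z ≤ y` the mean speed is already ordered, and otherwise `C *
  -- c₁ ≤ θ` limits the loss.
  have hspeed : ∀ {c y z}, c ∈ Icc (-m) m → y ∈ Icc (-m) m → z ∈ Icc (-m) m → z - y ≤ c₁ →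
      meanSpeed (deriv A) c z - θ ≤ meanSpeed (deriv A) c y := by
    intro c y z hc hy hz hzy
    rcases le_total z y with hle | hle
    · linarith [meanSpeed_mono ca ha c hle]
    · have h1 := (abs_le.1 (abs_meanSpeed_sub_le ca hC0 hC hc hz hy)).2
      rw [abs_of_nonneg (sub_nonneg.2 hle)] at h1
      have h2 := mul_le_mul_of_nonneg_left hzy hC0
      linarith
  have hgoodL : ∀ t ∈ Ioo 0 T, ε ≤ t → ∀ x, x < X t → X t < x + h₀ →
      v t + θ ≤ meanSpeed (deriv A) C_L (U t x) := by
    intro t ht hεt x hx hx'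
    have h1 := h.increment_le hA ha hε.le hU₀ hm hm₀ hc₁ hmod ht.1 x (k := X t - x)
      ⟨by linarith, by linarith⟩
    rw [add_sub_cancel] at h1
    have h2 := hspeed hCL (hmem t ht.1 x) (hmem t ht.1 (X t)) h1
    have h3 := hgap _ (hmem t ht.1 (X t))
    rw [hv t ht hεt]
    simp only [hV]
    linarith
  have hgoodR : ∀ t ∈ Ioo 0 T, ε ≤ t → ∀ x, X t < x → x < X t + h₀ →
      meanSpeed (deriv A) C_R (U t x) + θ ≤ v t := by
    intro t ht hεt x hx hx'
    have h1 := h.increment_le hA ha hε.le hU₀ hm hm₀ hc₁ hmod ht.1 (X t) (k := x - X t)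
      ⟨by linarith, by linarith⟩
    rw [add_sub_cancel] at h1
    have h2 := hspeed hCR (hmem t ht.1 (X t)) (hmem t ht.1 x) h1
    have h3 := hgap _ (hmem t ht.1 (X t))
    rw [hv t ht hεt]
    simp only [hV]
    linarith
  refine ⟨X, v, cX, hX0, hX, hvL, fun t ht => ?_⟩
  set p := ε * Real.log (1 / ε) with hp
  have hp0 : 0 < p := hε.trans_le hlog
  -- These values give `ε * k = θ` and `k * δ / 2 = log (1 / ε)`, so the tail factor is exactly `ε`.
  -- The requirement `2 * δ ≤ h₀` becomes the assumed bound on `4 * p / θ`.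
  have key := h.sqL2Norm_sub_shift_le hA hε.le hU₀ (δ := 2 * p / θ) (k := θ / ε)
    (by positivity) (by field_simp) hθ.le (by positivity) (by
      refine (le_of_eq ?_).trans hεh
      ring) hL hCL hCR hm hm₀ hS cX hX0 hX hvL cv hε hgoodL hgoodR ht
  have hexp : Real.exp (-(θ / ε * (2 * p / θ) / 2)) = ε := by
    have : θ / ε * (2 * p / θ) / 2 = Real.log (1 / ε) := by
      rw [hp]
      field_simp
    rw [this, one_div, Real.log_inv, neg_neg, Real.exp_log hε]
  refine ⟨key.1, key.2.trans ?_⟩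
  rw [hexp]
  have e1 : 4 * (2 * p / θ) + 16 * ε / (θ / ε) ≤ 24 / θ * p := by
    have : 16 * ε / (θ / ε) ≤ 16 / θ * p := by
      have h2 : ε * ε ≤ p := (mul_le_of_le_one_right hε.le hε1).trans hlog
      calc 16 * ε / (θ / ε) = 16 / θ * (ε * ε) := by field_simp
        _ ≤ 16 / θ * p := by gcongr
    calc _ ≤ 4 * (2 * p / θ) + 16 / θ * p := by gcongr
      _ = _ := by ring
  have e2 : ε + 8 * ε * t ≤ (1 + 8 * T) * p := by
    have h1 : ε * t ≤ p * T := mul_le_mul hlog ht.2.le ht.1.le hp0.le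
    linarith
  have e3 : 2 * (2 * m) ^ 2 * (4 * (2 * p / θ) + 16 * ε / (θ / ε)) ≤
      2 * (2 * m) ^ 2 * (24 / θ * p) := by gcongr
  have e4 : 2 * (2 * L + θ) * (2 * m) ^ 2 * (ε + 8 * ε * t) ≤
      2 * (2 * L + θ) * (2 * m) ^ 2 * ((1 + 8 * T) * p) := by gcongr
  linarith

end IsViscousSolution

theorem theorem1p1 (A : ℝ → ℝ) (hA : ContDiff ℝ 2 A) (hA' : StrictConvexOn ℝ univ A)
    (C_L C_R : ℝ) (hC : C_R < C_L) (M K : ℝ) :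
    -- `ε₀` depends only on `A`, `C_L`, `C_R` and the bounds `M`, `K`; `Cs` depends also on `T`
    ∃ ε₀ > 0, ∀ T > 0, ∃ Cs > 0,
      ∀ U₀ g : ℝ → ℝ,
        MemLp U₀ ∞ volume → eLpNorm U₀ ∞ volume ≤ ENNReal.ofReal M →
        MemLp (fun x => U₀ x - shockProfile C_L C_R x) 2 volume →
        IsDerivPosPart U₀ g →
        MemLp g 2 volume → eLpNorm g 2 volume ≤ ENNReal.ofReal K →
      ∀ ε : ℝ, 0 < ε → ε ≤ ε₀ →
      ∀ U : ℝ → ℝ → ℝ, IsViscousSolution A ε U₀ U →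
      ∃ X : ℝ → ℝ, ContinuousOn X (Icc 0 T) ∧ X 0 = 0 ∧
        ∀ t ∈ Ioo 0 T,
          MemLp (fun x => U t x - shockProfile C_L C_R (x - X t)) 2 volume ∧
          sqL2Norm (fun x => U t x - shockProfile C_L C_R (x - X t)) ≤
            sqL2Norm (fun x => U₀ x - shockProfile C_L C_R x) + Cs * (ε * Real.log (1 / ε)) ∧
          DifferentiableAt ℝ X t ∧ |deriv X t| ≤ Cs ∧
          |X t - shockSpeed A C_L C_R * t| ^ 2 ≤
            Cs * t ^ (2 / 3 : ℝ) *
              (sqL2Norm (fun x => U₀ x - shockProfile C_L C_R x) + ε * Real.log (1 / ε)) := by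
  have dA : Differentiable ℝ A := hA.differentiable (by norm_num)
  have ca : Continuous (deriv A) := hA.continuous_deriv (by norm_num)
  have hstrict : StrictMono (deriv A) :=
    strictMonoOn_univ.1 (hA'.strictMonoOn_deriv fun x _ => dA x)
  have dA' : Differentiable ℝ (deriv A) :=
    (contDiff_succ_iff_deriv (n := 1)).1 hA |>.2.2.differentiable (by norm_num)
  have cA'' : Continuous (deriv (deriv A)) :=
    ((contDiff_succ_iff_deriv (n := 1)).1 hA).2.2.continuous_deriv (by norm_num)
  -- One interval contains the range of the solution and both end states. Absolute values also cover
  -- negative `M`.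
  set m := |M| + |C_L| + |C_R| with hm_def
  have hM0 := abs_nonneg M
  have hCL0 := abs_nonneg C_L
  have hCR0 := abs_nonneg C_R
  have hm0 : 0 ≤ m := by positivity
  have hCL : C_L ∈ Icc (-m) m := abs_le.1 (by linarith)
  have hCR : C_R ∈ Icc (-m) m := abs_le.1 (by linarith)
  obtain ⟨L₀, hL₀⟩ := (isCompact_Icc (a := -m) (b := m)).exists_bound_of_continuousOn
    ca.continuousOn
  set L := max L₀ 1
  have hL1 : 1 ≤ L := le_max_right _ _
  have hL : ∀ s ∈ Icc (-m) m, |deriv A s| ≤ L := fun s hs => (hL₀ s hs).trans (le_max_left _ _)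
  obtain ⟨C, hC0, hCl⟩ := exists_lipschitz_of_hasDerivAt (fun u => (dA' u).hasDerivAt) cA'' m
  obtain ⟨θ, hθ, hgap⟩ := exists_meanSpeed_gap ca hstrict hC hC0 hCl hCR hCL
  obtain ⟨C₂, hC₂, hpos⟩ := IsViscousSolution.exists_sq_shift_sub_le hA hC hL1 hL hCL hCR
  -- An increment `c₁` changes the mean speeds by at most `C * c₁ ≤ θ`; the `1` guards against `C =
  -- 0`. Below, `h₀` is chosen so that `|K| * √h ≤ c₁` for `h ≤ h₀`, and `ε₀` so that the layers fit
  -- into the distance `h₀`.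
  set c₁ := θ / (C + 1) with hc₁
  have hc₁0 : 0 < c₁ := by positivity
  have hCc : C * c₁ ≤ θ := by
    rw [hc₁, mul_div_assoc', div_le_iff₀ (by positivity)]
    nlinarith
  set h₀ := (c₁ / (|K| + 1)) ^ 2 with hh₀
  have hK0 := abs_nonneg K
  have hh₀0 : 0 < h₀ := by positivity
  obtain ⟨ε₀, hε₀, hε₀1, hε₀p⟩ := exists_mul_log_le (η := h₀ * θ / 4) (by positivity)
  refine ⟨ε₀, hε₀, fun T hT => ?_⟩
  set C₁ := 2 * (2 * m) ^ 2 * (24 / θ) + 2 * (2 * L + θ) * (2 * m) ^ 2 * (1 + 8 * T) with hC₁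
  have hL0 : 0 < L := by linarith
  have hC₁0 : 0 ≤ C₁ := by positivity
  have hT3 : 0 < T ^ (1 / 3 : ℝ) := Real.rpow_pos_of_pos hT _
  set D := C₂ * (1 + C₁) * T ^ (1 / 3 : ℝ) with hD
  have hD0 : 0 ≤ D := by positivity
  have hLL : 0 ≤ (2 * L) ^ 2 := sq_nonneg _
  -- The summands serve the energy, the speed of the shift, the position for `t < ε`, and the
  -- position for `ε ≤ t`.
  refine ⟨C₁ + L + (2 * L) ^ 2 + D, by positivity, ?_⟩
  intro U₀ g hU₀ hU₀M hS hg hg2 hgK ε hε hεε₀ U hU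
  have hε1 : ε ≤ Real.exp (-1) := hεε₀.trans hε₀1
  have hεone : ε ≤ 1 := hε1.trans (Real.exp_le_one_iff.2 (by norm_num))
  have hlog := le_mul_log_of_le_exp hε hε1
  have hplog := hε₀p ε hε hεε₀
  have hM₀ : ∀ᵐ x, |U₀ x| ≤ |M| := ae_abs_le_of_eLpNorm_top_le hM0
    (hU₀M.trans (ENNReal.ofReal_le_ofReal (le_abs_self M)))
  have hm₀ : ∀ᵐ x, |U₀ x| ≤ m := hM₀.mono fun x hx => by linarith
  have hm : ∀ t > 0, ∀ x, |U t x| ≤ m := fun t ht x =>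
    hU.abs_le_of_initial hA hε.le hU₀.1 hm0 hm₀ ht x
  have hmod : ∀ h ∈ Ioc 0 h₀, ∀ᵐ x, U₀ (x + h) - U₀ x ≤ c₁ := by
    intro h hh
    filter_upwards [increment_le_of_isDerivPosPart hg hg2 hK0
      (hgK.trans (ENNReal.ofReal_le_ofReal (le_abs_self K))) hh.1] with x hx
    refine hx.trans ?_
    have h1 : √h ≤ c₁ / (|K| + 1) := Real.sqrt_le_iff.2 ⟨by positivity, hh.2⟩
    calc |K| * √h ≤ (|K| + 1) * (c₁ / (|K| + 1)) := by gcongr; linarith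
      _ = c₁ := by field_simp
  set p := ε * Real.log (1 / ε) with hp
  set S₀ := sqL2Norm (fun x => U₀ x - shockProfile C_L C_R x) with hS₀
  have hS₀0 : 0 ≤ S₀ := sq_nonneg _
  have hp0 : 0 < p := hε.trans_le hlog
  obtain ⟨X, v, cX, hX0, hX, hvL, hE⟩ := hU.exists_shift_energy_le hA hstrict.monotone hε hεone
    hlog hU₀.1 hT hm hm₀ hCL hCR hL hC0 hCl hθ hgap hc₁0.le hCc hmod
    (by rw [div_le_iff₀ hθ]; linarith) hS
  refine ⟨X, cX, hX0, fun t ht => ⟨(hE t ht).1, (hE t ht).2.trans ?_, (hX t ht).differentiableAt,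
    ?_, ?_⟩⟩
  · have : C₁ * p ≤ (C₁ + L + (2 * L) ^ 2 + D) * p := by
      gcongr
      linarith
    linarith
  · rw [(hX t ht).deriv]
    exact (hvL t ht).trans (by linarith)
  · have ht0 : 0 < t := ht.1
    have ht3 : 0 < t ^ (2 / 3 : ℝ) := Real.rpow_pos_of_pos ht0 _
    have hsplit : t = t ^ (2 / 3 : ℝ) * t ^ (1 / 3 : ℝ) := by
      rw [← Real.rpow_add ht0]
      norm_num
    -- For `ε ≤ t` the mass balance gives the factor `t`, and `t ≤ t ^ (2/3) * T ^ (1/3)`. For `t <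
    -- ε` both curves move with speed at most `L`; one factor of `t ^ 2` is at most `ε ≤ ε * log (1
    -- / ε)`, the other at most `t ^ (2/3)` because `t ≤ 1`.
    rcases le_or_gt ε t with hεt | hεt
    · have h1 := hpos (Q := S₀ + C₁ * p) hU hε.le hU₀.1 hm hm₀ cX hX0 hX hvL hS
        (by linarith [mul_nonneg hC₁0 hp0.le]) (fun s hs => (hE s hs).1) (fun s hs => (hE s hs).2)
        t ht hεt
      have h2 : S₀ + C₁ * p ≤ (1 + C₁) * (S₀ + p) := by
        have := mul_nonneg hC₁0 hS₀0
        linarith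
      have h3 : t ≤ t ^ (2 / 3 : ℝ) * T ^ (1 / 3 : ℝ) := by
        conv_lhs => rw [hsplit]
        gcongr
        exact ht.2.le
      calc _ ≤ C₂ * (t * (S₀ + C₁ * p)) := h1
        _ ≤ C₂ * ((t ^ (2 / 3 : ℝ) * T ^ (1 / 3 : ℝ)) * ((1 + C₁) * (S₀ + p))) := by gcongr
        _ = D * t ^ (2 / 3 : ℝ) * (S₀ + p) := by rw [hD]; ring
        _ ≤ _ := by
          gcongr
          linarith
    · have h1 := abs_le_mul_of_abs_deriv_le cX hX0 hX hvL ht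
      have h2 := abs_shockSpeed_le dA hC hL hCL hCR
      have h3 : |X t - shockSpeed A C_L C_R * t| ≤ 2 * L * t := by
        refine (abs_sub _ _).trans ?_
        rw [abs_mul, abs_of_pos ht0]
        have := mul_le_mul_of_nonneg_right h2 ht0.le
        linarith
      have h4 : t ≤ t ^ (2 / 3 : ℝ) := by
        conv_lhs => rw [← Real.rpow_one t]
        exact Real.rpow_le_rpow_of_exponent_ge ht0 (hεt.le.trans hεone) (by norm_num)
      calc _ ≤ (2 * L * t) ^ 2 := by gcongr
        _ = (2 * L) ^ 2 * t * t := by ring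
        _ ≤ (2 * L) ^ 2 * t ^ (2 / 3 : ℝ) * (S₀ + p) := by
          have : t ≤ S₀ + p := by linarith
          gcongr
        _ ≤ _ := by
          gcongr
          linarith
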